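/- Let $B(x;y,z)\Leftrightarrow (y<x<z)\vee(z<x<y)$ be the betweenness relation on $\mathbb{Q}$, and let $G=\mathrm{Aut}(\mathbb{Q},B)$ carry the topology of pointwise convergence ($\mathbb{Q}$ discrete). Let $\rho\in G\setminus \mathrm{Aut}(\mathbb{Q},<)$, that is, $\rho$ is an automorphism of $(\mathbb{Q},B)$ that reverses the order. Let $\mathcal{C}_\rho$ be the closure in $G$ of the conjugacy class of $\rho$, and let $\mathcal{P}_\rho$ be the family of all finite partial isomorphisms of $(\mathbb{Q},B)$ that extend to an automorphism from $\mathcal{C}_\rho$, ordered by extension of maps; $G$ acts on it by $\alpha(p)=\{(\alpha(x),\alpha(y)) : (x,y)\in p\}$. Then $\mathcal{P}_\rho$ contains a cofinal, $G$-invariant subfamily $\mathcal{F}$ with the amalgamation property: for all $p_0,p_1,p_2\in\mathcal{F}$ with $p_0\subseteq p_1$ and $p_0\subseteq p_2$ there are $p_3\in\mathcal{F}$ and $\alpha\in G$ fixing $\mathrm{Dom}(p_0)\cup\mathrm{Rng}(p_0)$ pointwise such that $p_1\subseteq p_3$ and $\alpha(p_2)\subseteq p_3$. Moreover, $\mathcal{C}_\rho$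 contains a generic automorphism, that is, some $\gamma\in\mathcal{C}_\rho$ whose conjugacy class in $G$ is comeagre in $\mathcal{C}_\rho$. -/

import Mathlib

/-- The topology of pointwise convergence on the permutations of a set `X`, where `X` itself
carries the discrete topology. Subgroups of `Equiv.Perm X` carry the subspace topology. -/
instance permPointwiseTopology (X : Type*) : TopologicalSpace (Equiv.Perm X) :=
  TopologicalSpace.induced (fun g : Equiv.Perm X => (g : X → X))
    (@Pi.topologicalSpace X (fun _ => X) (fun _ => ⊥))

/-! ### Conjugacy classes and generic elements in a permutation group -/

/-- `C_ρ`: the closure in `G` of the conjugacy class of `ρ`, which is the least closed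
conjugation-invariant subset of `G` that contains `ρ`. -/
def conjClosure {X : Type*} {G : Subgroup (Equiv.Perm X)} (ρ : G) : Set G :=
  closure (conjugatesOf ρ)

/-- `γ` is generic in `C ⊆ G` if the `G`-conjugacy class of `γ` is comeagre in the subspace `C`. -/
def IsGenericIn {X : Type*} {G : Subgroup (Equiv.Perm X)} (C : Set G) (γ : G) : Prop :=
  ((↑) : C → G) ⁻¹' conjugatesOf γ ∈ residual C

/-! ### Finite partial maps, given by their graphs -/

/-- The action of a permutation `α` on finite partial maps: `(x, y) ∈ p` becomes `(α x, α y)`. -/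
def permAct {X : Type*} (α : Equiv.Perm X) (p : Finset (X × X)) : Finset (X × X) :=
  p.map (α.prodCongr α).toEmbedding

/-- The permutation `γ` extends the finite partial map `p`. -/
def ExtendsPartial {X : Type*} (γ : Equiv.Perm X) (p : Finset (X × X)) : Prop :=
  ∀ e ∈ p, γ e.1 = e.2

/-- `α` fixes `Dom p ∪ Rng p` pointwise. -/
def FixesSupport {X : Type*} (α : Equiv.Perm X) (p : Finset (X × X)) : Prop :=
  ∀ e ∈ p, α e.1 = e.1 ∧ α e.2 = e.2

/-- The family `F` of finite partial maps is invariant under the action of `G`. -/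
def InvariantFamily {X : Type*} (G : Subgroup (Equiv.Perm X)) (F : Set (Finset (X × X))) : Prop :=
  ∀ α ∈ G, ∀ p ∈ F, permAct α p ∈ F

/-- The amalgamation property of a family `F` of finite partial maps, with respect to `G`. -/
def HasAmalgamation {X : Type*} (G : Subgroup (Equiv.Perm X)) (F : Set (Finset (X × X))) : Prop :=
  ∀ p₀ ∈ F, ∀ p₁ ∈ F, ∀ p₂ ∈ F, p₀ ⊆ p₁ → p₀ ⊆ p₂ →
    ∃ p₃ ∈ F, ∃ α ∈ G, FixesSupport α p₀ ∧ p₁ ⊆ p₃ ∧ permAct α p₂ ⊆ p₃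

/-- `F` is a cofinal subfamily of `P` with respect to extension of maps. -/
def CofinalSubfamily {X : Type*} (F P : Set (Finset (X × X))) : Prop :=
  F ⊆ P ∧ ∀ p ∈ P, ∃ q ∈ F, p ⊆ q

/-! ### The betweenness relation of the rationals -/

/-- The linear betweenness relation `B(x; y, z)` on `ℚ`: `x` lies strictly between `y` and `z`. -/
def ratBetween (x y z : ℚ) : Prop := (y < x ∧ x < z) ∨ (z < x ∧ x < y)

/-- `Aut(ℚ, B)`. -/
def autRatBetween : Subgroup (Equiv.Perm ℚ) where
  carrier := {g | ∀ x y z, ratBetween (g x) (g y) (g z) ↔ ratBetween x y z}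
  mul_mem' := by
    intro a b ha hb x y z
    exact (ha (b x) (b y) (b z)).trans (hb x y z)
  one_mem' := fun _ _ _ => Iff.rfl
  inv_mem' := by
    intro a ha x y z
    simpa using (ha (a⁻¹ x) (a⁻¹ y) (a⁻¹ z)).symm

/-- `Aut(ℚ, <)`. -/
def autRatLt : Subgroup (Equiv.Perm ℚ) where
  carrier := {g | ∀ x y, g x < g y ↔ x < y}
  mul_mem' := by
    intro a b ha hb x y
    exact (ha (b x) (b y)).trans (hb x y)
  one_mem' := fun _ _ => Iff.rfl
  inv_mem' := by
    intro a ha x y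
    simpa using (ha (a⁻¹ x) (a⁻¹ y)).symm

/-- `p` is the graph of a finite partial isomorphism of `(ℚ, B)`: an injective partial map that
preserves and reflects betweenness. -/
def IsFinPartialIso (p : Finset (ℚ × ℚ)) : Prop :=
  (∀ a ∈ p, ∀ b ∈ p, a.1 = b.1 ↔ a.2 = b.2) ∧
    ∀ a ∈ p, ∀ b ∈ p, ∀ c ∈ p, ratBetween a.1 b.1 c.1 ↔ ratBetween a.2 b.2 c.2

/-- `P_ρ`: the finite partial isomorphisms of `(ℚ, B)` that extend to an automorphism
from `C_ρ`. -/
def partialIsos (ρ : autRatBetween) : Set (Finset (ℚ × ℚ)) :=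
  {p | IsFinPartialIso p ∧ ∃ γ ∈ conjClosure ρ, ExtendsPartial (γ : Equiv.Perm ℚ) p}

/-! ### Back and forth -/

/-! Reduction to a homogeneity criterion. Call a finite restriction of `γ` homogeneous if each of
its embeddings into `γ` agrees with an element of the centralizer of `γ`. Suppose `γ` has the same
conjugacy closure as `ρ` and every finite restriction of `γ` extends to a homogeneous one. Then the
maps with a homogeneous copy in `γ` form the required family: any two copies in `γ` of such a map
are matched by the centralizer, so two extensions can be placed together inside `γ` over their
common part (`homogeneousFamily_amalgamation`). Countably many open dense conditions say that `δ`
has the same extension properties as `γ`, and back and forth then conjugates `γ` to `δ`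
(`IsExtensive.exists_conj`), so `γ` is generic.

Reduction to order automorphisms. A reversal `ρ` is controlled by its square `σ` on the right half
`R = {x | ρ x < x}`, a countable dense order without endpoints. Maps of `R` that respect the squares
double to maps of the line that respect the reversals (`doubleMap`), and every order automorphism of
`R` is the square of a reversal with the same right half (`IsReversal.exists_replace`). So it
suffices to find `τ` with the same finite restrictions as `σ`, up to isomorphism, in which each
finite set lies in a finite determining set, one whose partial embeddings all extend to elements of
the centralizer of `τ`.

Construction of `τ`. Colour each point by the direction in which `σ` moves it. The order splits into
finitely many convex invariant pieces, each a single point or realizing every finite word in its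
colours (`exists_cutsInto_of_colours`). Finite restrictions see only such words: successive points
moved in one direction can be placed in the hull of a single orbit
(`exists_age_map_of_strictMonoOn`). Hence a piece may be replaced by one orbit hull, if it has a
single colour other than `.eq`, or by a dense shuffle of hulls of all its colours. In the resulting
sum a finite set becomes determining once it has suitable end points in every piece, separators
between distinct orbits of the same colour, and long enough segments of its orbits
(`IsShuffleSum.hasDeterminingSets`). -/

theorem exists_equiv_of_back_and_forth {α β : Type*} [Countable α] [Countable β]
    (I : Finset (α × β) → Prop)
    (hI : ∀ p, I p → ∀ e ∈ p, ∀ e' ∈ p, e.1 = e'.1 ↔ e.2 = e'.2)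
    (forth : ∀ p, I p → ∀ a, ∃ b q, p ⊆ q ∧ I q ∧ (a, b) ∈ q)
    (back : ∀ p, I p → ∀ b, ∃ a q, p ⊆ q ∧ I q ∧ (a, b) ∈ q)
    (p₀ : Finset (α × β)) (h₀ : I p₀) :
    ∃ e : α ≃ β, (∀ x ∈ p₀, e x.1 = x.2) ∧
      ∀ s : Finset α, ∃ q, I q ∧ (∀ x ∈ s, (x, e x) ∈ q) ∧ ∀ x ∈ q, e x.1 = x.2 := by
  classical
  have := Encodable.ofCountable α
  have := Encodable.ofCountable β
  let D : α ⊕ β → Order.Cofinal {p // I p} := Sum.elim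
    (fun a => ⟨{q | ∃ b, (a, b) ∈ q.1}, fun p => by
      obtain ⟨b, q, hpq, hq, hab⟩ := forth p.1 p.2 a
      exact ⟨⟨q, hq⟩, ⟨b, hab⟩, hpq⟩⟩)
    (fun b => ⟨{q | ∃ a, (a, b) ∈ q.1}, fun p => by
      obtain ⟨a, q, hpq, hq, hab⟩ := back p.1 p.2 b
      exact ⟨⟨q, hq⟩, ⟨a, hab⟩, hpq⟩⟩)
  -- A directed family meeting the countably many cofinal sets "`a` is in the domain" and "`b` is in
  -- the range"; its union is the graph of the bijection.
  let J := Order.idealOfCofinals (⟨p₀, h₀⟩ : {p // I p}) D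
  have hf : ∀ a, ∃ b, ∃ q ∈ J, (a, b) ∈ q.1 := fun a => by
    obtain ⟨q, ⟨b, hb⟩, hq⟩ := Order.cofinal_meets_idealOfCofinals (⟨p₀, h₀⟩ : {p // I p}) D (.inl a)
    exact ⟨b, q, hq, hb⟩
  have hg : ∀ b, ∃ a, ∃ q ∈ J, (a, b) ∈ q.1 := fun b => by
    obtain ⟨q, ⟨a, ha⟩, hq⟩ := Order.cofinal_meets_idealOfCofinals (⟨p₀, h₀⟩ : {p // I p}) D (.inr b)
    exact ⟨a, q, hq, ha⟩
  choose f hf using hf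
  choose g hg using hg
  have key : ∀ a b a' b', (∃ q ∈ J, (a, b) ∈ q.1) → (∃ q ∈ J, (a', b') ∈ q.1) →
      (a = a' ↔ b = b') := by
    rintro a b a' b' ⟨q, hq, h⟩ ⟨q', hq', h'⟩
    obtain ⟨r, -, h1, h2⟩ := J.directed q hq q' hq'
    exact hI r.1 r.2 _ (h1 h) _ (h2 h')
  refine ⟨⟨f, g, fun a => (key _ _ _ _ (hg (f a)) (hf a)).2 rfl,
    fun b => (key _ _ _ _ (hf (g b)) (hg b)).1 rfl⟩, fun x hx => ?_, fun s => ?_⟩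
  · exact (key _ _ _ _ (hf x.1) ⟨_, Order.mem_idealOfCofinals _ D, hx⟩).1 rfl
  · have : ∃ q ∈ J, ∀ x ∈ s, (x, f x) ∈ q.1 := by
      induction s using Finset.induction_on with
      | empty => exact ⟨_, Order.mem_idealOfCofinals _ D, by simp⟩
      | insert a s _ ih =>
        obtain ⟨q, hq, h⟩ := ih
        obtain ⟨q', hq', h'⟩ := hf a
        obtain ⟨r, hr, h1, h2⟩ := J.directed q hq q' hq'
        refine ⟨r, hr, fun x hx => ?_⟩
        rcases Finset.mem_insert.1 hx with rfl | hx
        · exact h2 h'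
        · exact h1 (h x hx)
    obtain ⟨q, hq, h⟩ := this
    exact ⟨q.1, q.2, h, fun x hx => (key _ _ _ _ (hf x.1) ⟨q, hq, hx⟩).1 rfl⟩

/-! ### Orbits of order automorphisms -/

section Orbits

variable {α : Type*} [LinearOrder α] (σ : α ≃o α)

/-- The direction in which `σ` moves `x`. -/
def orbSign (x : α) : Ordering := cmp x (σ x)

/-- The whole `σ`-orbit of `x` lies below `y`. -/
def Far (x y : α) : Prop := ∀ k : ℤ, (σ ^ k) x < y

variable {σ}

theorem zpow_apply_add (j k : ℤ) (x : α) : (σ ^ (j + k)) x = (σ ^ j) ((σ ^ k) x) := by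
  rw [zpow_add]; rfl

theorem cmp_zpow_zpow (j k : ℤ) (x y : α) :
    cmp ((σ ^ j) x) ((σ ^ k) y) = cmp ((σ ^ (j - k)) x) y := by
  conv_lhs => rw [show j = k + (j - k) by ring, zpow_apply_add]
  exact (σ ^ k).strictMono.cmp_map_eq _ _

theorem zpow_lt_zpow_iff (j k : ℤ) (x y : α) :
    (σ ^ j) x < (σ ^ k) y ↔ (σ ^ (j - k)) x < y := by
  rw [← cmp_eq_lt_iff, cmp_zpow_zpow, cmp_eq_lt_iff]

theorem zpow_le_zpow_iff (j k : ℤ) (x y : α) :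
    (σ ^ j) x ≤ (σ ^ k) y ↔ (σ ^ (j - k)) x ≤ y := by
  conv_lhs => rw [show j = k + (j - k) by ring, zpow_apply_add]
  exact (σ ^ k).le_iff_le

theorem lt_zpow_iff (k : ℤ) (x y : α) : x < (σ ^ k) y ↔ (σ ^ (-k)) x < y := by
  simpa using zpow_lt_zpow_iff 0 k x y

theorem le_zpow_iff (k : ℤ) (x y : α) : x ≤ (σ ^ k) y ↔ (σ ^ (-k)) x ≤ y := by
  simpa using zpow_le_zpow_iff 0 k x y

theorem zpow_le_iff (k : ℤ) (x y : α) : (σ ^ k) x ≤ y ↔ x ≤ (σ ^ (-k)) y := by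
  rw [le_zpow_iff, neg_neg]

theorem orbSign_eq_lt {x : α} : orbSign σ x = .lt ↔ x < σ x := cmp_eq_lt_iff _ _
theorem orbSign_eq_eq {x : α} : orbSign σ x = .eq ↔ x = σ x := cmp_eq_eq_iff _ _
theorem orbSign_eq_gt {x : α} : orbSign σ x = .gt ↔ σ x < x := cmp_eq_gt_iff _ _

theorem orbSign_zpow (k : ℤ) (x : α) : orbSign σ ((σ ^ k) x) = orbSign σ x := by
  have : σ ((σ ^ k) x) = (σ ^ k) (σ x) := by
    have h1 := zpow_apply_add (σ := σ) 1 k x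
    have h2 := zpow_apply_add (σ := σ) k 1 x
    rw [zpow_one] at h1 h2
    rw [← h1, ← h2, add_comm]
  rw [orbSign, this]
  exact (σ ^ k).strictMono.cmp_map_eq _ _

theorem orbSign_apply (x : α) : orbSign σ (σ x) = orbSign σ x := by
  simpa using orbSign_zpow (σ := σ) 1 x

theorem orbSign_inv (x : α) : orbSign σ⁻¹ x = (orbSign σ x).swap := by
  rw [orbSign, orbSign, cmp_swap, ← σ.strictMono.cmp_map_eq]
  congr 1
  exact σ.apply_symm_apply x

theorem far_inv {x y : α} : Far σ⁻¹ x y ↔ Far σ x y := by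
  constructor <;> intro h k <;> simpa using h (-k)

theorem Far.lt {x y : α} (h : Far σ x y) : x < y := by simpa using h 0

theorem Far.zpow_left {x y : α} (h : Far σ x y) (j : ℤ) : Far σ ((σ ^ j) x) y := fun k => by
  rw [← zpow_apply_add]; exact h _

theorem Far.zpow_right {x y : α} (h : Far σ x y) (j : ℤ) : Far σ x ((σ ^ j) y) := fun k => by
  rw [zpow_lt_zpow_iff]; exact h _

theorem Far.trans {x y z : α} (h : Far σ x y) (h' : Far σ y z) : Far σ x z := fun k =>
  (h k).trans h'.lt

theorem Far.trans_le {x y z : α} (h : Far σ x y) (h' : y ≤ z) : Far σ x z := fun k =>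
  (h k).trans_le h'

theorem Far.le_trans {x y z : α} (h' : x ≤ y) (h : Far σ y z) : Far σ x z := fun k =>
  ((σ ^ k).monotone h').trans_lt (h k)

theorem zpow_strictMono {x : α} (h : x < σ x) : StrictMono fun k : ℤ => (σ ^ k) x := by
  refine strictMono_int_of_lt_succ fun k => ?_
  have : (σ ^ (k + 1)) x = (σ ^ k) (σ x) := by simpa using zpow_apply_add (σ := σ) k 1 x
  simp only [this]
  exact (σ ^ k).strictMono h

theorem zpow_eq_self {x : α} (h : x = σ x) (k : ℤ) : (σ ^ k) x = x := by
  have hs : ∀ k : ℤ, (σ ^ (k + 1)) x = (σ ^ k) x := fun k => by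
    have := zpow_apply_add (σ := σ) k 1 x
    rwa [zpow_one, ← h] at this
  induction k using Int.induction_on with
  | zero => simp
  | succ i ih => rw [hs]; exact ih
  | pred i ih =>
    have := hs (-i - 1)
    rw [sub_add_cancel] at this
    rw [← this, ih]

theorem exists_zpow_le_lt {x y : α} (hx : x < σ x) (h1 : ¬ Far σ x y) (h2 : ¬ Far σ y x) :
    ∃ m : ℤ, (σ ^ m) x ≤ y ∧ y < (σ ^ (m + 1)) x := by
  simp only [Far, not_forall, not_lt] at h1 h2
  obtain ⟨k, hk⟩ := h1
  obtain ⟨j, hj⟩ := h2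
  obtain ⟨m, hm, hmax⟩ := Int.exists_greatest_of_bdd (P := fun m => (σ ^ m) x ≤ y)
    ⟨k, fun z hz => (zpow_strictMono hx).le_iff_le.1 (hz.trans hk)⟩
    ⟨-j, by rwa [zpow_le_iff, neg_neg]⟩
  refine ⟨m, hm, not_le.1 fun h => ?_⟩
  have := hmax _ h
  omega

theorem eq_of_not_far {x y : α} (hx : x = σ x) (h1 : ¬ Far σ x y) (h2 : ¬ Far σ y x) : x = y := by
  simp only [Far, not_forall, not_lt] at h1 h2
  obtain ⟨k, hk⟩ := h1
  obtain ⟨j, hj⟩ := h2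
  rw [le_zpow_iff, zpow_eq_self hx] at hj
  rw [zpow_eq_self hx] at hk
  exact le_antisymm hj hk

theorem orbSign_eq_lt_of_not_far {x y : α} (hx : x < σ x) (h1 : ¬ Far σ x y)
    (h2 : ¬ Far σ y x) : y < σ y := by
  obtain ⟨m, hm, hm'⟩ := exists_zpow_le_lt hx h1 h2
  refine hm'.trans_le ?_
  have := σ.monotone hm
  rw [add_comm, zpow_apply_add, zpow_one]
  exact this

/-- If neither orbit lies wholly beyond the other point, both points have the same orbit hull, and a
hull is moved in one direction only. -/
theorem orbSign_eq_of_not_far {x y : α} (h1 : ¬ Far σ x y) (h2 : ¬ Far σ y x) :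
    orbSign σ y = orbSign σ x := by
  rcases h : orbSign σ x with _ | _ | _
  · exact orbSign_eq_lt.2 (orbSign_eq_lt_of_not_far (orbSign_eq_lt.1 h) h1 h2)
  · rw [← eq_of_not_far (orbSign_eq_eq.1 h) h1 h2, h]
  · have h' : orbSign σ⁻¹ x = .lt := by rw [orbSign_inv, h]; rfl
    rw [← far_inv] at h1 h2
    have := orbSign_eq_lt.2 (orbSign_eq_lt_of_not_far (orbSign_eq_lt.1 h') h1 h2)
    rw [orbSign_inv] at this
    exact Ordering.swap_inj.1 this

/-- This is how finite data force separation of orbits: a change of colour, or a fixed point, cannot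
occur between two points of one hull. -/
theorem far_of_lt {x y : α} (h : x < y) (hc : orbSign σ x ≠ orbSign σ y ∨ orbSign σ x = .eq) :
    Far σ x y := by
  by_contra h1
  have h2 : ¬ Far σ y x := fun h2 => h.not_gt h2.lt
  rcases hc with hc | hc
  · exact hc (orbSign_eq_of_not_far h1 h2).symm
  · exact h.ne (eq_of_not_far (orbSign_eq_eq.1 hc) h1 h2)

theorem not_far_self {x : α} : ¬ Far σ x x := fun h => lt_irrefl _ h.lt

/-- The two orbit points next to a point `z` of the convex hull of an orbit. -/
theorem exists_neighbours {x z : α} (h1 : ¬ Far σ x z) (h2 : ¬ Far σ z x)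
    (hz : ∀ k : ℤ, (σ ^ k) x ≠ z) :
    ∃ j k : ℤ, (σ ^ j) x < z ∧ z < (σ ^ k) x ∧ ∀ i : ℤ, (σ ^ i) x ≤ (σ ^ j) x ∨ (σ ^ k) x ≤ (σ ^ i) x := by
  have main : ∀ τ : α ≃o α, x < τ x → ¬ Far τ x z → ¬ Far τ z x → (∀ k : ℤ, (τ ^ k) x ≠ z) →
      ∃ j k : ℤ, (τ ^ j) x < z ∧ z < (τ ^ k) x ∧
        ∀ i : ℤ, (τ ^ i) x ≤ (τ ^ j) x ∨ (τ ^ k) x ≤ (τ ^ i) x := by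
    intro τ hx h1 h2 hz
    obtain ⟨m, hm, hm'⟩ := exists_zpow_le_lt hx h1 h2
    refine ⟨m, m + 1, hm.lt_of_ne (hz m), hm', fun i => ?_⟩
    have := (zpow_strictMono hx).monotone
    rcases le_or_gt i m with hi | hi
    · exact .inl (this hi)
    · exact .inr (this (by omega : m + 1 ≤ i))
  rcases h : orbSign σ x with _ | _ | _
  · exact main σ (orbSign_eq_lt.1 h) h1 h2 hz
  · exact absurd (eq_of_not_far (orbSign_eq_eq.1 h) h1 h2) (by simpa using hz 0)
  · have h' : orbSign σ⁻¹ x = .lt := by rw [orbSign_inv, h]; rfl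
    rw [← far_inv] at h1 h2
    obtain ⟨j, k, h3, h4, h5⟩ := main σ⁻¹ (orbSign_eq_lt.1 h') h1 h2 fun k => by
      simpa using hz (-k)
    refine ⟨-j, -k, by simpa using h3, by simpa using h4, fun i => by simpa using h5 (-i)⟩

theorem cmp_zpow_self {x : α} (h : x < σ x) (k : ℤ) : cmp ((σ ^ k) x) x = cmp k 0 := by
  simpa using (zpow_strictMono h).cmp_map_eq k 0

/-- The direction alone fixes the order of an orbit: increasing, constant or decreasing in the
exponent. -/
theorem cmp_zpow_self_eq {β : Type*} [LinearOrder β] {τ : β ≃o β} {x : α} {y : β}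
    (h : orbSign σ x = orbSign τ y) (k : ℤ) : cmp ((σ ^ k) x) x = cmp ((τ ^ k) y) y := by
  rcases hx : orbSign σ x with _ | _ | _ <;> rw [hx] at h
  · rw [cmp_zpow_self (orbSign_eq_lt.1 hx), cmp_zpow_self (orbSign_eq_lt.1 h.symm)]
  · rw [zpow_eq_self (orbSign_eq_eq.1 hx), zpow_eq_self (orbSign_eq_eq.1 h.symm)]
    simp
  · have h1 : orbSign σ⁻¹ x = .lt := by rw [orbSign_inv, hx]; rfl
    have h2 : orbSign τ⁻¹ y = .lt := by rw [orbSign_inv, ← h]; rfl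
    have e1 := cmp_zpow_self (orbSign_eq_lt.1 h1) (-k)
    have e2 := cmp_zpow_self (orbSign_eq_lt.1 h2) (-k)
    simp only [inv_zpow', neg_neg] at e1 e2
    rw [e1, e2]

end Orbits

/-! ### Automorphisms that are finite sums of shuffles -/

/-- The shape of a finite sum of `n` invariant pieces: the piece `i` is a single fixed point
if `sg i`, and otherwise its points are moved in the directions from `A i`. -/
structure SumShape where
  n : ℕ
  A : ℕ → Set Ordering
  sg : ℕ → Prop

/-- The piece `i` is to be a shuffle: it is neither a single point nor a single infinite orbit
hull. -/
def SumShape.IsDense (S : SumShape) (i : ℕ) : Prop := ¬ S.sg i ∧ ∀ s, s ≠ .eq → S.A i ≠ {s}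

/-- `π` decomposes the order into convex `σ`-invariant pieces as described by the shape `S`. -/
structure IsPlacement {α : Type*} [LinearOrder α] (S : SumShape) (σ : α ≃o α) (π : α → ℕ) :
    Prop where
  mono : Monotone π
  lt : ∀ x, π x < S.n
  inv : ∀ x, π (σ x) = π x
  sgn : ∀ x, orbSign σ x ∈ S.A (π x)
  single : ∀ x y, S.sg (π x) → π x = π y → x = y

/-- The pieces are single orbit hulls, or shuffles of orbit hulls of all admitted directions. -/
structure IsShuffleSum {α : Type*} [LinearOrder α] (S : SumShape) (σ : α ≃o α) (π : α → ℕ) : Prop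
    extends IsPlacement S σ π where
  uniq : ∀ x y, π x = π y → Far σ x y → S.IsDense (π x)
  ext : ∀ i < S.n, ∀ s ∈ S.A i, ∀ L U : Finset α, (∀ a ∈ L, ∀ b ∈ U, Far σ a b) →
    (∀ a ∈ L, π a ≤ i ∧ (π a = i → S.IsDense i)) →
    (∀ b ∈ U, i ≤ π b ∧ (π b = i → S.IsDense i)) →
    ∃ z, π z = i ∧ orbSign σ z = s ∧ (∀ a ∈ L, Far σ a z) ∧ ∀ b ∈ U, Far σ z b

/-! ### Extension of finite orbit isomorphisms -/

section

variable {α β : Type*} [LinearOrder α] [LinearOrder β] {S : SumShape} {σ : α ≃o α} {τ : β ≃o β}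
  {π : α → ℕ} {π' : β → ℕ}

theorem IsPlacement.zpow (h : IsPlacement S σ π) (k : ℤ) (x : α) : π ((σ ^ k) x) = π x := by
  induction k using Int.induction_on generalizing x with
  | zero => simp
  | succ i ih => rw [zpow_apply_add, ih, zpow_one, h.inv]
  | pred i ih =>
    have hx : σ ((σ ^ (-1 : ℤ)) x) = x := by rw [zpow_neg_one]; exact σ.apply_symm_apply x
    rw [sub_eq_add_neg, zpow_apply_add, ih, ← h.inv, hx]

theorem IsPlacement.eq_of_not_far (h : IsPlacement S σ π) {x y : α} (h1 : ¬ Far σ x y)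
    (h2 : ¬ Far σ y x) : π x = π y := by
  simp only [Far, not_forall, not_lt] at h1 h2
  obtain ⟨k, hk⟩ := h1
  obtain ⟨j, hj⟩ := h2
  have := h.mono hk
  have := h.mono hj
  rw [h.zpow] at *
  omega

/-- A finite correspondence that extends to an equivariant order isomorphism between unions of
orbits, compatible with the pieces. -/
def OrbitIso (σ : α ≃o α) (τ : β ≃o β) (π : α → ℕ) (π' : β → ℕ) (u : Finset (α × β)) : Prop :=
  (∀ e ∈ u, ∀ e' ∈ u, ∀ k : ℤ, cmp ((σ ^ k) e.1) e'.1 = cmp ((τ ^ k) e.2) e'.2) ∧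
    ∀ e ∈ u, π e.1 = π' e.2

theorem OrbitIso.lt_iff {u : Finset (α × β)} (h : OrbitIso σ τ π π' u) {e e' : α × β}
    (he : e ∈ u) (he' : e' ∈ u) (j k : ℤ) :
    (σ ^ j) e.1 < (σ ^ k) e'.1 ↔ (τ ^ j) e.2 < (τ ^ k) e'.2 := by
  rw [zpow_lt_zpow_iff, zpow_lt_zpow_iff, ← cmp_eq_lt_iff, ← cmp_eq_lt_iff, h.1 e he e' he']

theorem OrbitIso.far {u : Finset (α × β)} (h : OrbitIso σ τ π π' u) {e e' : α × β}
    (he : e ∈ u) (he' : e' ∈ u) : Far σ e.1 e'.1 ↔ Far τ e.2 e'.2 :=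
  forall_congr' fun k => by simpa using h.lt_iff he he' k 0

theorem cmp_zpow_symm (k : ℤ) (x y : α) : cmp ((σ ^ k) x) y = (cmp ((σ ^ (-k)) y) x).swap := by
  rw [cmp_swap, ← (σ ^ (-k)).strictMono.cmp_map_eq, ← zpow_apply_add]
  simp

theorem OrbitIso.insert [DecidableEq (α × β)] {u : Finset (α × β)} (h : OrbitIso σ τ π π' u)
    {z : α} {w : β} (h1 : ∀ e ∈ u, ∀ k : ℤ, cmp ((σ ^ k) e.1) z = cmp ((τ ^ k) e.2) w)
    (h2 : orbSign σ z = orbSign τ w) (h3 : π z = π' w) :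
    OrbitIso σ τ π π' (insert (z, w) u) := by
  refine ⟨fun e he e' he' k => ?_, fun e he => ?_⟩
  · rcases Finset.mem_insert.1 he with rfl | he <;> rcases Finset.mem_insert.1 he' with rfl | he'
    · exact cmp_zpow_self_eq h2 k
    · dsimp only
      rw [cmp_zpow_symm, h1 _ he', ← cmp_zpow_symm]
    · exact h1 _ he k
    · exact h.1 _ he _ he' k
  · rcases Finset.mem_insert.1 he with rfl | he
    · exact h3
    · exact h.2 _ he

theorem OrbitIso.swap {u : Finset (α × β)} (h : OrbitIso σ τ π π' u) :
    OrbitIso τ σ π' π (u.map (Equiv.prodComm α β).toEmbedding) := by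
  refine ⟨fun e he e' he' k => ?_, fun e he => ?_⟩
  · obtain ⟨d, hd, rfl⟩ := Finset.mem_map.1 he
    obtain ⟨d', hd', rfl⟩ := Finset.mem_map.1 he'
    exact (h.1 _ hd _ hd' k).symm
  · obtain ⟨d, hd, rfl⟩ := Finset.mem_map.1 he
    exact (h.2 _ hd).symm

/-- A new point lies on a known orbit, strictly inside the hull of a known orbit, or far from all
known orbits. In the first case its image is forced. In the second, any point in the corresponding
finite intersection of gaps works, since the hull determines colour and piece. The third is what
`IsShuffleSum.ext` provides. -/
theorem OrbitIso.exists_extension [DenselyOrdered β] [NoMinOrder β] [NoMaxOrder β] [Nonempty β]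
    (hσ : IsShuffleSum S σ π) (hτ : IsShuffleSum S τ π') {u : Finset (α × β)}
    (h : OrbitIso σ τ π π' u) (z : α) :
    ∃ w, (∀ e ∈ u, ∀ k : ℤ, cmp ((σ ^ k) e.1) z = cmp ((τ ^ k) e.2) w) ∧
      orbSign σ z = orbSign τ w ∧ π z = π' w := by
  classical
  have hsign : ∀ e ∈ u, orbSign σ e.1 = orbSign τ e.2 := fun e he => by
    have := h.1 e he e he 1
    rw [zpow_one, zpow_one] at this
    exact cmp_eq_cmp_symm.1 this
  by_cases horb : ∃ e ∈ u, ∃ k : ℤ, (σ ^ k) e.1 = z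
  · obtain ⟨e, he, k, rfl⟩ := horb
    refine ⟨(τ ^ k) e.2, fun e' he' j => ?_, ?_, ?_⟩
    · rw [cmp_zpow_zpow, cmp_zpow_zpow, h.1 _ he' _ he]
    · rw [orbSign_zpow, orbSign_zpow, hsign e he]
    · rw [hσ.zpow, hτ.zpow, h.2 _ he]
  push Not at horb
  by_cases hcross : ∃ e ∈ u, ¬ Far σ e.1 z ∧ ¬ Far σ z e.1
  · have hn : ∀ e : α × β, ∃ j k : ℤ, e ∈ u → ¬ Far σ e.1 z → ¬ Far σ z e.1 →
        (σ ^ j) e.1 < z ∧ z < (σ ^ k) e.1 ∧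
          ∀ i : ℤ, (σ ^ i) e.1 ≤ (σ ^ j) e.1 ∨ (σ ^ k) e.1 ≤ (σ ^ i) e.1 := fun e => by
      by_cases he : e ∈ u ∧ ¬ Far σ e.1 z ∧ ¬ Far σ z e.1
      · obtain ⟨j, k, hjk⟩ := exists_neighbours he.2.1 he.2.2 (horb e he.1)
        exact ⟨j, k, fun _ _ _ => hjk⟩
      · exact ⟨0, 0, fun h1 h2 h3 => absurd ⟨h1, h2, h3⟩ he⟩
    choose j k hjk using hn
    let c := u.filter fun e => ¬ Far σ e.1 z ∧ ¬ Far σ z e.1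
    have hc : ∀ e ∈ c, e ∈ u ∧ (σ ^ j e) e.1 < z ∧ z < (σ ^ k e) e.1 ∧
        ∀ i : ℤ, (σ ^ i) e.1 ≤ (σ ^ j e) e.1 ∨ (σ ^ k e) e.1 ≤ (σ ^ i) e.1 := fun e he => by
      obtain ⟨h1, h2, h3⟩ := Finset.mem_filter.1 he
      exact ⟨h1, hjk e h1 h2 h3⟩
    -- Each known orbit whose hull contains `z` confines `w` to the gap between the images of the
    -- two neighbours of `z` on that orbit.
    obtain ⟨w, hlo, hhi⟩ := Order.exists_between_finsets (c.image fun e => (τ ^ j e) e.2)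
      (c.image fun e => (τ ^ k e) e.2) (by
        simp only [Finset.mem_image]
        rintro _ ⟨e, he, rfl⟩ _ ⟨e', he', rfl⟩
        exact (h.lt_iff (hc e he).1 (hc e' he').1 _ _).1 ((hc e he).2.1.trans (hc e' he').2.2.1))
    have hlo : ∀ e ∈ c, (τ ^ j e) e.2 < w := fun e he => hlo _ (Finset.mem_image_of_mem _ he)
    have hhi : ∀ e ∈ c, w < (τ ^ k e) e.2 := fun e he => hhi _ (Finset.mem_image_of_mem _ he)
    obtain ⟨d, hd, hd1, hd2⟩ := hcross
    have hdc : d ∈ c := Finset.mem_filter.2 ⟨hd, hd1, hd2⟩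
    have hw1 : ¬ Far τ d.2 w := fun hf => (hf (k d)).not_gt (hhi d hdc)
    have hw2 : ¬ Far τ w d.2 := fun hf => by
      have := hf (-(j d))
      rw [← lt_zpow_iff] at this
      exact this.not_gt (hlo d hdc)
    refine ⟨w, fun e he i => ?_, ?_, ?_⟩
    · by_cases hec : e ∈ c
      · obtain ⟨-, h1, h2, h3⟩ := hc e hec
        rcases h3 i with h3 | h3
        · rw [(cmp_eq_lt_iff _ _).2 (h3.trans_lt h1), (cmp_eq_lt_iff _ _).2]
          refine lt_of_le_of_lt (not_lt.1 fun hlt => ?_) (hlo e hec)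
          exact h3.not_gt ((h.lt_iff he he _ _).2 hlt)
        · rw [(cmp_eq_gt_iff _ _).2 (h2.trans_le h3), (cmp_eq_gt_iff _ _).2]
          refine lt_of_lt_of_le (hhi e hec) (not_lt.1 fun hlt => ?_)
          exact h3.not_gt ((h.lt_iff he he _ _).2 hlt)
      · have : Far σ e.1 z ∨ Far σ z e.1 := by
          by_contra hcon
          rw [not_or] at hcon
          exact hec (Finset.mem_filter.2 ⟨he, hcon⟩)
        rcases this with hf | hf
        · rw [(cmp_eq_lt_iff _ _).2 (hf i), (cmp_eq_lt_iff _ _).2]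
          have hfd : Far σ e.1 d.1 := by
            have := (hf.trans_le (hc d hdc).2.2.1.le).zpow_right (-(k d))
            rwa [← zpow_apply_add, neg_add_cancel, zpow_zero] at this
          exact (((h.far he hd).1 hfd).zpow_right _ i).trans (hlo d hdc)
        · have hf' : z < (σ ^ i) e.1 := (hf.zpow_right i).lt
          rw [(cmp_eq_gt_iff _ _).2 hf', (cmp_eq_gt_iff _ _).2]
          have hfd : Far σ d.1 e.1 := by
            have := (Far.le_trans (hc d hdc).2.1.le hf).zpow_left (-(j d))
            rwa [← zpow_apply_add, neg_add_cancel, zpow_zero] at this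
          exact (hhi d hdc).trans ((((h.far hd he).1 hfd).zpow_right i) _)
    · rw [orbSign_eq_of_not_far hd1 hd2, orbSign_eq_of_not_far hw1 hw2, hsign d hd]
    · rw [← hσ.eq_of_not_far hd1 hd2, ← hτ.eq_of_not_far hw1 hw2, h.2 d hd]
  · push Not at hcross
    obtain ⟨w, hw1, hw2, hlo, hhi⟩ := hτ.ext (π z) (hσ.lt z) (orbSign σ z) (hσ.sgn z)
      ((u.filter fun e => Far σ e.1 z).image Prod.snd)
      ((u.filter fun e => Far σ z e.1).image Prod.snd) (by
        simp only [Finset.mem_image, Finset.mem_filter]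
        rintro _ ⟨e, ⟨he, h1⟩, rfl⟩ _ ⟨e', ⟨he', h2⟩, rfl⟩
        exact (h.far he he').1 (h1.trans h2)) (by
        simp only [Finset.mem_image, Finset.mem_filter]
        rintro _ ⟨e, ⟨he, h1⟩, rfl⟩
        rw [← h.2 e he]
        exact ⟨hσ.mono h1.lt.le, fun heq => heq ▸ hσ.uniq _ _ heq h1⟩) (by
        simp only [Finset.mem_image, Finset.mem_filter]
        rintro _ ⟨e, ⟨he, h1⟩, rfl⟩
        rw [← h.2 e he]
        exact ⟨hσ.mono h1.lt.le, fun heq => hσ.uniq _ _ heq.symm h1⟩)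
    have hlo : ∀ e ∈ u, Far σ e.1 z → Far τ e.2 w := fun e he hf =>
      hlo _ (Finset.mem_image_of_mem _ (Finset.mem_filter.2 ⟨he, hf⟩))
    have hhi : ∀ e ∈ u, Far σ z e.1 → Far τ w e.2 := fun e he hf =>
      hhi _ (Finset.mem_image_of_mem _ (Finset.mem_filter.2 ⟨he, hf⟩))
    refine ⟨w, fun e he k => ?_, hw2.symm, hw1.symm⟩
    by_cases hf : Far σ e.1 z
    · rw [(cmp_eq_lt_iff _ _).2 (hf k), (cmp_eq_lt_iff _ _).2 (hlo e he hf k)]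
    · have hf := hcross e he hf
      rw [(cmp_eq_gt_iff _ _).2 ((hf.zpow_right k).lt),
        (cmp_eq_gt_iff _ _).2 (((hhi e he hf).zpow_right k).lt)]

theorem OrbitIso.fst_eq_iff {u : Finset (α × β)} (h : OrbitIso σ τ π π' u) {e e' : α × β}
    (he : e ∈ u) (he' : e' ∈ u) : e.1 = e'.1 ↔ e.2 = e'.2 := by
  have := h.1 e he e' he' 0
  rw [← cmp_eq_eq_iff, ← cmp_eq_eq_iff e.2]
  simp only [zpow_zero] at this
  exact (this ▸ Iff.rfl : cmp e.1 e'.1 = .eq ↔ cmp e.2 e'.2 = .eq)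

/-- Finite orbit isomorphisms between shuffle sums of the same shape extend to isomorphisms. -/
theorem OrbitIso.exists_orderIso [Countable α] [Countable β] [DenselyOrdered α] [NoMinOrder α]
    [NoMaxOrder α] [DenselyOrdered β] [NoMinOrder β] [NoMaxOrder β] [Nonempty α] [Nonempty β]
    (hσ : IsShuffleSum S σ π) (hτ : IsShuffleSum S τ π') {u : Finset (α × β)}
    (h : OrbitIso σ τ π π' u) :
    ∃ e : α ≃o β, (∀ x, e (σ x) = τ (e x)) ∧ ∀ x ∈ u, e x.1 = x.2 := by
  classical
  obtain ⟨e, he, he'⟩ := exists_equiv_of_back_and_forth (OrbitIso σ τ π π')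
    (fun p hp e he e' he' => hp.fst_eq_iff he he')
    (fun p hp z => by
      obtain ⟨w, h1, h2, h3⟩ := hp.exists_extension hσ hτ z
      exact ⟨w, _, Finset.subset_insert _ _, hp.insert h1 h2 h3, Finset.mem_insert_self _ _⟩)
    (fun p hp w => by
      obtain ⟨z, h1, h2, h3⟩ := hp.swap.exists_extension hτ hσ w
      refine ⟨z, _, Finset.subset_insert _ _, hp.insert (fun e he k => ?_) h2.symm h3.symm,
        Finset.mem_insert_self _ _⟩
      exact (h1 (e.2, e.1) (Finset.mem_map_of_mem (Equiv.prodComm α β).toEmbedding he) k).symm)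
    u h
  have hmono : StrictMono e := fun x y hxy => by
    obtain ⟨q, hq, h1, -⟩ := he' {x, y}
    have := (hq.lt_iff (h1 x (by simp)) (h1 y (by simp)) 0 0).1 (by simpa using hxy)
    simpa using this
  refine ⟨StrictMono.orderIsoOfSurjective e hmono e.surjective, fun x => ?_, he⟩
  change e (σ x) = τ (e x)
  obtain ⟨q, hq, h1, -⟩ := he' {x, σ x}
  have := hq.1 _ (h1 x (by simp)) _ (h1 (σ x) (by simp)) 1
  simp only [zpow_one, cmp_self_eq_eq] at this
  exact ((cmp_eq_eq_iff _ _).1 this.symm).symm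

end

/-- Finite monotone maps of the rationals extend to automorphisms. -/
theorem exists_orderIso_rat (s : Finset ℚ) (f : ℚ → ℚ) (hf : StrictMonoOn f s) :
    ∃ e : ℚ ≃o ℚ, ∀ x ∈ s, e x = f x := by
  classical
  have h1 : ∀ x y : ℚ, Far 1 x y ↔ x < y := fun x y => by simp [Far]
  have h2 : ∀ x : ℚ, orbSign 1 x = .eq := fun x => by simp [orbSign]
  -- The identity is a shuffle of fixed points in one piece, where being far is just being smaller.
  have hS : IsShuffleSum ⟨1, fun _ => {.eq}, fun _ => False⟩ (1 : ℚ ≃o ℚ) fun _ => 0 := by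
    have hd : SumShape.IsDense ⟨1, fun _ => {.eq}, fun _ => False⟩ 0 :=
      ⟨not_false, fun s hs h => hs (by simpa using h.symm)⟩
    refine ⟨⟨monotone_const, fun _ => Nat.one_pos, fun _ => rfl, fun x => h2 x,
      fun _ _ h => h.elim⟩, fun _ _ _ _ => hd, fun i hi s hs L U hLU _ _ => ?_⟩
    obtain ⟨m, hm1, hm2⟩ := Order.exists_between_finsets L U fun a ha b hb =>
      (h1 a b).1 (hLU a ha b hb)
    obtain rfl : i = 0 := by simpa using hi
    obtain rfl : s = .eq := hs
    exact ⟨m, rfl, h2 m, fun a ha => (h1 _ _).2 (hm1 a ha), fun a ha => (h1 _ _).2 (hm2 a ha)⟩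
  obtain ⟨e, -, he⟩ := OrbitIso.exists_orderIso hS hS (u := s.image fun x => (x, f x)) (by
    refine ⟨fun e he e' he' k => ?_, fun _ _ => rfl⟩
    obtain ⟨x, hx, rfl⟩ := Finset.mem_image.1 he
    obtain ⟨y, hy, rfl⟩ := Finset.mem_image.1 he'
    simpa using (hf.cmp_map_eq hx hy).symm)
  exact ⟨e, fun x hx => he (x, f x) (Finset.mem_image_of_mem _ hx)⟩

/-- No piece of the shape can be absorbed by a neighbouring one. -/
structure SumShape.IsReduced (S : SumShape) : Prop where
  nonempty : ∀ i < S.n, (S.A i).Nonempty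
  single : ∀ i, S.sg i → S.A i = {.eq}
  left : ∀ i, i + 1 < S.n → ¬ S.sg i → ¬ S.A (i + 1) ⊆ S.A i
  right : ∀ i, i + 1 < S.n → ¬ S.sg (i + 1) → ¬ S.A i ⊆ S.A (i + 1)

/-! ### Rigid, separated and determining finite sets -/

section

variable {β : Type*} [LinearOrder β] {S : SumShape} {τ : β ≃o β} {π : β → ℕ}

/-- Unlike `exists_neighbours`, this allows `y` on the orbit, hence the weak lower inequality. For a
decreasing orbit the successor in the order is the inverse image. -/
theorem exists_bracket {x y : β} (hx : orbSign τ x ≠ .eq) (h1 : ¬ Far τ x y)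
    (h2 : ¬ Far τ y x) :
    ∃ j k : ℤ, (τ ^ j) x ≤ y ∧ y < (τ ^ k) x ∧ ∀ i : ℤ, (τ ^ i) x ≤ (τ ^ j) x ∨ (τ ^ k) x ≤ (τ ^ i) x := by
  by_cases hz : ∀ k : ℤ, (τ ^ k) x ≠ y
  · obtain ⟨j, k, h3, h4, h5⟩ := exists_neighbours h1 h2 hz
    exact ⟨j, k, h3.le, h4, h5⟩
  push Not at hz
  obtain ⟨j, rfl⟩ := hz
  have main : ∀ σ : β ≃o β, x < σ x → ∀ j : ℤ, ∃ k : ℤ, (σ ^ j) x < (σ ^ k) x ∧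
      ∀ i : ℤ, (σ ^ i) x ≤ (σ ^ j) x ∨ (σ ^ k) x ≤ (σ ^ i) x := by
    intro σ hσ j
    have hm := zpow_strictMono hσ
    refine ⟨j + 1, hm (lt_add_one j), fun i => ?_⟩
    rcases le_or_gt i j with hi | hi
    · exact .inl (hm.monotone hi)
    · exact .inr (hm.monotone (by omega : j + 1 ≤ i))
  rcases h : orbSign τ x with _ | _ | _
  · obtain ⟨k, h3, h4⟩ := main τ (orbSign_eq_lt.1 h) j
    exact ⟨j, k, le_rfl, h3, h4⟩
  · exact absurd h hx
  · have h' : orbSign τ⁻¹ x = .lt := by rw [orbSign_inv, h]; rfl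
    obtain ⟨k, h3, h4⟩ := main τ⁻¹ (orbSign_eq_lt.1 h') (-j)
    simp only [inv_zpow', neg_neg] at h3 h4
    exact ⟨j, -k, le_rfl, h3, fun i => by simpa using h4 (-i)⟩

theorem SumShape.IsReduced.eq_singleton (hS : S.IsReduced) {i : ℕ} (h : ¬ S.IsDense i) :
    ∃ s, S.A i = {s} := by
  rw [SumShape.IsDense, not_and_or, not_not] at h
  rcases h with h | h
  · exact ⟨_, hS.single i h⟩
  · push Not at h
    obtain ⟨s, -, hs⟩ := h
    exact ⟨s, hs⟩

theorem IsShuffleSum.exists_le (hS : S.IsReduced) (hτ : IsShuffleSum S τ π) (t : Finset β)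
    {i : ℕ} (hi : i < S.n) {s : Ordering} (hs : s ∈ S.A i) :
    ∃ y, π y = i ∧ orbSign τ y = s ∧ ∀ x ∈ t, π x = i → y ≤ x := by
  classical
  by_cases hd : S.IsDense i
  · obtain ⟨z, h1, h2, -, h3⟩ := hτ.ext i hi s hs ∅ (t.filter fun x => π x = i) (by simp)
      (by simp) (fun b hb => ⟨(Finset.mem_filter.1 hb).2.ge, fun _ => hd⟩)
    exact ⟨z, h1, h2, fun x hx hxi => (h3 x (Finset.mem_filter.2 ⟨hx, hxi⟩)).lt.le⟩
  · rcases (t.filter fun x => π x = i).eq_empty_or_nonempty with h0 | h0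
    · obtain ⟨z, h1, h2, -⟩ := hτ.ext i hi s hs ∅ ∅ (by simp) (by simp) (by simp)
      exact ⟨z, h1, h2, fun x hx hxi =>
        absurd (Finset.mem_filter.2 ⟨hx, hxi⟩) (h0 ▸ Finset.notMem_empty x)⟩
    · obtain ⟨s', hs'⟩ := hS.eq_singleton hd
      have hm := Finset.mem_filter.1 (Finset.min'_mem _ h0)
      refine ⟨_, hm.2, ?_, fun x hx hxi => Finset.min'_le _ _ (Finset.mem_filter.2 ⟨hx, hxi⟩)⟩
      have := hτ.sgn ((t.filter fun x => π x = i).min' h0)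
      rw [hm.2, hs'] at this
      rw [hs'] at hs
      exact this.trans hs.symm

theorem IsShuffleSum.exists_ge (hS : S.IsReduced) (hτ : IsShuffleSum S τ π) (t : Finset β)
    {i : ℕ} (hi : i < S.n) {s : Ordering} (hs : s ∈ S.A i) :
    ∃ y, π y = i ∧ orbSign τ y = s ∧ ∀ x ∈ t, π x = i → x ≤ y := by
  classical
  by_cases hd : S.IsDense i
  · obtain ⟨z, h1, h2, h3, -⟩ := hτ.ext i hi s hs (t.filter fun x => π x = i) ∅ (by simp)
      (fun b hb => ⟨(Finset.mem_filter.1 hb).2.le, fun _ => hd⟩) (by simp)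
    exact ⟨z, h1, h2, fun x hx hxi => (h3 x (Finset.mem_filter.2 ⟨hx, hxi⟩)).lt.le⟩
  · rcases (t.filter fun x => π x = i).eq_empty_or_nonempty with h0 | h0
    · obtain ⟨z, h1, h2, -⟩ := hτ.ext i hi s hs ∅ ∅ (by simp) (by simp) (by simp)
      exact ⟨z, h1, h2, fun x hx hxi =>
        absurd (Finset.mem_filter.2 ⟨hx, hxi⟩) (h0 ▸ Finset.notMem_empty x)⟩
    · obtain ⟨s', hs'⟩ := hS.eq_singleton hd
      have hm := Finset.mem_filter.1 (Finset.max'_mem _ h0)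
      refine ⟨_, hm.2, ?_, fun x hx hxi => Finset.le_max' _ _ (Finset.mem_filter.2 ⟨hx, hxi⟩)⟩
      have := hτ.sgn ((t.filter fun x => π x = i).max' h0)
      rw [hm.2, hs'] at this
      rw [hs'] at hs
      exact this.trans hs.symm

/-- The finite set `u` has a first and a last point in each piece, whose directions do not occur
in the preceding and in the following piece. -/
structure IsRigidSet (S : SumShape) (τ : β ≃o β) (π : β → ℕ) (u : Finset β) : Prop where
  first : ∀ i < S.n, ∃ y ∈ u, π y = i ∧ (∀ x ∈ u, π x = i → y ≤ x) ∧
    ∀ j, j + 1 = i → ¬ S.sg j → orbSign τ y ∉ S.A j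
  last : ∀ i < S.n, ∃ y ∈ u, π y = i ∧ (∀ x ∈ u, π x = i → x ≤ y) ∧
    (i + 1 < S.n → ¬ S.sg (i + 1) → orbSign τ y ∉ S.A (i + 1))

/-- Reducedness supplies in each piece a colour absent from a neighbouring piece that is not a
single point. A point of that colour can be put at the relevant end: by density in a shuffle, and
otherwise because all points of the piece share the colour. -/
theorem IsShuffleSum.exists_isRigidSet [Nonempty β] (hS : S.IsReduced) (hτ : IsShuffleSum S τ π)
    (t : Finset β) : ∃ u, t ⊆ u ∧ IsRigidSet S τ π u := by
  classical
  have hlow : ∀ i, ∃ y, i < S.n → π y = i ∧ (∀ x ∈ t, π x = i → y ≤ x) ∧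
      ∀ j, j + 1 = i → ¬ S.sg j → orbSign τ y ∉ S.A j := fun i => by
    by_cases hi : i < S.n
    swap
    · exact ⟨Classical.arbitrary β, fun h => absurd h hi⟩
    have : ∃ s ∈ S.A i, ∀ j, j + 1 = i → ¬ S.sg j → s ∉ S.A j := by
      rcases i with _ | i
      · obtain ⟨s, hs⟩ := hS.nonempty 0 hi
        exact ⟨s, hs, fun j hj => absurd hj (by omega)⟩
      · by_cases hsg : S.sg i
        · obtain ⟨s, hs⟩ := hS.nonempty _ hi
          exact ⟨s, hs, fun j hj hj' => absurd hsg (by obtain rfl : j = i := by omega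
                                                       exact hj')⟩
        · obtain ⟨s, hs, hs'⟩ := Set.not_subset.1 (hS.left i hi hsg)
          exact ⟨s, hs, fun j hj _ => by obtain rfl : j = i := by omega
                                         exact hs'⟩
    obtain ⟨s, hs, hs'⟩ := this
    obtain ⟨y, h1, h2, h3⟩ := hτ.exists_le hS t hi hs
    exact ⟨y, fun _ => ⟨h1, h3, h2 ▸ hs'⟩⟩
  choose l hl using hlow
  have hhigh : ∀ i, ∃ y, i < S.n → π y = i ∧ (∀ x ∈ insert (l i) t, π x = i → x ≤ y) ∧
      (i + 1 < S.n → ¬ S.sg (i + 1) → orbSign τ y ∉ S.A (i + 1)) := fun i => by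
    by_cases hi : i < S.n
    swap
    · exact ⟨l i, fun h => absurd h hi⟩
    have : ∃ s ∈ S.A i, i + 1 < S.n → ¬ S.sg (i + 1) → s ∉ S.A (i + 1) := by
      by_cases hsg : i + 1 < S.n ∧ ¬ S.sg (i + 1)
      · obtain ⟨s, hs, hs'⟩ := Set.not_subset.1 (hS.right i hsg.1 hsg.2)
        exact ⟨s, hs, fun _ _ => hs'⟩
      · obtain ⟨s, hs⟩ := hS.nonempty _ hi
        exact ⟨s, hs, fun h1 h2 => absurd ⟨h1, h2⟩ hsg⟩
    obtain ⟨s, hs, hs'⟩ := this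
    obtain ⟨y, h1, h2, h3⟩ := hτ.exists_ge hS (insert (l i) t) hi hs
    exact ⟨y, fun _ => ⟨h1, h3, h2 ▸ hs'⟩⟩
  choose r hr using hhigh
  have hmem : ∀ x, x ∈ t ∪ ((Finset.range S.n).image l ∪ (Finset.range S.n).image r) ↔
      x ∈ t ∨ (∃ i < S.n, l i = x) ∨ ∃ i < S.n, r i = x := fun x => by
    simp
  refine ⟨t ∪ ((Finset.range S.n).image l ∪ (Finset.range S.n).image r),
    Finset.subset_union_left, ⟨fun i hi => ⟨l i, (hmem _).2 (.inr (.inl ⟨i, hi, rfl⟩)),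
      (hl i hi).1, fun x hx hxi => ?_, (hl i hi).2.2⟩, fun i hi =>
      ⟨r i, (hmem _).2 (.inr (.inr ⟨i, hi, rfl⟩)), (hr i hi).1, fun x hx hxi => ?_,
        (hr i hi).2.2⟩⟩⟩
  · rcases (hmem x).1 hx with hx | ⟨j, hj, rfl⟩ | ⟨j, hj, rfl⟩
    · exact (hl i hi).2.1 x hx hxi
    · rw [(hl j hj).1] at hxi
      rw [hxi]
    · rw [(hr j hj).1] at hxi
      subst hxi
      exact (hr j hj).2.1 _ (Finset.mem_insert_self _ _) (hl j hj).1
  · rcases (hmem x).1 hx with hx | ⟨j, hj, rfl⟩ | ⟨j, hj, rfl⟩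
    · exact (hr i hi).2.1 x (Finset.mem_insert_of_mem hx) hxi
    · rw [(hl j hj).1] at hxi
      subst hxi
      exact (hr j hj).2.1 _ (Finset.mem_insert_self _ _) (hl j hj).1
    · rw [(hr j hj).1] at hxi
      rw [hxi]

/-- A colour-preserving increasing map cannot slide a piece into a neighbour, because its end point
would bring in a colour which does not occur there. Induction from the left shows that pieces do not
move down, induction from the right that they do not move up. -/
theorem IsRigidSet.piece_eq (hτ : IsPlacement S τ π) {u : Finset β} (hu : IsRigidSet S τ π u)
    {f : β → β} (hf : StrictMonoOn f u) (hs : ∀ x ∈ u, orbSign τ (f x) = orbSign τ x) :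
    ∀ x ∈ u, π (f x) = π x := by
  have hmono : ∀ x ∈ u, ∀ y ∈ u, x ≤ y → π (f x) ≤ π (f y) := fun x hx y hy hxy =>
    hτ.mono (hf.monotoneOn hx hy hxy)
  have hlt : ∀ x y : β, π x < π y → x < y := fun x y h => hτ.mono.reflect_lt h
  have h1 : ∀ i, ∀ x ∈ u, π x = i → i ≤ π (f x) := by
    intro i
    induction i with
    | zero => exact fun _ _ _ => Nat.zero_le _
    | succ i ih =>
      intro x hx hxi
      have hi : i + 1 < S.n := hxi ▸ hτ.lt x
      obtain ⟨y, hy, hyi, hymin, hyA⟩ := hu.first (i + 1) hi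
      obtain ⟨z, hz, hzi, -, -⟩ := hu.last i (by omega)
      have hzy : z < y := hlt _ _ (by omega)
      have h2 := ih z hz hzi
      have h3 := hmono z hz y hy hzy.le
      have h4 := hmono y hy x hx (hymin x hx hxi)
      by_contra hcon
      have h5 : π (f y) = i := by omega
      have h6 : π (f z) = i := by omega
      -- If piece `i` is a single point there is no colour obstruction, but `y` and `z` would both
      -- be sent to that point.
      by_cases hsg : S.sg i
      · exact (hf hz hy hzy).ne (hτ.single _ _ (h6 ▸ hsg) (h6.trans h5.symm))
      · have := hτ.sgn (f y)
        rw [h5, hs y hy] at this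
        exact hyA i rfl hsg this
  have h2 : ∀ i, ∀ x ∈ u, π x + i + 1 = S.n → π (f x) ≤ π x := by
    intro i
    induction i with
    | zero => exact fun x _ h => by have := hτ.lt (f x); omega
    | succ i ih =>
      intro x hx hxi
      obtain ⟨y, hy, hyi, hymax, hyA⟩ := hu.last (π x) (by omega)
      obtain ⟨z, hz, hzi, -, -⟩ := hu.first (π x + 1) (by omega)
      have hyz : y < z := hlt _ _ (by omega)
      have h2 := ih z hz (by omega)
      have h3 := hmono y hy z hz hyz.le
      have h4 := hmono x hx y hy (hymax x hx rfl)
      by_contra hcon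
      have h5 : π (f y) = π x + 1 := by omega
      have h6 : π (f z) = π x + 1 := by omega
      by_cases hsg : S.sg (π x + 1)
      · exact (hf hy hz hyz).ne (hτ.single _ _ (h5 ▸ hsg) (h5.trans h6.symm))
      · have := hτ.sgn (f y)
        rw [h5, hs y hy] at this
        exact hyA (by omega) hsg this
  intro x hx
  have := hτ.lt x
  exact le_antisymm (h2 (S.n - π x - 1) x hx (by omega)) (h1 _ x hx rfl)

/-- Points of `u` that are moved in the same direction along different orbits in the same piece
are separated by a point of `u` that is moved in another direction. -/
def IsSeparated (τ : β ≃o β) (π : β → ℕ) (u : Finset β) : Prop :=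
  ∀ x ∈ u, ∀ y ∈ u, Far τ x y → orbSign τ x = orbSign τ y → orbSign τ x ≠ .eq → π x = π y →
    ∃ v ∈ u, x < v ∧ v < y ∧ orbSign τ v ≠ orbSign τ x

/-- Points are added from left to right; only the gap between the previous maximum and the new point
can need a separator. The last clause keeps added points between old ones of the same piece, so that
rigidity is not lost. -/
theorem IsShuffleSum.exists_isSeparated (hτ : IsShuffleSum S τ π) (u : Finset β) :
    ∃ u', u ⊆ u' ∧ IsSeparated τ π u' ∧
      ∀ v ∈ u', ∃ x ∈ u, ∃ y ∈ u, x ≤ v ∧ v ≤ y ∧ π x = π v ∧ π y = π v := by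
  classical
  induction u using Finset.induction_on_max with
  | empty => exact ⟨∅, by simp, by simp [IsSeparated], by simp⟩
  | insert z u hz ih =>
    obtain ⟨u', huu', hsep, hbd⟩ := ih
    have hz' : ∀ x ∈ u', x < z := fun x hx => by
      obtain ⟨-, -, y, hy, -, hxy, -⟩ := hbd x hx
      exact hxy.trans_lt (hz y hy)
    have hbd' : ∀ v ∈ insert z u', ∃ x ∈ insert z u, ∃ y ∈ insert z u,
        x ≤ v ∧ v ≤ y ∧ π x = π v ∧ π y = π v := fun v hv => by
      rcases Finset.mem_insert.1 hv with rfl | hv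
      · exact ⟨v, by simp, v, by simp, le_rfl, le_rfl, rfl, rfl⟩
      · obtain ⟨x, hx, y, hy, h⟩ := hbd v hv
        exact ⟨x, by simp [hx], y, by simp [hy], h⟩
    rcases u'.eq_empty_or_nonempty with rfl | hne
    · refine ⟨{z}, ?_, ?_, hbd'⟩
      · exact Finset.insert_subset_insert z huu'
      · intro x hx y hy hxy
        rw [Finset.mem_singleton] at hx hy
        subst hx hy
        exact absurd hxy not_far_self
    set a := u'.max' hne with ha
    have hau : a ∈ u' := Finset.max'_mem _ _
    have hamax : ∀ x ∈ u', x ≤ a := fun x hx => Finset.le_max' _ _ hx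
    have haz : a < z := hz' a hau
    by_cases hgood : Far τ a z ∧ orbSign τ a = orbSign τ z ∧ orbSign τ z ≠ .eq ∧ π a = π z
    · obtain ⟨hfar, hcol, hne0, hpi⟩ := hgood
      have hd := hτ.uniq a z hpi hfar
      obtain ⟨s, hsA, hs⟩ : ∃ s ∈ S.A (π z), s ≠ orbSign τ z := by
        by_contra hcon
        push Not at hcon
        refine hd.2 _ hne0 (Set.eq_singleton_iff_unique_mem.2 ⟨hpi ▸ hτ.sgn z, fun s hs => ?_⟩)
        -- Two mutually far points in one piece make it dense, so its colours are not just one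
        -- colour of moved points.
        exact hcon s (hpi ▸ hs)
      obtain ⟨v, hv1, hv2, hv3, hv4⟩ := hτ.ext (π z) (hτ.lt z) s hsA {a} {z} (by simpa using hfar)
        (by simpa [hpi] using hpi ▸ hd) (by simpa using hpi ▸ hd)
      have hav : Far τ a v := hv3 a (by simp)
      have hvz : Far τ v z := hv4 z (by simp)
      refine ⟨insert v (insert z u'), ?_, ?_, ?_⟩
      · exact (Finset.insert_subset_insert z huu').trans (Finset.subset_insert _ _)
      · intro x hx y hy hxy hcxy hcx hpxy
        simp only [Finset.mem_insert] at hx hy ⊢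
        rcases hy with rfl | rfl | hy
        · rcases hx with rfl | rfl | hx
          · exact absurd hxy not_far_self
          · exact absurd hxy.lt hvz.lt.not_gt
          · have hca : orbSign τ a ≠ orbSign τ x := by rw [hcxy, hv2, hcol]; exact hs.symm
            exact ⟨a, .inr (.inr hau), (hamax x hx).lt_of_ne fun h => hca (by rw [h]), hav.lt, hca⟩
        · rcases hx with rfl | rfl | hx
          · exact absurd (hv2 ▸ hcxy) hs
          · exact absurd hxy not_far_self
          · exact ⟨v, .inl rfl, (hamax x hx).trans_lt hav.lt, hvz.lt, by rw [hv2, hcxy]; exact hs⟩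
        · rcases hx with rfl | rfl | hx
          · exact absurd hxy.lt ((hamax y hy).trans hav.lt.le).not_gt
          · exact absurd hxy.lt (hz' y hy).not_gt
          · obtain ⟨w, hw, h⟩ := hsep x hx y hy hxy hcxy hcx hpxy
            exact ⟨w, .inr (.inr hw), h⟩
      · intro w hw
        rcases Finset.mem_insert.1 hw with rfl | hw
        · obtain ⟨x, hx, y, hy, h1, h2, h3, h4⟩ := hbd a hau
          exact ⟨x, by simp [hx], z, by simp, h1.trans hav.lt.le, hvz.lt.le,
            by rw [h3, hpi, hv1], hv1.symm⟩
        · exact hbd' w hw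
    · refine ⟨insert z u', Finset.insert_subset_insert z huu', ?_, hbd'⟩
      intro x hx y hy hxy hcxy hcx hpxy
      simp only [Finset.mem_insert] at hx hy ⊢
      rcases hy with rfl | hy
      · rcases hx with rfl | hx
        · exact absurd hxy not_far_self
        · by_cases hca : orbSign τ a = orbSign τ x
          · have hpa : π a = π y := by
              have h1 := hτ.mono (hamax x hx)
              have h2 := hτ.mono haz.le
              omega
            have hnf : ¬ Far τ a y := fun hf =>
              hgood ⟨hf, hca.trans hcxy, hcxy ▸ hcx, hpa⟩
            have hxa : Far τ x a := by
              by_contra h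
              have h1 : ¬ Far τ a x := fun h => (hamax x hx).not_gt h.lt
              simp only [Far, not_forall, not_lt] at hnf h
              obtain ⟨k, hk⟩ := hnf
              obtain ⟨j, hj⟩ := h
              have := hxy (k + j)
              rw [zpow_apply_add] at this
              exact this.not_ge (hk.trans ((τ ^ k).monotone hj))
            obtain ⟨v, hv, h1, h2, h3⟩ := hsep x hx a hau hxa hca.symm hcx (by omega)
            exact ⟨v, .inr hv, h1, h2.trans haz, h3⟩
          · exact ⟨a, .inr hau, (hamax x hx).lt_of_ne fun h => hca (by rw [h]), haz, hca⟩
      · rcases hx with rfl | hx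
        · exact absurd hxy.lt (hz' y hy).not_gt
        · obtain ⟨w, hw, h⟩ := hsep x hx y hy hxy hcxy hcx hpxy
          exact ⟨w, .inr hw, h⟩

theorem IsRigidSet.of_between {u u' : Finset β} (hu : IsRigidSet S τ π u)
    (huu' : u ⊆ u')
    (h : ∀ v ∈ u', ∃ x ∈ u, ∃ y ∈ u, x ≤ v ∧ v ≤ y ∧ π x = π v ∧ π y = π v) :
    IsRigidSet S τ π u' := by
  refine ⟨fun i hi => ?_, fun i hi => ?_⟩
  · obtain ⟨y, hy, hyi, hmin, hA⟩ := hu.first i hi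
    refine ⟨y, huu' hy, hyi, fun x hx hxi => ?_, hA⟩
    obtain ⟨w, hw, -, -, hwx, -, hwi, -⟩ := h x hx
    exact (hmin w hw (hwi.trans hxi)).trans hwx
  · obtain ⟨y, hy, hyi, hmax, hA⟩ := hu.last i hi
    refine ⟨y, huu' hy, hyi, fun x hx hxi => ?_, hA⟩
    obtain ⟨-, -, w, hw, -, hwx, -, hwi⟩ := h x hx
    exact hwx.trans (hmax w hw (hwi.trans hxi))

/-- Every finite set is contained in a finite set all of whose partial embeddings extend to
automorphisms. -/
def HasDeterminingSets (τ : β ≃o β) : Prop :=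
  ∀ t : Finset β, ∃ t', t ⊆ t' ∧ ∀ f : β → β, StrictMonoOn f t' →
    (∀ x ∈ t', τ x ∈ t' → f (τ x) = τ (f x)) →
    ∃ h : β ≃o β, (∀ x, h (τ x) = τ (h x)) ∧ ∀ x ∈ t', h x = f x

/-- Rigidity makes a partial embedding preserve pieces, separation makes it preserve `Far`, and
orbit segments reaching past all mutual brackets make it preserve positions inside a hull. It is
thus an orbit isomorphism on `u` and extends by back and forth. -/
theorem IsShuffleSum.hasDeterminingSets [Countable β] [DenselyOrdered β] [NoMinOrder β]
    [NoMaxOrder β] [Nonempty β] (hS : S.IsReduced) (hτ : IsShuffleSum S τ π) :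
    HasDeterminingSets τ := by
  classical
  intro t
  obtain ⟨u₀, ht, hu₀⟩ := hτ.exists_isRigidSet hS t
  obtain ⟨u, huu, hsep, hbd⟩ := hτ.exists_isSeparated u₀
  have hrig := hu₀.of_between huu hbd
  have hb : ∀ x y : β, ∃ j k : ℤ, orbSign τ x ≠ .eq → ¬ Far τ x y → ¬ Far τ y x →
      (τ ^ j) x ≤ y ∧ y < (τ ^ k) x ∧ ∀ i : ℤ, (τ ^ i) x ≤ (τ ^ j) x ∨ (τ ^ k) x ≤ (τ ^ i) x := by
    intro x y
    by_cases h : orbSign τ x ≠ .eq ∧ ¬ Far τ x y ∧ ¬ Far τ y x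
    · obtain ⟨j, k, hjk⟩ := exists_bracket h.1 h.2.1 h.2.2
      exact ⟨j, k, fun _ _ _ => hjk⟩
    · exact ⟨0, 0, fun h1 h2 h3 => absurd ⟨h1, h2, h3⟩ h⟩
  choose j k hjk using hb
  obtain ⟨N, hN⟩ := ((u ×ˢ u).image fun p => max (j p.1 p.2).natAbs (k p.1 p.2).natAbs).exists_le
  -- Using `N + 1` instead of `N` ensures that `τ x` lies in `t'` for each `x ∈ u`, which is needed
  -- to read off directions.
  have hN : ∀ x ∈ u, ∀ y ∈ u, (j x y).natAbs ≤ N + 1 ∧ (k x y).natAbs ≤ N + 1 := fun x hx y hy => by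
    have := hN _ (Finset.mem_image_of_mem _ (Finset.mk_mem_product hx hy))
    dsimp only at this
    omega
  let t' := (Finset.Icc (-(N + 1) : ℤ) (N + 1) ×ˢ u).image fun p => (τ ^ p.1) p.2
  have ht' : ∀ i : ℤ, i.natAbs ≤ N + 1 → ∀ x ∈ u, (τ ^ i) x ∈ t' := fun i hi x hx =>
    Finset.mem_image.2 ⟨(i, x), Finset.mk_mem_product (Finset.mem_Icc.2 (by omega)) hx, rfl⟩
  have hut' : u ⊆ t' := fun x hx => by simpa using ht' 0 (by omega) x hx
  refine ⟨t', ht.trans (huu.trans hut'), fun f hf hcomm => ?_⟩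
  have hfz : ∀ x ∈ u, ∀ i : ℤ, i.natAbs ≤ N + 1 → f ((τ ^ i) x) = (τ ^ i) (f x) := by
    intro x hx
    -- Commutation is given only for single forward steps inside `t'`, so the induction starts at
    -- the far end, exponent `-(N + 1)`, and passes through `0`.
    have h1 : ∀ m : ℕ, m ≤ 2 * (N + 1) → f ((τ ^ (m - (N + 1) : ℤ)) x) =
        (τ ^ (m : ℤ)) (f ((τ ^ (-(N + 1) : ℤ)) x)) := by
      intro m
      induction m with
      | zero => intro _; simp
      | succ m ih =>
        intro hm
        have e1 : (τ ^ ((m + 1 : ℕ) - (N + 1) : ℤ)) x = τ ((τ ^ (m - (N + 1) : ℤ)) x) := by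
          rw [show ((m + 1 : ℕ) - (N + 1) : ℤ) = 1 + (m - (N + 1)) by push_cast; ring,
            zpow_apply_add, zpow_one]
        have e2 := hcomm ((τ ^ (m - (N + 1) : ℤ)) x) (ht' _ (by omega) x hx)
          (e1 ▸ ht' _ (by omega) x hx)
        rw [e1, e2, ih (by omega), show ((m + 1 : ℕ) : ℤ) = 1 + m by push_cast; ring,
            zpow_apply_add, zpow_one]
    intro i hi
    have h2 := h1 (N + 1) (by omega)
    have h3 := h1 (i + (N + 1)).toNat (by omega)
    rw [Int.toNat_of_nonneg (by omega)] at h3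
    push_cast at h2
    simp only [sub_self, zpow_zero, add_sub_cancel_right] at h2 h3
    rw [h3, zpow_apply_add, ← h2]
    rfl
  have hsign : ∀ x ∈ u, orbSign τ (f x) = orbSign τ x := fun x hx => by
    have h1 := hfz x hx 1 (by simp)
    have h2 := ht' 1 (by simp) x hx
    rw [zpow_one] at h1 h2
    rw [orbSign, ← h1]
    exact hf.cmp_map_eq (hut' hx) h2
  have hpi := hrig.piece_eq hτ.toIsPlacement (hf.mono hut') hsign
  have hfar : ∀ x ∈ u, ∀ y ∈ u, Far τ x y → Far τ (f x) (f y) := by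
    intro x hx y hy hxy
    have hlt := hf (hut' hx) (hut' hy) hxy.lt
    by_cases hc : orbSign τ x ≠ orbSign τ y ∨ orbSign τ x = .eq
    · exact far_of_lt hlt (by rwa [hsign x hx, hsign y hy])
    rw [not_or, not_not] at hc
    by_cases hp : π x = π y
    · obtain ⟨v, hv, h1, h2, h3⟩ := hsep x hx y hy hxy hc.1 hc.2 hp
      exact (far_of_lt (hf (hut' hx) (hut' hv) h1)
        (.inl (by rw [hsign x hx, hsign v hv]; exact h3.symm))).trans_le
        (hf (hut' hv) (hut' hy) h2).le
    · rw [← hpi x hx, ← hpi y hy] at hp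
      by_contra hcon
      exact hp (hτ.eq_of_not_far hcon fun h => h.lt.not_gt hlt)
  have hiso : OrbitIso τ τ π π (u.image fun x => (x, f x)) := by
    refine ⟨fun e he e' he' i => ?_, fun e he => ?_⟩
    swap
    · obtain ⟨x, hx, rfl⟩ := Finset.mem_image.1 he
      exact (hpi x hx).symm
    obtain ⟨x, hx, rfl⟩ := Finset.mem_image.1 he
    obtain ⟨y, hy, rfl⟩ := Finset.mem_image.1 he'
    dsimp only
    by_cases h1 : Far τ x y
    · rw [(cmp_eq_lt_iff _ _).2 (h1 i), (cmp_eq_lt_iff _ _).2 (hfar x hx y hy h1 i)]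
    by_cases h2 : Far τ y x
    · rw [(cmp_eq_gt_iff _ _).2 ((h2.zpow_right i).lt),
        (cmp_eq_gt_iff _ _).2 (((hfar y hy x hx h2).zpow_right i).lt)]
    by_cases h3 : orbSign τ x = .eq
    · rw [← eq_of_not_far (orbSign_eq_eq.1 h3) h1 h2]
      exact cmp_zpow_self_eq (hsign x hx).symm i
    obtain ⟨h4, h5, h6⟩ := hjk x y h3 h1 h2
    obtain ⟨hj, hk⟩ := hN x hx y hy
    have hcm : ∀ a b : ℤ, cmp ((τ ^ a) (f x)) ((τ ^ b) (f x)) = cmp ((τ ^ a) x) ((τ ^ b) x) :=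
      fun a b => by
        rw [cmp_zpow_zpow, cmp_zpow_zpow]
        exact cmp_zpow_self_eq (hsign x hx) _
    have h7 : cmp ((τ ^ j x y) x) y = cmp ((τ ^ j x y) (f x)) (f y) := by
      rw [← hfz x hx _ hj]
      exact (hf.cmp_map_eq (ht' _ hj x hx) (hut' hy)).symm
    have h8 : f y < (τ ^ k x y) (f x) := by
      rw [← hfz x hx _ hk]
      exact hf (hut' hy) (ht' _ hk x hx) h5
    rcases h6 i with h6 | h6
    · rcases h6.lt_or_eq with h9 | h9
      · have h10 : (τ ^ i) (f x) < (τ ^ j x y) (f x) := by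
          rw [← cmp_eq_lt_iff, hcm, cmp_eq_lt_iff]; exact h9
        have h11 : (τ ^ j x y) (f x) ≤ f y := by
          rw [← hfz x hx _ hj]
          exact hf.monotoneOn (ht' _ hj x hx) (hut' hy) h4
        rw [(cmp_eq_lt_iff _ _).2 (h9.trans_le h4), (cmp_eq_lt_iff _ _).2 (h10.trans_le h11)]
      · have h10 : (τ ^ i) (f x) = (τ ^ j x y) (f x) := by
          rw [← cmp_eq_eq_iff, hcm, cmp_eq_eq_iff]; exact h9
        rw [h9, h10, h7]
    · have h10 : (τ ^ k x y) (f x) ≤ (τ ^ i) (f x) := by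
        refine not_lt.1 fun h => h6.not_gt ?_
        rw [← cmp_eq_lt_iff, ← hcm, cmp_eq_lt_iff]; exact h
      rw [(cmp_eq_gt_iff _ _).2 (h5.trans_le h6), (cmp_eq_gt_iff _ _).2 (h8.trans_le h10)]
  obtain ⟨h, hcom, hh⟩ := hiso.exists_orderIso hτ hτ
  refine ⟨h, hcom, fun x hx => ?_⟩
  obtain ⟨⟨i, y⟩, hiy, rfl⟩ := Finset.mem_image.1 hx
  obtain ⟨hi, hy⟩ := Finset.mem_product.1 hiy
  rw [Finset.mem_Icc] at hi
  dsimp only at *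
  have hy' : h y = f y := hh (y, f y) (Finset.mem_image_of_mem _ hy)
  have hcz : ∀ m : ℤ, ∀ x, h ((τ ^ m) x) = (τ ^ m) (h x) := by
    intro m
    have hcp : h * τ = τ * h := by ext x; exact hcom x
    have := (show Commute h τ from hcp).zpow_right m
    exact fun x => DFunLike.congr_fun this.eq x
  rw [hcz, hy', hfz y hy i (by omega)]

end

/-! ### Decomposition of an automorphism into finitely many homogeneous pieces -/

/-- The word `w` is the sequence of colours of an increasing sequence of points of `J`. -/
def Realizes {α : Type*} [LinearOrder α] (c : α → Ordering) : List Ordering → Set α → Prop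
  | [], _ => True
  | a :: w, J => ∃ x ∈ J, c x = a ∧ Realizes c w (J ∩ Set.Ioi x)

theorem Realizes.mono {α : Type*} [LinearOrder α] {c : α → Ordering} {w : List Ordering}
    {J K : Set α} (h : Realizes c w J) (hJK : J ⊆ K) : Realizes c w K := by
  induction w generalizing J K with
  | nil => trivial
  | cons a w ih =>
    obtain ⟨x, hx, hxa, hw⟩ := h
    exact ⟨x, hJK hx, hxa, ih hw (Set.inter_subset_inter_left _ hJK)⟩

section

variable {α : Type*} [LinearOrder α] {σ : α ≃o α}

/-- A nonempty invariant set that is a single point or realizes all words in its colours. -/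
def IsAtomPiece (σ : α ≃o α) (J : Set α) : Prop :=
  J.Nonempty ∧ (∀ x, σ x ∈ J ↔ x ∈ J) ∧
    (J.Subsingleton ∨ ∀ w, (∀ a ∈ w, a ∈ orbSign σ '' J) → Realizes (orbSign σ) w J)

/-- The map `π` cuts `J` into `n` atom pieces. -/
def CutsInto (σ : α ≃o α) (J : Set α) (n : ℕ) (π : α → ℕ) : Prop :=
  MonotoneOn π J ∧ (∀ x ∈ J, π x < n) ∧ ∀ i < n, IsAtomPiece σ {x | x ∈ J ∧ π x = i}

theorem IsAtomPiece.cutsInto {J : Set α} (h : IsAtomPiece σ J) : ∃ n π, CutsInto σ J n π := by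
  refine ⟨1, fun _ => 0, monotoneOn_const, fun _ _ => Nat.one_pos, fun i hi => ?_⟩
  obtain rfl : i = 0 := by omega
  simpa using h

theorem CutsInto.union {J K : Set α} (hJK : ∀ x ∈ J, ∀ y ∈ K, x < y)
    (hJ : ∃ n π, CutsInto σ J n π) (hK : ∃ n π, CutsInto σ K n π) :
    ∃ n π, CutsInto σ (J ∪ K) n π := by
  classical
  obtain ⟨n, π, h1, h2, h3⟩ := hJ
  obtain ⟨m, ρ, h4, h5, h6⟩ := hK
  have hKJ : ∀ x ∈ K, x ∉ J := fun x hx hx' => lt_irrefl _ (hJK x hx' x hx)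
  refine ⟨n + m, fun x => if x ∈ J then π x else n + ρ x, ?_, ?_, ?_⟩
  · rintro x (hx | hx) y (hy | hy) hxy
    · simpa [hx, hy] using h1 hx hy hxy
    · have := h2 x hx
      simp only [hx, hKJ y hy, if_true, if_false]
      omega
    · exact absurd (hJK y hy x hx) hxy.not_gt
    · simpa [hKJ x hx, hKJ y hy] using h4 hx hy hxy
  · rintro x (hx | hx)
    · have := h2 x hx
      simp only [hx, if_true]
      omega
    · have := h5 x hx
      simp only [hKJ x hx, if_false]
      omega
  · intro i hi
    rcases lt_or_ge i n with hin | hin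
    · convert h3 i hin using 1
      ext x
      simp only [Set.mem_ofPred_eq, Set.mem_union]
      constructor
      · rintro ⟨hx | hx, h⟩
        · exact ⟨hx, by simpa [hx] using h⟩
        · simp only [hKJ x hx, if_false] at h
          omega
      · rintro ⟨hx, h⟩
        exact ⟨.inl hx, by simpa [hx] using h⟩
    · convert h6 (i - n) (by omega) using 1
      ext x
      simp only [Set.mem_ofPred_eq, Set.mem_union]
      constructor
      · rintro ⟨hx | hx, h⟩
        · have := h2 x hx
          simp only [hx, if_true] at h
          omega
        · simp only [hKJ x hx, if_false] at h
          exact ⟨hx, by omega⟩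
      · rintro ⟨hx, h⟩
        refine ⟨.inr hx, ?_⟩
        simp only [hKJ x hx, if_false]
        omega

/-- Outer induction on the set of colours, inner induction on a word that is not realized. Cutting
just before the occurrences of the first letter `a` leaves a lower part without `a`, and an upper
part that, up to one fixed point, omits the shorter word. -/
theorem exists_cutsInto_of_colours (A : Finset Ordering) : ∀ J : Set α, (∀ x, σ x ∈ J ↔ x ∈ J) →
    (∀ x ∈ J, orbSign σ x ∈ A) → ∃ n π, CutsInto σ J n π := by
  classical
  induction A using Finset.strongInduction with
  | H A ih =>
  have hempty : ∃ n π, CutsInto σ (∅ : Set α) n π :=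
    ⟨0, fun _ => 0, monotoneOn_const, by simp, by simp⟩
  have key : ∀ w : List Ordering, (∀ a ∈ w, a ∈ A) → ∀ J : Set α, (∀ x, σ x ∈ J ↔ x ∈ J) →
      (∀ x ∈ J, orbSign σ x ∈ A) → ¬ Realizes (orbSign σ) w J → ∃ n π, CutsInto σ J n π := by
    intro w
    induction w with
    | nil => exact fun _ J _ _ h => absurd trivial h
    | cons a w ihw =>
      intro hw J hJ hJA hreal
      set J₂ : Set α := {x | x ∈ J ∧ ∃ y ∈ J, y ≤ x ∧ orbSign σ y = a} with hJ₂
      have hJ₂inv : ∀ x, σ x ∈ J₂ ↔ x ∈ J₂ := fun x => by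
        constructor
        · rintro ⟨h1, y, h2, h3, h4⟩
          refine ⟨(hJ x).1 h1, σ.symm y, (hJ _).1 (by simpa using h2),
            by rwa [OrderIso.symm_apply_le], ?_⟩
          rw [← h4, ← orbSign_apply, OrderIso.apply_symm_apply]
        · rintro ⟨h1, y, h2, h3, h4⟩
          exact ⟨(hJ x).2 h1, σ y, (hJ y).2 h2, σ.monotone h3, by rw [orbSign_apply, h4]⟩
      set J₁ : Set α := J \ J₂ with hJ₁
      have hd1 : ∃ n π, CutsInto σ J₁ n π := by
        refine ih (A.erase a) (Finset.erase_ssubset (hw a (by simp))) J₁ (fun x => ?_) fun x hx => ?_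
        · rw [hJ₁, Set.mem_sdiff, Set.mem_sdiff, hJ, hJ₂inv]
        · refine Finset.mem_erase.2 ⟨fun h => hx.2 ⟨hx.1, x, hx.1, le_rfl, h⟩, hJA x hx.1⟩
      have hlt : ∀ x ∈ J₁, ∀ y ∈ J₂, x < y := by
        rintro x hx y ⟨-, z, hz, hzy, hza⟩
        refine lt_of_not_ge fun hyx => hx.2 ⟨hx.1, z, hz, hzy.trans hyx, hza⟩
      have hun : J₁ ∪ J₂ = J := Set.sdiff_union_of_subset fun x hx => hx.1
      rw [← hun]
      refine CutsInto.union hlt hd1 ?_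
      rcases J₂.eq_empty_or_nonempty with h0 | ⟨x₀, -, y₀, hy₀, -, hya₀⟩
      · rw [h0]; exact hempty
      by_cases hmin : ∃ m ∈ J₂, orbSign σ m = a ∧ ∀ x ∈ J₂, m ≤ x
      · obtain ⟨m, hm, hma, hmin⟩ := hmin
        -- The set `J₂` is invariant, so its least element is fixed and forms a piece of its own.
        have hfix : σ m = m := by
          refine le_antisymm ?_ (hmin _ ((hJ₂inv m).2 hm))
          have := hmin (σ.symm m) ((hJ₂inv _).1 (by simpa using hm))
          rwa [← OrderIso.le_symm_apply]
        have hsplit : J₂ = {m} ∪ (J ∩ Set.Ioi m) := by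
          ext x
          constructor
          · intro hx
            rcases (hmin x hx).eq_or_lt with h | h
            · exact .inl h.symm
            · exact .inr ⟨hx.1, h⟩
          · rintro (rfl | ⟨hx, h⟩)
            · exact hm
            · exact ⟨hx, m, hm.1, le_of_lt h, hma⟩
        rw [hsplit]
        refine CutsInto.union (by rintro x rfl y ⟨-, hy⟩; exact hy) (IsAtomPiece.cutsInto
          ⟨⟨m, rfl⟩, fun x => ?_, .inl Set.subsingleton_singleton⟩) ?_
        · rw [Set.mem_singleton_iff, Set.mem_singleton_iff]
          conv_lhs => rw [← hfix]
          exact σ.injective.eq_iff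
        · refine ihw (fun b hb => hw b (by simp [hb])) _ (fun x => ?_) (fun x hx => hJA x hx.1)
            fun hr => hreal ⟨m, hm.1, hma, hr⟩
          rw [Set.mem_inter_iff, Set.mem_inter_iff, hJ, Set.mem_Ioi, Set.mem_Ioi]
          conv_lhs => rw [← hfix]
          rw [σ.lt_iff_lt]
      · push Not at hmin
        -- With no least `a`, below any point of `J₂` there is strictly an `a`; a copy of `w` in
        -- `J₂` would therefore extend to a copy of `a :: w` in `J`.
        refine ihw (fun b hb => hw b (by simp [hb])) _ hJ₂inv (fun x hx => hJA x hx.1) fun hr => ?_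
        rcases w with _ | ⟨b, w⟩
        · exact hreal ⟨y₀, hy₀, hya₀, trivial⟩
        · obtain ⟨y, hy, hyb, hrw⟩ := hr
          obtain ⟨hyJ, x, hx, hxy, hxa⟩ := id hy
          obtain ⟨z, ⟨hzJ, x', hx', hxz, hxa'⟩, hzx⟩ := hmin x ⟨hx, x, hx, le_rfl, hxa⟩ hxa
          refine hreal ⟨x', hx', hxa', y, ⟨hyJ, hxz.trans_lt (hzx.trans_le hxy)⟩, hyb,
            hrw.mono ?_⟩
          rintro u ⟨hu, hyu⟩
          exact ⟨⟨hu.1, (hxz.trans_lt (hzx.trans_le hxy)).trans hyu⟩, hyu⟩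
  intro J hJ hJA
  rcases J.eq_empty_or_nonempty with rfl | hne
  · exact hempty
  by_cases hsurj : ∀ a ∈ A, a ∈ orbSign σ '' J
  · by_cases hfull : ∀ w, (∀ a ∈ w, a ∈ A) → Realizes (orbSign σ) w J
    · refine IsAtomPiece.cutsInto ⟨hne, hJ, .inr fun w hw => hfull w fun a ha => ?_⟩
      obtain ⟨x, hx, rfl⟩ := hw a ha
      exact hJA x hx
    · push Not at hfull
      obtain ⟨w, hw, hreal⟩ := hfull
      exact key w hw J hJ hJA hreal
  · push Not at hsurj
    obtain ⟨a, ha, haJ⟩ := hsurj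
    exact ih (A.erase a) (Finset.erase_ssubset ha) J hJ fun x hx =>
      Finset.mem_erase.2 ⟨fun h => haJ ⟨x, hx, h⟩, hJA x hx⟩

theorem CutsInto.merge {n : ℕ} {π : α → ℕ} (h : CutsInto σ Set.univ (n + 1) π) {i : ℕ}
    (hi : i + 1 < n + 1) (hm : IsAtomPiece σ {x | π x = i ∨ π x = i + 1}) :
    ∃ π', CutsInto σ Set.univ n π' := by
  obtain ⟨h1, h2, h3⟩ := h
  refine ⟨fun x => if π x ≤ i then π x else π x - 1, ?_, ?_, ?_⟩
  · intro x _ y _ hxy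
    have := h1 (Set.mem_univ x) (Set.mem_univ y) hxy
    dsimp only
    split_ifs <;> omega
  · intro x hx
    have := h2 x hx
    dsimp only
    split_ifs <;> omega
  · intro j hj
    rcases lt_trichotomy j i with hji | rfl | hji
    · convert h3 j (by omega) using 1
      ext x
      simp only [Set.mem_ofPred_eq, Set.mem_univ, true_and]
      split_ifs <;> omega
    · convert hm using 1
      ext x
      simp only [Set.mem_ofPred_eq, Set.mem_univ, true_and]
      split_ifs <;> omega
    · convert h3 (j + 1) (by omega) using 1
      ext x
      simp only [Set.mem_ofPred_eq, Set.mem_univ, true_and]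
      split_ifs <;> omega

/-- All pieces that are not single points realize all words in their colours. -/
structure IsFullPlacement (S : SumShape) (σ : α ≃o α) (π : α → ℕ) : Prop
    extends IsPlacement S σ π where
  ex : ∀ i < S.n, ∃ x, π x = i
  full : ∀ i < S.n, ¬ S.sg i → ∀ w : List Ordering, (∀ a ∈ w, a ∈ S.A i) →
    Realizes (orbSign σ) w {x | π x = i}

/-- Single points are neither first nor last nor adjacent. -/
structure SumShape.IsSpread (S : SumShape) : Prop where
  pos : 0 < S.n
  zero : ¬ S.sg 0
  last : ∀ i, i + 1 = S.n → ¬ S.sg i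
  adj : ∀ i, i + 1 < S.n → ¬ (S.sg i ∧ S.sg (i + 1))

/-- Take a decomposition with the least number of pieces. If the colours of one piece were contained
in those of an adjacent piece that is not a single point, the two would merge; this gives
reducedness. Density and the absence of endpoints restrict the single points. -/
theorem exists_isFullPlacement [DenselyOrdered α] [NoMinOrder α] [NoMaxOrder α] [Nonempty α]
    (σ : α ≃o α) : ∃ S π, IsFullPlacement S σ π ∧ S.IsReduced ∧ S.IsSpread := by
  classical
  have hex : ∃ n π, CutsInto σ (Set.univ : Set α) n π :=
    exists_cutsInto_of_colours {.lt, .eq, .gt} _ (by simp) fun x _ => by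
      rcases orbSign σ x with _ | _ | _ <;> simp
  obtain ⟨π, h1, h2, h3⟩ := Nat.find_spec hex
  set n := Nat.find hex with hn
  have hmerge : ∀ i, i + 1 < n → ¬ IsAtomPiece σ {x | π x = i ∨ π x = i + 1} := by
    intro i hi hat
    obtain ⟨m, hm⟩ : ∃ m, n = m + 1 := ⟨n - 1, by omega⟩
    obtain ⟨π', h'⟩ := CutsInto.merge (n := m) (hm ▸ ⟨h1, h2, h3⟩) (by omega) hat
    exact Nat.find_min hex (by omega : m < n) ⟨π', h'⟩
  have h1 : Monotone π := fun x y => h1 (Set.mem_univ x) (Set.mem_univ y)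
  simp only [Set.mem_univ, true_and, forall_const] at h2 h3
  let S : SumShape :=
    -- The conjunct `i < n` excludes the empty fibres, which are also subsingletons.
    ⟨n, fun i => orbSign σ '' {x | π x = i}, fun i => i < n ∧ {x | π x = i}.Subsingleton⟩
  have hfull : ∀ i < n, ¬ S.sg i → ∀ w : List Ordering, (∀ a ∈ w, a ∈ S.A i) →
      Realizes (orbSign σ) w {x | π x = i} := fun i hi hsg =>
    (h3 i hi).2.2.resolve_left fun h => hsg ⟨hi, h⟩
  have hinv : ∀ x, π (σ x) = π x := fun x => ((h3 (π x) (h2 x)).2.1 x).2 rfl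
  have hlt : ∀ x y : α, π x < π y → x < y := fun x y h => h1.reflect_lt h
  have hunion : ∀ i, i + 1 < n → ∀ j, j = i ∨ j = i + 1 → ¬ S.sg j →
      ¬ (S.A i ⊆ S.A j ∧ S.A (i + 1) ⊆ S.A j) := by
    intro i hi j hj hsg hA
    refine hmerge i hi ⟨?_, fun x => by simp only [Set.mem_ofPred_eq, hinv], .inr fun w hw => ?_⟩
    · obtain ⟨x, hx⟩ := (h3 i (by omega)).1
      exact ⟨x, .inl hx⟩
    · refine (hfull j (by omega) hsg w fun a ha => ?_).mono fun x hx => ?_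
      · obtain ⟨x, hx | hx, rfl⟩ := hw a ha
        · exact hA.1 ⟨x, hx, rfl⟩
        · exact hA.2 ⟨x, hx, rfl⟩
      · rcases hj with rfl | rfl
        · exact .inl hx
        · exact .inr hx
  refine ⟨S, π, ⟨⟨h1, h2, hinv, fun x => ⟨x, rfl, rfl⟩, fun x y h hxy => h.2 rfl hxy.symm⟩,
    fun i hi => (h3 i hi).1, hfull⟩, ⟨?_, ?_, ?_, ?_⟩, ⟨?_, ?_, ?_, ?_⟩⟩
  · intro i hi
    exact (h3 i hi).1.image _
  · rintro i ⟨hi, hsub⟩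
    obtain ⟨x, hx⟩ := (h3 i hi).1
    have hσx : orbSign σ x = .eq := orbSign_eq_eq.2 (hsub hx ((hinv x).trans hx))
    refine Set.eq_singleton_iff_unique_mem.2 ⟨⟨x, hx, hσx⟩, ?_⟩
    rintro _ ⟨y, hy, rfl⟩
    rw [hsub hy hx, hσx]
  · exact fun i hi hsg hA => hunion i hi i (.inl rfl) hsg ⟨subset_rfl, hA⟩
  · exact fun i hi hsg hA => hunion i hi (i + 1) (.inr rfl) hsg ⟨hA, subset_rfl⟩
  · exact (Nat.zero_le _).trans_lt (h2 (Classical.arbitrary α))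
  · rintro ⟨hi, hsub⟩
    obtain ⟨x, hx⟩ := (h3 0 hi).1
    obtain ⟨y, hy⟩ := exists_lt x
    have hx' : π x = 0 := hx
    have := h1 hy.le
    exact hy.ne (hsub (show π y = 0 by omega) hx)
  · rintro i hin ⟨hi, hsub⟩
    obtain ⟨x, hx⟩ := (h3 i hi).1
    obtain ⟨y, hy⟩ := exists_gt x
    have hx' : π x = i := hx
    have := h1 hy.le
    have := h2 y
    have hin : i + 1 = n := hin
    exact hy.ne (hsub hx (show π y = i by omega))
  · rintro i hi' ⟨⟨hi, hsub⟩, ⟨hi1, hsub1⟩⟩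
    obtain ⟨x, hx⟩ := (h3 i hi).1
    obtain ⟨y, hy⟩ := (h3 (i + 1) hi1).1
    have hx' : π x = i := hx
    have hy' : π y = i + 1 := hy
    obtain ⟨z, hxz, hzy⟩ := exists_between (hlt x y (by omega))
    have hz1 := h1 hxz.le
    have hz2 := h1 hzy.le
    rcases (by omega : π z = i ∨ π z = i + 1) with h | h
    · exact hxz.ne (hsub hx h)
    · exact hzy.ne (hsub1 h hy)

end

/-! ### Comparison of the finite restrictions of two automorphisms -/

section

variable {α β : Type*} [LinearOrder α] [LinearOrder β]

/-- The word is the list of colours of `s` in increasing order, and realizing it yields an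
increasing colour-preserving map. -/
theorem exists_word [Nonempty β] (c : α → Ordering) (d : β → Ordering) (s : Finset α) :
    ∃ w : List Ordering, (∀ a ∈ w, ∃ x ∈ s, c x = a) ∧ ∀ J : Set β, Realizes d w J →
      ∃ g : α → β, StrictMonoOn g s ∧ ∀ x ∈ s, g x ∈ J ∧ d (g x) = c x := by
  classical
  induction s using Finset.induction_on_min with
  | empty =>
    exact ⟨[], by simp, fun J _ => ⟨fun _ => Classical.arbitrary β, fun x hx => by simp at hx, by simp⟩⟩
  | insert a s ha ih =>
    obtain ⟨w, hw, hg⟩ := ih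
    refine ⟨c a :: w, ?_, ?_⟩
    · intro b hb
      rcases List.mem_cons.1 hb with rfl | hb
      · exact ⟨a, by simp, rfl⟩
      · obtain ⟨x, hx, h⟩ := hw b hb
        exact ⟨x, by simp [hx], h⟩
    · rintro J ⟨y, hy, hya, hr⟩
      obtain ⟨g, hg1, hg2⟩ := hg _ hr
      have hne : ∀ x ∈ s, x ≠ a := fun x hx => (ha x hx).ne'
      refine ⟨Function.update g a y, ?_, ?_⟩
      · intro x hx z hz hxz
        simp only [Finset.coe_insert, Set.mem_insert_iff, Finset.mem_coe] at hx hz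
        rcases hx with rfl | hx <;> rcases hz with rfl | hz
        · exact absurd hxz (lt_irrefl _)
        · rw [Function.update_self, Function.update_of_ne (hne z hz)]
          exact (hg2 z hz).1.2
        · exact absurd hxz (ha x hx).not_gt
        · rw [Function.update_of_ne (hne z hz), Function.update_of_ne (hne x hx)]
          exact hg1 hx hz hxz
      · intro x hx
        rcases Finset.mem_insert.1 hx with rfl | hx
        · rw [Function.update_self]
          exact ⟨hy, hya⟩
        · rw [Function.update_of_ne (hne x hx)]
          exact ⟨(hg2 x hx).1.1, (hg2 x hx).2⟩

variable {S : SumShape} {σ : α ≃o α} {τ : β ≃o β} {π : α → ℕ} {π' : β → ℕ}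

theorem IsPlacement.exists_strictMonoOn [Nonempty β] (hS : S.IsReduced) (hσ : IsPlacement S σ π)
    (hτ : IsFullPlacement S τ π') (s : Finset α) :
    ∃ g : α → β, StrictMonoOn g s ∧ ∀ x ∈ s, orbSign τ (g x) = orbSign σ x := by
  classical
  have hi : ∀ i, ∃ g : α → β, StrictMonoOn g (s.filter fun x => π x = i) ∧
      ∀ x ∈ s, π x = i → π' (g x) = i ∧ orbSign τ (g x) = orbSign σ x := fun i => by
    by_cases hin : i < S.n
    swap
    · refine ⟨fun _ => Classical.arbitrary β, fun x hx => ?_, fun x _ hxi => ?_⟩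
      · exact absurd (hσ.lt x) ((Finset.mem_filter.1 hx).2 ▸ hin)
      · exact absurd (hσ.lt x) (hxi ▸ hin)
    by_cases hsg : S.sg i
    · obtain ⟨y, hy⟩ := hτ.ex i hin
      refine ⟨fun _ => y, fun x hx z hz hxz => ?_, fun x _ hxi => ⟨hy, ?_⟩⟩
      · have hx := (Finset.mem_filter.1 hx).2
        have hz := (Finset.mem_filter.1 hz).2
        exact absurd (hσ.single x z (hx ▸ hsg) (hx.trans hz.symm)) hxz.ne
      · have h1 := hσ.sgn x
        have h2 := hτ.sgn y
        rw [hxi, hS.single i hsg] at h1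
        rw [hy, hS.single i hsg] at h2
        exact Eq.trans h2 h1.symm
    · obtain ⟨w, hw, hg⟩ := exists_word (orbSign σ) (orbSign τ) (s.filter fun x => π x = i)
      obtain ⟨g, hg1, hg2⟩ := hg _ (hτ.full i hin hsg w fun a ha => by
        obtain ⟨x, hx, rfl⟩ := hw a ha
        exact (Finset.mem_filter.1 hx).2 ▸ hσ.sgn x)
      exact ⟨g, hg1, fun x hx hxi => hg2 x (Finset.mem_filter.2 ⟨hx, hxi⟩)⟩
  choose g hg1 hg2 using hi
  refine ⟨fun x => g (π x) x, fun x hx y hy hxy => ?_, fun x hx => (hg2 _ x hx rfl).2⟩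
  rcases (hσ.mono hxy.le).eq_or_lt with h | h
  · dsimp only
    rw [← h]
    exact hg1 _ (Finset.mem_filter.2 ⟨hx, rfl⟩) (Finset.mem_filter.2 ⟨hy, h.symm⟩) hxy
  · refine hτ.mono.reflect_lt ?_
    dsimp only
    rwa [(hg2 _ x hx rfl).1, (hg2 _ y hy rfl).1]

/-- In a piece that is not a single point, every admitted colour recurs above every point: by
density in a shuffle, along the orbit in a single hull. Words are then realized letter by letter. -/
theorem IsShuffleSum.isFullPlacement (hS : S.IsReduced) (hτ : IsShuffleSum S τ π') :
    IsFullPlacement S τ π' := by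
  have hex : ∀ i < S.n, ∃ x, π' x = i := fun i hi => by
    obtain ⟨s, hs⟩ := hS.nonempty i hi
    obtain ⟨y, hy, -⟩ := hτ.exists_le hS ∅ hi hs
    exact ⟨y, hy⟩
  refine ⟨hτ.toIsPlacement, hex, fun i hi hsg w hw => ?_⟩
  have hgt : ∀ x, π' x = i → ∀ s ∈ S.A i, ∃ y, π' y = i ∧ orbSign τ y = s ∧ x < y := by
    intro x hx s hs
    by_cases hd : S.IsDense i
    · obtain ⟨z, h1, h2, h3, -⟩ := hτ.ext i hi s hs {x} ∅ (by simp) (by simp [hx, hd]) (by simp)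
      exact ⟨z, h1, h2, (h3 x (by simp)).lt⟩
    · simp only [SumShape.IsDense, hsg, not_false_eq_true, true_and, not_forall, not_not] at hd
      obtain ⟨s', hs', hA⟩ := hd
      have hxs := hτ.sgn x
      rw [hx, hA] at hxs
      rw [hA] at hs
      obtain rfl : s = s' := hs
      have hxs : orbSign τ x = s := hxs
      rcases s with _ | _ | _
      · exact ⟨τ x, by rw [hτ.inv, hx], by rw [orbSign_apply, hxs], orbSign_eq_lt.1 hxs⟩
      · exact absurd rfl hs'
      · refine ⟨τ.symm x, ?_, ?_, ?_⟩
        · rw [← hτ.inv, OrderIso.apply_symm_apply, hx]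
        · rw [← orbSign_apply, OrderIso.apply_symm_apply, hxs]
        · rw [OrderIso.lt_symm_apply]
          exact orbSign_eq_gt.1 hxs
  have hreal : ∀ w : List Ordering, (∀ a ∈ w, a ∈ S.A i) → ∀ x, π' x = i →
      Realizes (orbSign τ) w ({x | π' x = i} ∩ Set.Ioi x) := by
    intro w
    induction w with
    | nil => exact fun _ _ _ => trivial
    | cons a w ih =>
      intro hw x hx
      obtain ⟨y, hy, hya, hxy⟩ := hgt x hx a (hw a (by simp))
      refine ⟨y, ⟨hy, hxy⟩, hya, (ih (fun b hb => hw b (by simp [hb])) y hy).mono ?_⟩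
      rintro z ⟨hz, hyz⟩
      exact ⟨⟨hz, hxy.trans hyz⟩, hyz⟩
  obtain ⟨x, hx⟩ := hex i hi
  exact (hreal w hw x hx).mono Set.inter_subset_left

/-- Each finite restriction of `σ` embeds into `τ`. -/
def AgeLe (σ : α ≃o α) (τ : β ≃o β) : Prop :=
  ∀ s : Finset α, ∃ f : α → β, ∀ x ∈ s, ∀ y ∈ s,
    cmp x y = cmp (f x) (f y) ∧ cmp x (σ y) = cmp (f x) (τ (f y))

/-- One step of building an orbit segment from left to right. The point `z` is forced when `x` is
already an image, and otherwise chosen in a gap. The bound by `τ (τ (f m))` keeps it in the orbit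
hull of `f m`. -/
theorem exists_next_point [DenselyOrdered β] [NoMinOrder β] [NoMaxOrder β] {s : Finset α}
    {f : α → β} (hf : ∀ x ∈ s, ∀ y ∈ s, cmp x y = cmp (f x) (f y) ∧
      cmp x (σ y) = cmp (f x) (τ (f y))) {m x : α} (hm : m ∈ s) (hmax : ∀ y ∈ s, y ≤ m)
    (hx : ∀ y ∈ s, y < x) (hmσ : m < σ m) :
    ∃ z, (∀ y ∈ s, f y < z) ∧ z < τ (τ (f m)) ∧ ∀ y ∈ s, cmp x (σ y) = cmp z (τ (f y)) := by
  classical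
  have hlt : ∀ x ∈ s, ∀ y ∈ s, (x < y ↔ f x < f y) := fun x hx y hy => by
    rw [← cmp_eq_lt_iff, ← cmp_eq_lt_iff (f x), (hf x hx y hy).1]
  have hlt' : ∀ x ∈ s, ∀ y ∈ s, (x < σ y ↔ f x < τ (f y)) := fun x hx y hy => by
    rw [← cmp_eq_lt_iff, ← cmp_eq_lt_iff (f x), (hf x hx y hy).2]
  have hle : ∀ y ∈ s, f y ≤ f m := fun y hy =>
    not_lt.1 fun h => (hmax y hy).not_gt ((hlt m hm y hy).2 h)
  have hfm : f m < τ (f m) := (hlt' m hm m hm).1 hmσ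
  have hfm2 : τ (f m) < τ (τ (f m)) := τ.strictMono hfm
  by_cases h : ∃ y ∈ s, x = σ y
  · obtain ⟨y, hy, rfl⟩ := h
    refine ⟨τ (f y), fun y' hy' => (hlt' y' hy' y hy).1 (hx y' hy'),
      (τ.monotone (hle y hy)).trans_lt hfm2, fun y' hy' => ?_⟩
    rw [σ.strictMono.cmp_map_eq, τ.strictMono.cmp_map_eq, (hf y hy y' hy').1]
  push Not at h
  have : Nonempty β := ⟨f m⟩
  obtain ⟨z, hlo, hhi⟩ := Order.exists_between_finsets
    (s.image f ∪ (s.filter fun y => σ y < x).image fun y => τ (f y))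
    (insert (τ (τ (f m))) ((s.filter fun y => x < σ y).image fun y => τ (f y))) (by
      simp only [Finset.mem_union, Finset.mem_insert, Finset.mem_image, Finset.mem_filter]
      rintro _ (⟨y, hy, rfl⟩ | ⟨y, ⟨hy, hyx⟩, rfl⟩) _ (rfl | ⟨y', ⟨hy', hyx'⟩, rfl⟩)
      · exact (hle y hy).trans_lt (hfm.trans hfm2)
      · exact (hlt' y hy y' hy').1 ((hx y hy).trans hyx')
      · exact (τ.monotone (hle y hy)).trans_lt hfm2
      · exact τ.strictMono ((hlt y hy y' hy').1 (σ.lt_iff_lt.1 (hyx.trans hyx'))))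
  refine ⟨z, fun y hy => hlo _ (Finset.mem_union_left _ (Finset.mem_image_of_mem _ hy)),
    hhi _ (Finset.mem_insert_self _ _), fun y hy => ?_⟩
  rcases lt_trichotomy x (σ y) with h1 | h1 | h1
  · rw [(cmp_eq_lt_iff _ _).2 h1, (cmp_eq_lt_iff _ _).2]
    exact hhi _ (Finset.mem_insert_of_mem (Finset.mem_image.2
      ⟨y, Finset.mem_filter.2 ⟨hy, h1⟩, rfl⟩))
  · exact absurd h1 (h y hy)
  · rw [(cmp_eq_gt_iff _ _).2 h1, (cmp_eq_gt_iff _ _).2]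
    exact hlo _ (Finset.mem_union_right _ (Finset.mem_image.2
      ⟨y, Finset.mem_filter.2 ⟨hy, h1⟩, rfl⟩))

end

/-! ### Finite restrictions depend only on colour words -/

section

variable {α β : Type*} [LinearOrder α] [LinearOrder β] {σ : α ≃o α} {τ : β ≃o β}

theorem not_far_trans {a b c : α} (h1 : ¬ Far σ a b) (h2 : ¬ Far σ b c) : ¬ Far σ a c := by
  simp only [Far, not_forall, not_lt] at *
  obtain ⟨k, hk⟩ := h1
  obtain ⟨j, hj⟩ := h2
  exact ⟨j + k, hj.trans (by rw [zpow_apply_add]; exact (σ ^ j).monotone hk)⟩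

/-- A maximal run of points with one colour other than `.eq` goes into one hull of `τ`, even if `σ`
has its points in different hulls; finitely many comparisons cannot tell. A change of colour, or a
fixed point, starts again at the value of `g`. The second clause, that each `f y` shares a hull with
some `g w` of its colour, keeps the runs apart. -/
theorem exists_age_map_of_strictMonoOn [DenselyOrdered β] [NoMinOrder β] [NoMaxOrder β]
    (g : α → β) (s : Finset α) (hg : StrictMonoOn g s)
    (hgs : ∀ x ∈ s, orbSign τ (g x) = orbSign σ x) :
    ∃ f : α → β, (∀ x ∈ s, ∀ y ∈ s, cmp x y = cmp (f x) (f y) ∧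
      cmp x (σ y) = cmp (f x) (τ (f y))) ∧
      ∀ y ∈ s, ∃ w ∈ s, orbSign σ w = orbSign σ y ∧ ¬ Far τ (f y) (g w) ∧ ¬ Far τ (g w) (f y) := by
  classical
  induction s using Finset.induction_on_max with
  | empty => exact ⟨g, by simp, by simp⟩
  | insert x s hx ih =>
  obtain ⟨f, hf, hfg⟩ := ih (hg.mono (by simp)) fun y hy => hgs y (by simp [hy])
  have hne : ∀ y ∈ s, y ≠ x := fun y hy => (hx y hy).ne
  suffices h : ∃ z, (∀ y ∈ s, f y < z) ∧ (∀ y ∈ s, cmp x (σ y) = cmp z (τ (f y))) ∧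
      (∀ y ∈ s, cmp y (σ x) = cmp (f y) (τ z)) ∧ orbSign σ x = orbSign τ z ∧
      ∃ w ∈ insert x s, orbSign σ w = orbSign σ x ∧ ¬ Far τ z (g w) ∧ ¬ Far τ (g w) z by
    obtain ⟨z, h1, h2, h3, h4, w, hw, h5⟩ := h
    refine ⟨Function.update f x z, fun y hy y' hy' => ?_, fun y hy => ?_⟩
    · rcases Finset.mem_insert.1 hy with rfl | hy1 <;> rcases Finset.mem_insert.1 hy' with rfl | hy2
      · rw [Function.update_self]
        exact ⟨by simp, h4⟩
      · rw [Function.update_self, Function.update_of_ne (hne y' hy2)]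
        exact ⟨by rw [(cmp_eq_gt_iff _ _).2 (hx y' hy2), (cmp_eq_gt_iff _ _).2 (h1 y' hy2)],
          h2 y' hy2⟩
      · rw [Function.update_self, Function.update_of_ne (hne y hy1)]
        exact ⟨by rw [(cmp_eq_lt_iff _ _).2 (hx y hy1), (cmp_eq_lt_iff _ _).2 (h1 y hy1)], h3 y hy1⟩
      · rw [Function.update_of_ne (hne y hy1), Function.update_of_ne (hne y' hy2)]
        exact hf y hy1 y' hy2
    · rcases Finset.mem_insert.1 hy with rfl | hy
      · rw [Function.update_self]
        exact ⟨w, hw, h5⟩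
      · rw [Function.update_of_ne (hne y hy)]
        obtain ⟨v, hv, h⟩ := hfg y hy
        exact ⟨v, by simp [hv], h⟩
  by_cases hB : ∃ m ∈ s, (∀ y ∈ s, y ≤ m) ∧ orbSign σ m = orbSign σ x ∧ orbSign σ x ≠ .eq
  · obtain ⟨m, hm, hmax, hmx, hxe⟩ := hB
    have hfm : orbSign σ m = orbSign τ (f m) := (hf m hm m hm).2
    have hle : ∀ y ∈ s, f y ≤ f m := fun y hy => by
      rw [← not_lt, ← cmp_eq_lt_iff, ← (hf m hm y hy).1, cmp_eq_lt_iff, not_lt]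
      exact hmax y hy
    have hclose : ∀ z, f m < z → (∃ k : ℤ, z < (τ ^ k) (f m)) → orbSign σ x = orbSign τ z ∧
        ∃ w ∈ insert x s, orbSign σ w = orbSign σ x ∧ ¬ Far τ z (g w) ∧ ¬ Far τ (g w) z := by
      rintro z hz ⟨k, hk⟩
      have h1 : ¬ Far τ (f m) z := fun h => (h k).not_gt hk
      have h2 : ¬ Far τ z (f m) := fun h => h.lt.not_gt hz
      obtain ⟨w, hw, hwm, h3, h4⟩ := hfg m hm
      exact ⟨by rw [orbSign_eq_of_not_far h1 h2, ← hfm, hmx], w, by simp [hw], hwm.trans hmx,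
        not_far_trans h2 h3, not_far_trans h4 h1⟩
    rcases hsx : orbSign σ x with _ | _ | _
    · have hmσ : m < σ m := orbSign_eq_lt.1 (hmx.trans hsx)
      obtain ⟨z, h1, h2, h3⟩ := exists_next_point hf hm hmax hx hmσ
      obtain ⟨h4, h5⟩ := hclose z (h1 m hm) ⟨2, by simpa [zpow_ofNat, pow_two] using h2⟩
      have h6 : z < τ z := orbSign_eq_lt.1 (h4.symm.trans hsx)
      rw [hsx] at h4 h5
      refine ⟨z, h1, h3, fun y hy => ?_, h4, h5⟩
      rw [(cmp_eq_lt_iff _ _).2 ((hx y hy).trans (orbSign_eq_lt.1 hsx)),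
        (cmp_eq_lt_iff _ _).2 ((h1 y hy).trans h6)]
    · exact absurd hsx hxe
    · have hmσ' : σ m < m := orbSign_eq_gt.1 (hmx.trans hsx)
      -- A decreasing run is an increasing run for the inverses, and the comparisons with `σ` and
      -- with `σ⁻¹` carry the same information.
      have hmσ : m < σ⁻¹ m := (OrderIso.lt_symm_apply σ).2 hmσ'
      have hcσ : ∀ y y' : α, cmp y (σ⁻¹ y') = cmp (σ y) y' := fun y y' => by
        rw [← σ.strictMono.cmp_map_eq]
        exact congrArg _ (σ.apply_symm_apply y')
      have hcτ : ∀ y y' : β, cmp y (τ⁻¹ y') = cmp (τ y) y' := fun y y' => by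
        rw [← τ.strictMono.cmp_map_eq]
        exact congrArg _ (τ.apply_symm_apply y')
      obtain ⟨z, h1, h2, h3⟩ := exists_next_point (σ := σ⁻¹) (τ := τ⁻¹) (fun y hy y' hy' =>
        ⟨(hf y hy y' hy').1, by
          rw [hcσ, hcτ, cmp_eq_cmp_symm]; exact (hf y' hy' y hy).2⟩) hm hmax hx hmσ
      obtain ⟨h4, h5⟩ := hclose z (h1 m hm) ⟨-2, by
        simpa [zpow_neg, zpow_ofNat, pow_two] using h2⟩
      rw [hsx] at h4 h5
      refine ⟨z, h1, fun y hy => ?_, fun y hy => ?_, h4, h5⟩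
      · rw [(cmp_eq_gt_iff _ _).2 (((σ.monotone (hmax y hy)).trans_lt hmσ').trans (hx m hm)),
          (cmp_eq_gt_iff _ _).2]
        refine ((τ.monotone (hle y hy)).trans_lt ?_).trans (h1 m hm)
        exact orbSign_eq_gt.1 (by rw [← hfm, hmx, hsx])
      · have := h3 y hy
        rwa [hcσ, hcτ, cmp_eq_cmp_symm] at this
  -- A new run begins at `x`. Both in `σ` and in `τ` it is far above everything before, which
  -- settles all comparisons.
  · have hfar : ∀ y ∈ s, Far σ y x ∧ Far τ (f y) (g x) := by
      intro y hy
      set m := s.max' ⟨y, hy⟩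
      have hm : m ∈ s := Finset.max'_mem _ _
      have hmax : ∀ y ∈ s, y ≤ m := fun y hy => Finset.le_max' _ _ hy
      have hc : orbSign σ m ≠ orbSign σ x ∨ orbSign σ m = .eq := by
        by_contra hcon
        rw [not_or, not_not] at hcon
        exact hB ⟨m, hm, hmax, hcon.1, hcon.1 ▸ hcon.2⟩
      refine ⟨(far_of_lt (hx m hm) hc).le_trans (hmax y hy), ?_⟩
      obtain ⟨w, hw, hwm, -, h1⟩ := hfg m hm
      have hgw : Far τ (g w) (g x) := far_of_lt
        (hg (by simp [hw]) (by simp) (hx w hw)) (by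
          rw [hgs w (by simp [hw]), hgs x (by simp), hwm]; exact hc)
      have hfm : Far τ (f m) (g x) := by
        simp only [Far, not_forall, not_lt] at h1
        obtain ⟨k, hk⟩ := h1
        exact Far.le_trans hk (hgw.zpow_left k)
      refine hfm.le_trans ?_
      rw [← not_lt, ← cmp_eq_lt_iff, ← (hf m hm y hy).1, cmp_eq_lt_iff, not_lt]
      exact hmax y hy
    refine ⟨g x, fun y hy => (hfar y hy).2.lt, fun y hy => ?_, fun y hy => ?_,
      (hgs x (by simp)).symm, x, by simp, rfl, not_far_self, not_far_self⟩
    · have h1 := (hfar y hy).1 1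
      have h2 := (hfar y hy).2 1
      rw [zpow_one] at h1 h2
      rw [(cmp_eq_gt_iff _ _).2 h1, (cmp_eq_gt_iff _ _).2 h2]
    · have h1 := ((hfar y hy).1.zpow_right 1).lt
      have h2 := ((hfar y hy).2.zpow_right 1).lt
      rw [zpow_one] at h1 h2
      rw [(cmp_eq_lt_iff _ _).2 h1, (cmp_eq_lt_iff _ _).2 h2]

theorem IsPlacement.ageLe [DenselyOrdered β] [NoMinOrder β] [NoMaxOrder β] [Nonempty β]
    {S : SumShape} {π : α → ℕ} {π' : β → ℕ} (hS : S.IsReduced) (hσ : IsPlacement S σ π)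
    (hτ : IsFullPlacement S τ π') : AgeLe σ τ := fun s => by
  obtain ⟨g, hg, hgs⟩ := hσ.exists_strictMonoOn hS hτ s
  obtain ⟨f, hf, -⟩ := exists_age_map_of_strictMonoOn g s hg hgs
  exact ⟨f, hf⟩

end

/-! ### Existence of shuffle sums -/

/-- The numbers `odd * 2 ^ r / 3 ^ k` have 2-adic valuation `r` and are dense for each fixed `r`. -/
theorem exists_dense_colouring : ∃ χ : ℚ → ℕ, ∀ r : ℕ, ∀ a b : ℚ, a < b →
    ∃ d, a < d ∧ d < b ∧ χ d = r := by
  refine ⟨fun q => (padicValRat 2 q).toNat, fun r a b hab => ?_⟩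
  have : Fact (Nat.Prime 2) := ⟨Nat.prime_two⟩
  obtain ⟨k, hk⟩ : ∃ k : ℕ, 2 * 2 ^ r / (b - a) < (3 : ℚ) ^ k :=
    pow_unbounded_of_one_lt _ (by norm_num)
  have hab' : 0 < b - a := sub_pos.2 hab
  rw [div_lt_iff₀ hab'] at hk
  have h3 : (0 : ℚ) < 3 ^ k := by positivity
  have h2 : (0 : ℚ) < 2 ^ r := by positivity
  -- `2 * m + 1` is the first odd integer above `a * 3 ^ k / 2 ^ r`, at distance at most 2; `k` was
  -- chosen to make the scaled interval longer than 2.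
  set m : ℤ := ⌊(a * 3 ^ k / 2 ^ r - 1) / 2⌋ + 1
  have hm1 : (a * 3 ^ k / 2 ^ r - 1) / 2 < m := by
    push_cast [m]
    exact Int.lt_floor_add_one _
  have hm2 : (m : ℚ) ≤ (a * 3 ^ k / 2 ^ r - 1) / 2 + 1 := by
    push_cast [m]
    linarith [Int.floor_le ((a * 3 ^ k / 2 ^ r - 1) / 2)]
  have hm3 : a * 3 ^ k < (2 * m + 1) * 2 ^ r := by
    rw [← div_lt_iff₀ h2]; linarith
  have hm4 : ((2 * m + 1 : ℤ) : ℚ) * 2 ^ r < b * 3 ^ k := by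
    have : (2 * m + 1 : ℚ) ≤ a * 3 ^ k / 2 ^ r + 2 := by linarith
    have := mul_le_mul_of_nonneg_right this h2.le
    rw [add_mul (a * 3 ^ k / 2 ^ r), div_mul_cancel₀ _ h2.ne'] at this
    push_cast
    nlinarith
  refine ⟨((2 * m + 1 : ℤ) : ℚ) * 2 ^ r / 3 ^ k, ?_, ?_, ?_⟩
  · rw [lt_div_iff₀ h3]; exact_mod_cast hm3
  · rw [div_lt_iff₀ h3]; exact hm4
  · have hodd : ((2 * m + 1 : ℤ) : ℚ) ≠ 0 := by
      exact_mod_cast (by omega : (2 * m + 1 : ℤ) ≠ 0)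
    have v1 : padicValRat 2 ((2 * m + 1 : ℤ) : ℚ) = 0 := by
      rw [padicValRat.of_int, padicValInt.eq_zero_of_not_dvd (by omega)]
      rfl
    have v2 : padicValRat 2 (3 : ℚ) = 0 := by
      have := padicValRat.of_int (p := 2) (z := 3)
      rw [padicValInt.eq_zero_of_not_dvd (by norm_num)] at this
      simpa using this
    have v3 : padicValRat 2 (2 : ℚ) = 1 := by
      have := padicValRat.self (p := 2) (by norm_num)
      simpa using this
    simp only
    rw [padicValRat.div (by positivity) h3.ne', padicValRat.mul hodd h2.ne',
      padicValRat.pow, padicValRat.pow, v1, v2, v3]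
    simp

/-- The points of a lexicographic sum of pieces: the piece `i`, the orbit hull `d` in the piece,
and the position `q` in the hull. The hull `d` in the piece `i` is moved in the direction
`c i d`. -/
@[ext]
structure SumPoint (S : SumShape) (c : ℕ → ℚ → Ordering) where
  i : ℕ
  d : ℚ
  q : ℚ
  hi : i < S.n
  hd : ¬ S.IsDense i → d = 0
  hq : c i d = .eq → q = 0

namespace SumPoint

variable {S : SumShape} {c : ℕ → ℚ → Ordering}

noncomputable instance : LinearOrder (SumPoint S c) :=
  LinearOrder.lift' (fun x => toLex (x.i, toLex (x.d, x.q))) fun x y h => by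
    simp only [EmbeddingLike.apply_eq_iff_eq, Prod.mk.injEq] at h
    exact SumPoint.ext h.1 h.2.1 h.2.2

theorem lt_iff {x y : SumPoint S c} :
    x < y ↔ x.i < y.i ∨ x.i = y.i ∧ (x.d < y.d ∨ x.d = y.d ∧ x.q < y.q) := by
  change toLex (x.i, toLex (x.d, x.q)) < toLex (y.i, toLex (y.d, y.q)) ↔ _
  simp [Prod.Lex.toLex_lt_toLex]

instance : Countable (SumPoint S c) :=
  Function.Injective.countable (f := fun x : SumPoint S c => (x.i, x.d, x.q)) fun x y h => by
    simp only [Prod.mk.injEq] at h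
    exact SumPoint.ext h.1 h.2.1 h.2.2

/-- The translation in an orbit hull of the given direction. -/
def step : Ordering → ℚ
  | .lt => 1
  | .eq => 0
  | .gt => -1

/-- The automorphism that translates each hull in its direction. -/
noncomputable def shift (S : SumShape) (c : ℕ → ℚ → Ordering) : SumPoint S c ≃o SumPoint S c :=
  StrictMono.orderIsoOfSurjective
    (fun x => ⟨x.i, x.d, x.q + step (c x.i x.d), x.hi, x.hd, fun h => by
      rw [x.hq h, h]; simp [step]⟩)
    (fun x y h => by
      rw [lt_iff] at h ⊢
      rcases h with h | ⟨h, h' | ⟨h', h''⟩⟩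
      · exact .inl h
      · exact .inr ⟨h, .inl h'⟩
      · refine .inr ⟨h, .inr ⟨h', ?_⟩⟩
        dsimp only
        rw [h, h']
        linarith)
    (fun x => ⟨⟨x.i, x.d, x.q - step (c x.i x.d), x.hi, x.hd, fun h => by
      rw [x.hq h, h]; simp [step]⟩, by ext <;> simp⟩)

theorem shift_apply_i (x : SumPoint S c) : (shift S c x).i = x.i := rfl
theorem shift_apply_d (x : SumPoint S c) : (shift S c x).d = x.d := rfl
theorem shift_apply_q (x : SumPoint S c) : (shift S c x).q = x.q + step (c x.i x.d) := rfl

theorem shift_zpow (k : ℤ) (x : SumPoint S c) : ((shift S c ^ k) x).i = x.i ∧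
    ((shift S c ^ k) x).d = x.d ∧ ((shift S c ^ k) x).q = x.q + k * step (c x.i x.d) := by
  induction k using Int.induction_on with
  | zero => simp
  | succ k ih =>
    obtain ⟨h1, h2, h3⟩ := ih
    have : (shift S c ^ (k + 1 : ℤ)) x = shift S c ((shift S c ^ (k : ℤ)) x) := by
      rw [add_comm, zpow_apply_add, zpow_one]
    rw [this, shift_apply_i, shift_apply_d, shift_apply_q, h1, h2, h3]
    refine ⟨rfl, rfl, ?_⟩
    push_cast
    ring
  | pred k ih =>
    obtain ⟨h1, h2, h3⟩ := ih
    have : (shift S c ^ (-k : ℤ)) x = shift S c ((shift S c ^ (-k - 1 : ℤ)) x) := by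
      conv_rhs => rw [← zpow_one (shift S c), zpow_one (shift S c)]
      have := zpow_apply_add (σ := shift S c) 1 (-k - 1) x
      rw [zpow_one] at this
      rw [← this]
      congr 2
      ring
    rw [this] at h1 h2 h3
    rw [shift_apply_i] at h1
    rw [shift_apply_d] at h2
    rw [shift_apply_q, h1, h2] at h3
    refine ⟨h1, h2, ?_⟩
    push_cast at h3 ⊢
    linarith

theorem orbSign_shift (x : SumPoint S c) : orbSign (shift S c) x = c x.i x.d := by
  rcases h : c x.i x.d with _ | _ | _
  · rw [orbSign_eq_lt, lt_iff, shift_apply_i, shift_apply_d, shift_apply_q, h]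
    simp [step]
  · rw [orbSign_eq_eq]
    ext
    · rfl
    · rfl
    · rw [shift_apply_q, h]
      simp [step]
  · rw [orbSign_eq_gt, lt_iff, shift_apply_i, shift_apply_d, shift_apply_q, h]
    simp [step]

/-- Translations by integer multiples of `±1` are unbounded in `ℚ`, so two points of the same hull
are never far; a fixed hull has only the coordinate `0`. -/
theorem far_iff {x y : SumPoint S c} :
    Far (shift S c) x y ↔ x.i < y.i ∨ x.i = y.i ∧ x.d < y.d := by
  constructor
  · intro h
    rcases lt_iff.1 h.lt with h' | ⟨h1, h2 | ⟨h2, h3⟩⟩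
    · exact .inl h'
    · exact .inr ⟨h1, h2⟩
    · exfalso
      obtain ⟨k, hk⟩ := exists_nat_gt (y.q - x.q)
      have hstep : ∀ j : ℤ, x.q + j * step (c x.i x.d) < y.q := fun j => by
        obtain ⟨e1, e2, e3⟩ := shift_zpow j x
        have := lt_iff.1 (h j)
        rw [e1, e2, e3, h1, h2] at this
        simpa [h1, h2] using this
      rcases hc : c x.i x.d with _ | _ | _
      · have := hstep k
        rw [hc] at this
        simp only [step] at this
        push_cast at this
        linarith
      · have e1 := x.hq hc
        have e2 := y.hq (by rw [← h1, ← h2, hc])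
        linarith
      · have := hstep (-k)
        rw [hc] at this
        simp only [step] at this
        push_cast at this
        linarith
  · intro h k
    obtain ⟨e1, e2, -⟩ := shift_zpow k x
    rw [lt_iff, e1, e2]
    rcases h with h | ⟨h1, h2⟩
    · exact .inl h
    · exact .inr ⟨h1, .inl h2⟩

/-- The base point of a piece. -/
def base {i : ℕ} (hi : i < S.n) : SumPoint S c := ⟨i, 0, 0, hi, fun _ => rfl, fun _ => rfl⟩

section

variable (hc : ∀ i < S.n, ∀ d, c i d ∈ S.A i)

include hc

theorem isDense_of_eq {x : SumPoint S c} (hx : ¬ S.sg x.i) (h : c x.i x.d = .eq) :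
    S.IsDense x.i :=
  ⟨hx, fun s hs hA => hs (by
    have := hc x.i x.hi x.d
    rw [hA, h] at this
    exact this.symm)⟩

theorem exists_gt_of_not_sg {x : SumPoint S c} (hx : ¬ S.sg x.i) : ∃ y, y.i = x.i ∧ x < y := by
  by_cases h : c x.i x.d = .eq
  · have hd := isDense_of_eq hc hx h
    exact ⟨⟨x.i, x.d + 1, 0, x.hi, fun h => absurd hd h, fun _ => rfl⟩, rfl,
      lt_iff.2 (.inr ⟨rfl, .inl (by simp)⟩)⟩
  · exact ⟨⟨x.i, x.d, x.q + 1, x.hi, x.hd, fun h' => absurd h' h⟩, rfl,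
      lt_iff.2 (.inr ⟨rfl, .inr ⟨rfl, by simp⟩⟩)⟩

theorem exists_lt_of_not_sg {x : SumPoint S c} (hx : ¬ S.sg x.i) : ∃ y, y.i = x.i ∧ y < x := by
  by_cases h : c x.i x.d = .eq
  · have hd := isDense_of_eq hc hx h
    exact ⟨⟨x.i, x.d - 1, 0, x.hi, fun h => absurd hd h, fun _ => rfl⟩, rfl,
      lt_iff.2 (.inr ⟨rfl, .inl (by simp)⟩)⟩
  · exact ⟨⟨x.i, x.d, x.q - 1, x.hi, x.hd, fun h' => absurd h' h⟩, rfl,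
      lt_iff.2 (.inr ⟨rfl, .inr ⟨rfl, by simp⟩⟩)⟩

theorem denselyOrdered (hS : S.IsSpread) : DenselyOrdered (SumPoint S c) := by
  refine ⟨fun x y hxy => ?_⟩
  rcases lt_iff.1 hxy with h | ⟨h, h' | ⟨h', h''⟩⟩
  · by_cases hx : S.sg x.i
    · by_cases hy : S.sg y.i
      · have hadj := hS.adj x.i
        -- Two single points are not adjacent pieces, so there is a piece between them.
        have hlt : x.i + 1 < y.i := lt_of_le_of_ne h fun he =>
          hadj (by have := y.hi; omega) ⟨hx, he ▸ hy⟩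
        have := y.hi
        exact ⟨base (hlt.trans y.hi), lt_iff.2 (.inl (Nat.lt_succ_self _)), lt_iff.2 (.inl hlt)⟩
      · obtain ⟨z, hz, hzy⟩ := exists_lt_of_not_sg hc hy
        exact ⟨z, lt_iff.2 (.inl (hz ▸ h)), hzy⟩
    · obtain ⟨z, hz, hxz⟩ := exists_gt_of_not_sg hc hx
      exact ⟨z, hxz, lt_iff.2 (.inl (hz ▸ h))⟩
  · obtain ⟨e, h1, h2⟩ := exists_between h'
    have hd : S.IsDense x.i := by
      by_contra hd
      have e1 := x.hd hd
      have e2 := y.hd (h ▸ hd)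
      exact h'.ne (e1.trans e2.symm)
    exact ⟨⟨x.i, e, 0, x.hi, fun h => absurd hd h, fun _ => rfl⟩, lt_iff.2 (.inr ⟨rfl, .inl h1⟩),
      lt_iff.2 (.inr ⟨h, .inl h2⟩)⟩
  · obtain ⟨e, h1, h2⟩ := exists_between h''
    refine ⟨⟨x.i, x.d, e, x.hi, x.hd, fun hce => ?_⟩, lt_iff.2 (.inr ⟨rfl, .inr ⟨rfl, h1⟩⟩),
      lt_iff.2 (.inr ⟨h, .inr ⟨h', h2⟩⟩)⟩
    have e1 := x.hq hce
    have e2 := y.hq (by rw [← h, ← h', hce])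
    linarith

theorem noMaxOrder (hS : S.IsSpread) : NoMaxOrder (SumPoint S c) := by
  refine ⟨fun x => ?_⟩
  by_cases hx : S.sg x.i
  · have := hS.last x.i
    have hlt : x.i + 1 < S.n := lt_of_le_of_ne x.hi fun h => this h hx
    exact ⟨base hlt, lt_iff.2 (.inl (Nat.lt_succ_self _))⟩
  · obtain ⟨y, -, hy⟩ := exists_gt_of_not_sg hc hx
    exact ⟨y, hy⟩

theorem noMinOrder (hS : S.IsSpread) : NoMinOrder (SumPoint S c) := by
  refine ⟨fun x => ?_⟩
  by_cases hx : S.sg x.i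
  · have hpos : 0 < x.i := Nat.pos_of_ne_zero fun h => hS.zero (h ▸ hx)
    exact ⟨base hS.pos, lt_iff.2 (.inl hpos)⟩
  · obtain ⟨y, -, hy⟩ := exists_lt_of_not_sg hc hx
    exact ⟨y, hy⟩

theorem isShuffleSum (hS : S.IsReduced)
    (hdense : ∀ i < S.n, ∀ s ∈ S.A i, ∀ a b : ℚ, a < b → ∃ d, a < d ∧ d < b ∧ c i d = s) :
    IsShuffleSum S (shift S c) fun x => x.i := by
  refine ⟨⟨?_, fun x => x.hi, shift_apply_i, fun x => ?_, fun x y hx hxy => ?_⟩, ?_, ?_⟩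
  · intro x y hxy
    rcases hxy.eq_or_lt with rfl | h
    · exact le_rfl
    · rcases lt_iff.1 h with h | h
      · exact h.le
      · exact h.1.le
  · rw [orbSign_shift]
    exact hc x.i x.hi x.d
  · have hd : ¬ S.IsDense x.i := fun h => h.1 hx
    have e1 := x.hd hd
    have e2 := y.hd (hxy ▸ hd)
    have h1 := hc x.i x.hi x.d
    have h2 := hc y.i y.hi y.d
    rw [hS.single _ hx] at h1
    rw [← hxy, hS.single _ hx] at h2
    exact SumPoint.ext hxy (e1.trans e2.symm) ((x.hq h1).trans (y.hq (hxy ▸ h2)).symm)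
  · intro x y hxy hf
    by_contra hd
    have e1 := x.hd hd
    have e2 := y.hd (by rwa [← hxy])
    rcases far_iff.1 hf with h | h
    · exact h.ne hxy
    · exact h.2.ne (e1.trans e2.symm)
  · intro i hi s hs L U hLU hL hU
    by_cases hd : S.IsDense i
    · obtain ⟨m, hm1, hm2⟩ := Order.exists_between_finsets
        ((L.filter fun x => x.i = i).image fun x => x.d)
        ((U.filter fun x => x.i = i).image fun x => x.d) (by
          simp only [Finset.mem_image, Finset.mem_filter]
          rintro _ ⟨x, ⟨hx, hxi⟩, rfl⟩ _ ⟨y, ⟨hy, hyi⟩, rfl⟩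
          rcases far_iff.1 (hLU x hx y hy) with h | h
          · omega
          · exact h.2)
      -- The colouring is dense in open intervals, so a whole interval between the lower and the
      -- upper hulls is needed, also when one side is empty.
      obtain ⟨m', hmm', hm'⟩ := Order.exists_between_finsets {m}
        ((U.filter fun x => x.i = i).image fun x => x.d) (by simpa using hm2)
      obtain ⟨d, hd1, hd2, hds⟩ := hdense i hi s hs m m' (hmm' m (by simp))
      refine ⟨⟨i, d, 0, hi, fun h => absurd hd h, fun _ => rfl⟩, rfl, ?_, fun a ha => ?_,
        fun b hb => ?_⟩
      · rw [orbSign_shift]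
        exact hds
      · rw [far_iff]
        rcases (hL a ha).1.lt_or_eq with h | h
        · exact .inl h
        · exact .inr ⟨h, (hm1 _ (Finset.mem_image_of_mem _
            (Finset.mem_filter.2 ⟨ha, h⟩))).trans hd1⟩
      · rw [far_iff]
        rcases (hU b hb).1.lt_or_eq with h | h
        · exact .inl h
        · exact .inr ⟨h, hd2.trans (hm' _ (Finset.mem_image_of_mem _
            (Finset.mem_filter.2 ⟨hb, h.symm⟩)))⟩
    · refine ⟨base hi, rfl, ?_, fun a ha => ?_, fun b hb => ?_⟩
      · obtain ⟨s', hs'⟩ := hS.eq_singleton hd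
        have h1 := hc i hi 0
        rw [hs'] at h1 hs
        rw [orbSign_shift]
        exact Eq.trans h1 (Eq.symm hs)
      · obtain ⟨h1, h2⟩ := hL a ha
        exact far_iff.2 (.inl (h1.lt_of_ne fun h => hd (h2 h)))
      · obtain ⟨h1, h2⟩ := hU b hb
        exact far_iff.2 (.inl (h1.lt_of_ne fun h => hd (h2 h.symm)))

end

end SumPoint

/-! ### Transport to a given countable dense order -/

section

variable {α β : Type*} [LinearOrder α] [LinearOrder β]

/-- Transport of an automorphism along an order isomorphism. -/
def pullAut (e : α ≃o β) (τ : β ≃o β) : α ≃o α := e.trans (τ.trans e.symm)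

theorem pullAut_apply (e : α ≃o β) (τ : β ≃o β) (x : α) : e (pullAut e τ x) = τ (e x) := by
  simp [pullAut]

theorem pullAut_zpow (e : α ≃o β) (τ : β ≃o β) (k : ℤ) (x : α) :
    e ((pullAut e τ ^ k) x) = (τ ^ k) (e x) := by
  induction k using Int.induction_on generalizing x with
  | zero => simp
  | succ k ih => rw [zpow_apply_add, ih, zpow_one, pullAut_apply, zpow_apply_add, zpow_one]
  | pred k ih =>
    have h1 : e ((pullAut e τ ^ (-1 : ℤ)) x) = (τ ^ (-1 : ℤ)) (e x) := by
      apply τ.injective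
      rw [← pullAut_apply, zpow_neg_one, zpow_neg_one]
      exact (congrArg e ((pullAut e τ).apply_symm_apply x)).trans (τ.apply_symm_apply (e x)).symm
    rw [sub_eq_add_neg, zpow_apply_add, ih, h1, zpow_apply_add]

theorem far_pullAut (e : α ≃o β) (τ : β ≃o β) {x y : α} :
    Far (pullAut e τ) x y ↔ Far τ (e x) (e y) :=
  forall_congr' fun k => by rw [← pullAut_zpow, e.lt_iff_lt]

theorem orbSign_pullAut (e : α ≃o β) (τ : β ≃o β) (x : α) :
    orbSign (pullAut e τ) x = orbSign τ (e x) := by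
  rw [orbSign, orbSign, ← pullAut_apply, e.strictMono.cmp_map_eq]

theorem IsShuffleSum.pullAut {S : SumShape} {τ : β ≃o β} {π : β → ℕ} (h : IsShuffleSum S τ π)
    (e : α ≃o β) : IsShuffleSum S (pullAut e τ) fun x => π (e x) := by
  classical
  refine ⟨⟨h.mono.comp e.monotone, fun x => h.lt _, fun x => ?_, fun x => ?_,
    fun x y hx hxy => e.injective (h.single _ _ hx hxy)⟩, fun x y hxy hf =>
      h.uniq _ _ hxy ((far_pullAut e τ).1 hf), fun i hi s hs L U hLU hL hU => ?_⟩
  · rw [pullAut_apply, h.inv]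
  · rw [orbSign_pullAut]
    exact h.sgn _
  · obtain ⟨z, h1, h2, h3, h4⟩ := h.ext i hi s hs (L.image e) (U.image e)
      (by
        simp only [Finset.mem_image]
        rintro _ ⟨a, ha, rfl⟩ _ ⟨b, hb, rfl⟩
        exact (far_pullAut e τ).1 (hLU a ha b hb))
      (by simpa using hL) (by simpa using hU)
    refine ⟨e.symm z, by simpa using h1, by rw [orbSign_pullAut]; simpa using h2, fun a ha => ?_,
      fun b hb => ?_⟩
    · rw [far_pullAut, OrderIso.apply_symm_apply]
      exact h3 _ (Finset.mem_image_of_mem _ ha)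
    · rw [far_pullAut, OrderIso.apply_symm_apply]
      exact h4 _ (Finset.mem_image_of_mem _ hb)

variable [Countable α] [DenselyOrdered α] [NoMinOrder α] [NoMaxOrder α] [Nonempty α]

/-- Each colour set is enumerated by `ℕ` and pulled back along the dense colouring of `ℚ`. The sum
of hulls is countable, dense and without endpoints, so Cantor's theorem carries it to `α`. -/
theorem exists_isShuffleSum {S : SumShape} (hS : S.IsReduced) (hS' : S.IsSpread) :
    ∃ (τ : α ≃o α) (π : α → ℕ), IsShuffleSum S τ π := by
  obtain ⟨χ, hχ⟩ := exists_dense_colouring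
  have hf : ∀ i, ∃ f : ℕ → Ordering, i < S.n → S.A i = Set.range f := fun i => by
    by_cases hi : i < S.n
    · obtain ⟨f, hf⟩ := (Set.to_countable (S.A i)).exists_eq_range (hS.nonempty i hi)
      exact ⟨f, fun _ => hf⟩
    · exact ⟨fun _ => .eq, fun h => absurd h hi⟩
  choose f hf using hf
  let c : ℕ → ℚ → Ordering := fun i d => f i (χ d)
  have hc : ∀ i < S.n, ∀ d, c i d ∈ S.A i := fun i hi d => by
    rw [hf i hi]
    exact ⟨_, rfl⟩
  have hsum := SumPoint.isShuffleSum hc hS fun i hi s hs a b hab => by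
    rw [hf i hi] at hs
    obtain ⟨r, rfl⟩ := hs
    obtain ⟨d, h1, h2, rfl⟩ := hχ r a b hab
    exact ⟨d, h1, h2, rfl⟩
  have := SumPoint.denselyOrdered hc hS'
  have := SumPoint.noMaxOrder hc hS'
  have := SumPoint.noMinOrder hc hS'
  have : Nonempty (SumPoint S c) := ⟨SumPoint.base hS'.pos⟩
  obtain ⟨e⟩ := Order.iso_of_countable_dense α (SumPoint S c)
  exact ⟨_, _, hsum.pullAut e⟩

/-- Every automorphism has the same finite restrictions, up to isomorphism, as an automorphism
with determining sets. -/
theorem exists_hasDeterminingSets (σ : α ≃o α) :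
    ∃ τ : α ≃o α, AgeLe σ τ ∧ AgeLe τ σ ∧ HasDeterminingSets τ := by
  obtain ⟨S, π, hσ, hS, hS'⟩ := exists_isFullPlacement σ
  obtain ⟨τ, π', hτ⟩ := exists_isShuffleSum (α := α) hS hS'
  exact ⟨τ, hσ.toIsPlacement.ageLe hS (hτ.isFullPlacement hS),
    hτ.toIsPlacement.ageLe hS hσ, hτ.hasDeterminingSets hS⟩

end

/-! ### Homogeneous finite restrictions and generic elements -/

section

variable {X : Type*} {G : Subgroup (Equiv.Perm X)}

theorem mem_permAct {α : Equiv.Perm X} {p : Finset (X × X)} {e : X × X} :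
    e ∈ permAct α p ↔ ∃ d ∈ p, (α d.1, α d.2) = e := by
  simp only [permAct, Finset.mem_map]
  rfl

theorem permAct_mul (α β : Equiv.Perm X) (p : Finset (X × X)) :
    permAct (α * β) p = permAct α (permAct β p) := by
  ext e
  simp only [mem_permAct]
  constructor
  · rintro ⟨d, hd, rfl⟩
    exact ⟨_, ⟨d, hd, rfl⟩, rfl⟩
  · rintro ⟨_, ⟨d, hd, rfl⟩, rfl⟩
    exact ⟨d, hd, rfl⟩

theorem permAct_one (p : Finset (X × X)) : permAct 1 p = p := by
  ext e
  simp [mem_permAct]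

theorem permAct_mono (α : Equiv.Perm X) {p q : Finset (X × X)} (h : p ⊆ q) :
    permAct α p ⊆ permAct α q := Finset.map_subset_map.2 h

theorem permAct_inv_mul (α : Equiv.Perm X) (p : Finset (X × X)) :
    permAct α⁻¹ (permAct α p) = p := by
  rw [← permAct_mul, inv_mul_cancel, permAct_one]

theorem permAct_mul_inv (α : Equiv.Perm X) (p : Finset (X × X)) :
    permAct α (permAct α⁻¹ p) = p := by
  rw [← permAct_mul, mul_inv_cancel, permAct_one]

theorem permAct_eq_self {α : Equiv.Perm X} {p : Finset (X × X)} (h : FixesSupport α p) :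
    permAct α p = p := by
  ext e
  rw [mem_permAct]
  constructor
  · rintro ⟨d, hd, rfl⟩
    rwa [(h d hd).1, (h d hd).2]
  · exact fun he => ⟨e, he, by rw [(h e he).1, (h e he).2]⟩

theorem ExtendsPartial.mono {γ : Equiv.Perm X} {p q : Finset (X × X)} (h : ExtendsPartial γ q)
    (hpq : p ⊆ q) : ExtendsPartial γ p := fun e he => h e (hpq he)

theorem extendsPartial_permAct {γ α : Equiv.Perm X} {p : Finset (X × X)} :
    ExtendsPartial γ (permAct α p) ↔ ExtendsPartial (α⁻¹ * γ * α) p := by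
  constructor
  · intro h e he
    have := h _ (mem_permAct.2 ⟨e, he, rfl⟩)
    rw [Equiv.Perm.mul_apply, Equiv.Perm.mul_apply, this]
    simp
  · intro h e he
    obtain ⟨d, hd, rfl⟩ := mem_permAct.1 he
    have := h d hd
    rw [← this]
    simp

theorem ExtendsPartial.permAct_of_commute {γ α : Equiv.Perm X} {p : Finset (X × X)}
    (h : ExtendsPartial γ p) (hc : α * γ = γ * α) : ExtendsPartial γ (permAct α p) := by
  rw [extendsPartial_permAct, mul_assoc, ← hc, inv_mul_cancel_left]
  exact h

/-- `q` is a finite restriction of `γ`, and each embedding of `q` into `γ` agrees with an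
automorphism of `γ`. -/
def IsHomogeneousIn (G : Subgroup (Equiv.Perm X)) (γ : Equiv.Perm X) (q : Finset (X × X)) : Prop :=
  ExtendsPartial γ q ∧ ∀ g ∈ G, ExtendsPartial γ (permAct g q) →
    ∃ h ∈ G, h * γ = γ * h ∧ ∀ e ∈ q, h e.1 = g e.1 ∧ h e.2 = g e.2

/-- The finite partial maps with a homogeneous copy in `γ`. -/
def homogeneousFamily (G : Subgroup (Equiv.Perm X)) (γ : Equiv.Perm X) : Set (Finset (X × X)) :=
  {q | ∃ g ∈ G, IsHomogeneousIn G γ (permAct g q)}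

theorem homogeneousFamily_invariant (γ : Equiv.Perm X) :
    InvariantFamily G (homogeneousFamily G γ) := by
  rintro α hα p ⟨g, hg, h⟩
  refine ⟨g * α⁻¹, G.mul_mem hg (G.inv_mem hα), ?_⟩
  rwa [permAct_mul, permAct_inv_mul]

/-- Two copies in `γ` of a member of the family are conjugate under the centralizer of `γ`. -/
theorem exists_commute_of_mem {γ : Equiv.Perm X} {p : Finset (X × X)}
    (hp : p ∈ homogeneousFamily G γ) {a b : Equiv.Perm X} (ha : a ∈ G) (hb : b ∈ G)
    (hap : ExtendsPartial γ (permAct a p)) (hbp : ExtendsPartial γ (permAct b p)) :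
    ∃ h ∈ G, h * γ = γ * h ∧ ∀ e ∈ p, h (a e.1) = b e.1 ∧ h (a e.2) = b e.2 := by
  obtain ⟨k, hk, -, hhom⟩ := hp
  have key : ∀ c ∈ G, ExtendsPartial γ (permAct c p) →
      ∃ h ∈ G, h * γ = γ * h ∧ ∀ e ∈ p, h (k e.1) = c e.1 ∧ h (k e.2) = c e.2 := by
    intro c hc hcp
    obtain ⟨h, hh, hcomm, hhe⟩ := hhom (c * k⁻¹) (G.mul_mem hc (G.inv_mem hk)) (by
      rwa [permAct_mul, permAct_inv_mul])
    refine ⟨h, hh, hcomm, fun e he => ?_⟩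
    have := hhe _ (mem_permAct.2 ⟨e, he, rfl⟩)
    simpa using this
  obtain ⟨h, hh, hc, he⟩ := key a ha hap
  obtain ⟨h', hh', hc', he'⟩ := key b hb hbp
  refine ⟨h' * h⁻¹, G.mul_mem hh' (G.inv_mem hh), ?_, fun e hep => ?_⟩
  · have h1 : Commute h γ := hc
    have h2 : Commute h' γ := hc'
    exact (h2.mul_left h1.inv_left).eq
  · rw [← (he e hep).1, ← (he e hep).2, ← (he' e hep).1, ← (he' e hep).2]
    simp

/-- Realize both extensions inside `γ`, move one copy of the common part onto the other by an
element of the centralizer, and take the union of the two restrictions. -/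
theorem homogeneousFamily_amalgamation [DecidableEq X] {γ : Equiv.Perm X} {P : Set (Finset (X × X))}
    (hP : ∀ p, p ∈ P ↔ ∃ g ∈ G, ExtendsPartial γ (permAct g p))
    (hF : CofinalSubfamily (homogeneousFamily G γ) P) :
    HasAmalgamation G (homogeneousFamily G γ) := by
  intro p hp q₁ hq₁ q₂ hq₂ h₁ h₂
  obtain ⟨a, ha, ha'⟩ := (hP q₁).1 (hF.1 hq₁)
  obtain ⟨b, hb, hb'⟩ := (hP q₂).1 (hF.1 hq₂)
  obtain ⟨h, hh, hc, he⟩ := exists_commute_of_mem hp hb ha (hb'.mono (permAct_mono b h₂))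
    (ha'.mono (permAct_mono a h₁))
  have hα : a⁻¹ * h * b ∈ G := G.mul_mem (G.mul_mem (G.inv_mem ha) hh) hb
  have hun : q₁ ∪ permAct (a⁻¹ * h * b) q₂ ∈ P := by
    refine (hP _).2 ⟨a, ha, ?_⟩
    intro e hep
    obtain ⟨d, hd, rfl⟩ := mem_permAct.1 hep
    rcases Finset.mem_union.1 hd with hd | hd
    · exact ha' _ (mem_permAct.2 ⟨d, hd, rfl⟩)
    · refine (hb'.permAct_of_commute hc) _ ?_
      rw [← permAct_mul, mem_permAct]
      obtain ⟨d', hd', rfl⟩ := mem_permAct.1 hd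
      exact ⟨d', hd', by simp⟩
  obtain ⟨p₃, hp₃, hsub⟩ := hF.2 _ hun
  refine ⟨p₃, hp₃, _, hα, fun e hep => ?_, Finset.subset_union_left.trans hsub,
    Finset.subset_union_right.trans hsub⟩
  obtain ⟨h1, h2⟩ := he e hep
  constructor
  · rw [Equiv.Perm.mul_apply, Equiv.Perm.mul_apply, h1]; simp
  · rw [Equiv.Perm.mul_apply, Equiv.Perm.mul_apply, h2]; simp

theorem homogeneousFamily_cofinal {γ : Equiv.Perm X} {P : Set (Finset (X × X))}
    (hP : ∀ p, p ∈ P ↔ ∃ g ∈ G, ExtendsPartial γ (permAct g p))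
    (hγ : ∀ p, ExtendsPartial γ p → ∃ q, p ⊆ q ∧ IsHomogeneousIn G γ q) :
    CofinalSubfamily (homogeneousFamily G γ) P := by
  refine ⟨fun p ⟨g, hg, h⟩ => (hP p).2 ⟨g, hg, h.1⟩, fun p hp => ?_⟩
  obtain ⟨g, hg, h⟩ := (hP p).1 hp
  obtain ⟨q, hpq, hq⟩ := hγ _ h
  refine ⟨permAct g⁻¹ q, ⟨g, hg, by rwa [permAct_mul_inv]⟩, ?_⟩
  have := permAct_mono g⁻¹ hpq
  rwa [permAct_inv_mul] at this

/-- The extension properties of a generic permutation with respect to a family `F`. -/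
structure IsExtensive (G : Subgroup (Equiv.Perm X)) (F : Set (Finset (X × X)))
    (δ : Equiv.Perm X) : Prop where
  cover : ∀ r, ExtendsPartial δ r → ∃ q ∈ F, r ⊆ q ∧ ExtendsPartial δ q
  extend : ∀ p ∈ F, ∀ q ∈ F, p ⊆ q → ExtendsPartial δ p →
    ∃ α ∈ G, FixesSupport α p ∧ ExtendsPartial δ (permAct α q)

/-- For `extend`, any copy of `q` in `γ` contains a copy of `p`, and the centralizer moves that copy
back to `p`. -/
theorem isExtensive_self {γ : Equiv.Perm X}
    (hγ : ∀ p, ExtendsPartial γ p → ∃ q, p ⊆ q ∧ IsHomogeneousIn G γ q) :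
    IsExtensive G (homogeneousFamily G γ) γ := by
  refine ⟨fun r hr => ?_, fun p hp q hq hpq hpγ => ?_⟩
  · obtain ⟨q, hrq, hq⟩ := hγ r hr
    exact ⟨q, ⟨1, G.one_mem, by rwa [permAct_one]⟩, hrq, hq.1⟩
  · obtain ⟨g, hg, hgq, -⟩ := hq
    obtain ⟨h, hh, hc, he⟩ := exists_commute_of_mem hp hg G.one_mem
      (hgq.mono (permAct_mono g hpq)) (by rwa [permAct_one])
    refine ⟨h * g, G.mul_mem hh hg, he, ?_⟩
    rw [permAct_mul]
    exact hgq.permAct_of_commute hc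

/-- Two permutations with the extension properties and a common restriction are conjugate. -/
theorem IsExtensive.exists_conj [Countable X] {F : Set (Finset (X × X))}
    (hG : ∀ e : Equiv.Perm X, (∀ s : Finset X, ∃ g ∈ G, ∀ x ∈ s, g x = e x) → e ∈ G)
    (hF : InvariantFamily G F) {γ δ : Equiv.Perm X} (hγ : IsExtensive G F γ)
    (hδ : IsExtensive G F δ) {p₀ : Finset (X × X)} {α₀ : Equiv.Perm X} (hp₀ : p₀ ∈ F)
    (hα₀ : α₀ ∈ G) (hp₀γ : ExtendsPartial γ p₀) (hp₀δ : ExtendsPartial δ (permAct α₀ p₀)) :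
    ∃ e ∈ G, e * γ * e⁻¹ = δ := by
  classical
  -- The partial bijections are restrictions of elements of `G` that carry a restriction of `γ` in
  -- `F` to one of `δ`. The limit stays in `G` because `G` is closed, which is `hG`.
  let I : Finset (X × X) → Prop := fun u => ∃ p ∈ F, ∃ α ∈ G, ExtendsPartial γ p ∧
    ExtendsPartial δ (permAct α p) ∧ u = p.image fun e => (e.1, α e.1)
  have hI : ∀ p, I p → ∀ e ∈ p, ∀ e' ∈ p, e.1 = e'.1 ↔ e.2 = e'.2 := by
    rintro _ ⟨p, -, α, -, -, -, rfl⟩ e he e' he'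
    obtain ⟨d, -, rfl⟩ := Finset.mem_image.1 he
    obtain ⟨d', -, rfl⟩ := Finset.mem_image.1 he'
    exact α.injective.eq_iff.symm
  have forth : ∀ p, I p → ∀ a, ∃ b q, p ⊆ q ∧ I q ∧ (a, b) ∈ q := by
    rintro _ ⟨p, hp, α, hα, hpγ, hpδ, rfl⟩ a
    obtain ⟨q, hq, hpq, hqγ⟩ := hγ.cover (insert (a, γ a) p) (fun e he => by
      rcases Finset.mem_insert.1 he with rfl | he
      · rfl
      · exact hpγ e he)
    obtain ⟨β, hβ, hfix, hqδ⟩ := hδ.extend _ (hF α hα p hp) _ (hF α hα q hq)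
      (permAct_mono α ((Finset.subset_insert _ _).trans hpq)) hpδ
    refine ⟨β (α a), q.image fun e => (e.1, (β * α) e.1), fun d hd => ?_,
      ⟨q, hq, β * α, G.mul_mem hβ hα, hqγ, by rwa [permAct_mul], rfl⟩,
      Finset.mem_image.2 ⟨(a, γ a), hpq (Finset.mem_insert_self _ _), rfl⟩⟩
    obtain ⟨e, he, rfl⟩ := Finset.mem_image.1 hd
    refine Finset.mem_image.2 ⟨e, hpq (Finset.mem_insert_of_mem he), ?_⟩
    rw [Equiv.Perm.mul_apply, (hfix _ (mem_permAct.2 ⟨e, he, rfl⟩)).1]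
  have back : ∀ p, I p → ∀ b, ∃ a q, p ⊆ q ∧ I q ∧ (a, b) ∈ q := by
    rintro _ ⟨p, hp, α, hα, hpγ, hpδ, rfl⟩ b
    obtain ⟨q, hq, hpq, hqδ⟩ := hδ.cover (insert (b, δ b) (permAct α p)) (fun e he => by
      rcases Finset.mem_insert.1 he with rfl | he
      · rfl
      · exact hpδ e he)
    have hpq' : p ⊆ permAct α⁻¹ q := by
      have := permAct_mono α⁻¹ ((Finset.subset_insert _ _).trans hpq)
      rwa [permAct_inv_mul] at this
    obtain ⟨β, hβ, hfix, hqγ⟩ := hγ.extend p hp _ (hF _ (G.inv_mem hα) q hq) hpq' hpγ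
    have hq' : permAct (α * β⁻¹) (permAct β (permAct α⁻¹ q)) = q := by
      rw [permAct_mul, permAct_inv_mul, permAct_mul_inv]
    refine ⟨β (α⁻¹ b), (permAct β (permAct α⁻¹ q)).image fun e => (e.1, (α * β⁻¹) e.1),
      fun d hd => ?_, ⟨_, hF β hβ _ (hF _ (G.inv_mem hα) q hq), α * β⁻¹,
        G.mul_mem hα (G.inv_mem hβ), hqγ, by rwa [hq'], rfl⟩,
      Finset.mem_image.2 ⟨_, mem_permAct.2 ⟨_, mem_permAct.2 ⟨_,
        hpq (Finset.mem_insert_self _ _), rfl⟩, rfl⟩, by simp⟩⟩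
    obtain ⟨e, he, rfl⟩ := Finset.mem_image.1 hd
    refine Finset.mem_image.2 ⟨e, ?_, ?_⟩
    · have := permAct_mono β hpq'
      rw [permAct_eq_self hfix] at this
      exact this he
    · have h1 : β⁻¹ e.1 = e.1 := by
        rw [Equiv.Perm.inv_eq_iff_eq, (hfix e he).1]
      rw [Equiv.Perm.mul_apply, h1]
  obtain ⟨e, -, he⟩ := exists_equiv_of_back_and_forth I hI forth back
    (p₀.image fun e => (e.1, α₀ e.1)) ⟨p₀, hp₀, α₀, hα₀, hp₀γ, hp₀δ, rfl⟩
  have heG : e ∈ G := by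
    refine hG e fun s => ?_
    obtain ⟨u, ⟨p, -, α, hα, -, -, rfl⟩, h1, -⟩ := he s
    refine ⟨α, hα, fun x hx => ?_⟩
    obtain ⟨d, -, hd⟩ := Finset.mem_image.1 (h1 x hx)
    simp only [Prod.mk.injEq] at hd
    rw [← hd.2, hd.1]
  refine ⟨e, heG, ?_⟩
  rw [mul_inv_eq_iff_eq_mul]
  ext x
  obtain ⟨u, ⟨p, -, α, hα, hpγ, hpδ, rfl⟩, h1, -⟩ := he {x, γ x}
  obtain ⟨d, hd, hdx⟩ := Finset.mem_image.1 (h1 x (by simp))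
  obtain ⟨d', -, hdx'⟩ := Finset.mem_image.1 (h1 (γ x) (by simp))
  simp only [Prod.mk.injEq] at hdx hdx'
  have h2 := hpδ _ (mem_permAct.2 ⟨d, hd, rfl⟩)
  have h3 := hpγ d hd
  rw [Equiv.Perm.mul_apply, Equiv.Perm.mul_apply, ← hdx'.2, ← hdx.2, hdx'.1]
  dsimp only at h2
  rw [h2, ← h3, hdx.1]

/-! ### The topology of pointwise convergence -/

theorem isOpen_setOf_agree (δ : G) (s : Finset X) :
    IsOpen {δ' : G | ∀ x ∈ s, (δ' : Equiv.Perm X) x = (δ : Equiv.Perm X) x} := by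
  let : TopologicalSpace X := ⊥
  have : DiscreteTopology X := ⟨rfl⟩
  have hc : ∀ x : X, Continuous fun δ' : G => (δ' : Equiv.Perm X) x := fun x =>
    (continuous_apply (A := fun _ => X) x).comp
      ((continuous_induced_dom (f := fun g : Equiv.Perm X => (g : X → X))).comp
        continuous_subtype_val)
  simp only [Set.ofPred_forall]
  exact isOpen_biInter_finset fun x _ => (isOpen_discrete {(δ : Equiv.Perm X) x}).preimage (hc x)

theorem exists_finset_of_isOpen {U : Set G} (hU : IsOpen U) {δ : G} (hδ : δ ∈ U) :
    ∃ s : Finset X, ∀ δ' : G, (∀ x ∈ s, (δ' : Equiv.Perm X) x = (δ : Equiv.Perm X) x) →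
      δ' ∈ U := by
  let : TopologicalSpace X := ⊥
  obtain ⟨V, hV, rfl⟩ := isOpen_induced_iff.1 hU
  obtain ⟨W, hW, rfl⟩ := isOpen_induced_iff.1 hV
  obtain ⟨s, u, h1, h2⟩ := isOpen_pi_iff.1 hW _ hδ
  refine ⟨s, fun δ' h => h2 fun x hx => ?_⟩
  change (δ' : Equiv.Perm X) x ∈ u x
  rw [h x hx]
  exact (h1 x hx).2

theorem mem_conjClosure_iff {ρ δ : G} : δ ∈ conjClosure ρ ↔
    ∀ s : Finset X, ∃ g : G, ∀ x ∈ s, ((g * ρ * g⁻¹ : G) : Equiv.Perm X) x = (δ : Equiv.Perm X) x := by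
  rw [conjClosure, mem_closure_iff]
  constructor
  · intro h s
    obtain ⟨δ', h1, h2⟩ := h _ (isOpen_setOf_agree δ s) (fun _ _ => rfl)
    obtain ⟨g, rfl⟩ := isConj_iff.1 h2
    exact ⟨g, h1⟩
  · intro h U hU hδ
    obtain ⟨s, hs⟩ := exists_finset_of_isOpen hU hδ
    obtain ⟨g, hg⟩ := h s
    exact ⟨_, hs _ hg, isConj_iff.2 ⟨g, rfl⟩⟩

theorem conjClosure_subset {ρ γ : G} (h : γ ∈ conjClosure ρ) : conjClosure γ ⊆ conjClosure ρ := by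
  classical
  intro δ hδ
  rw [mem_conjClosure_iff] at h hδ ⊢
  intro s
  obtain ⟨g, hg⟩ := hδ s
  obtain ⟨k, hk⟩ := h (s.image (g⁻¹ : G).1)
  refine ⟨g * k, fun x hx => ?_⟩
  rw [← hg x hx]
  have := hk _ (Finset.mem_image_of_mem _ hx)
  simp only [Subgroup.coe_mul, Subgroup.coe_inv, Equiv.Perm.mul_apply, mul_inv_rev] at this ⊢
  rw [this]

/-- A finite map sees only finitely many values, so an extension in the closure can be exchanged for
a conjugate of `γ`; this means a copy of the map in `γ`. -/
theorem exists_mem_conjClosure_iff {γ : G} {p : Finset (X × X)} :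
    (∃ δ ∈ conjClosure γ, ExtendsPartial (δ : Equiv.Perm X) p) ↔
      ∃ g ∈ G, ExtendsPartial (γ : Equiv.Perm X) (permAct g p) := by
  classical
  constructor
  · rintro ⟨δ, hδ, hp⟩
    obtain ⟨g, hg⟩ := mem_conjClosure_iff.1 hδ (p.image Prod.fst)
    refine ⟨(g⁻¹ : G), (g⁻¹ : G).2, extendsPartial_permAct.2 fun e he => ?_⟩
    rw [← hp e he, ← hg _ (Finset.mem_image_of_mem _ he)]
    simp
  · rintro ⟨g, hg, hp⟩
    let g' : G := ⟨g, hg⟩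
    exact ⟨g'⁻¹ * γ * g', mem_conjClosure_iff.2 fun s => ⟨g'⁻¹, fun x _ => by simp⟩,
      extendsPartial_permAct.1 hp⟩

theorem mem_residual_of_forall_extension {C : Set G} {D : Set C}
    (hopen : ∀ δ ∈ D, ∃ s : Finset X, ∀ δ' : C,
      (∀ x ∈ s, ((δ' : G) : Equiv.Perm X) x = ((δ : G) : Equiv.Perm X) x) → δ' ∈ D)
    (hdense : ∀ δ : C, ∀ s : Finset X, ∃ δ' ∈ D,
      ∀ x ∈ s, ((δ' : G) : Equiv.Perm X) x = ((δ : G) : Equiv.Perm X) x) :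
    D ∈ residual C := by
  refine residual_of_dense_open ?_ ?_
  · rw [isOpen_iff_forall_mem_open]
    intro δ hδ
    obtain ⟨s, hs⟩ := hopen δ hδ
    exact ⟨_, fun δ' h => hs δ' h, (isOpen_setOf_agree (δ : G) s).preimage continuous_subtype_val,
      fun _ _ => rfl⟩
  · rw [dense_iff_inter_open]
    rintro U hU ⟨δ, hδ⟩
    obtain ⟨V, hV, rfl⟩ := isOpen_induced_iff.1 hU
    obtain ⟨s, hs⟩ := exists_finset_of_isOpen hV hδ
    obtain ⟨δ', h1, h2⟩ := hdense δ s
    exact ⟨δ', hs _ h2, h1⟩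

/-- The conditions of `IsExtensive` are indexed by finite maps, hence countable in number. Each is
open, being witnessed by finitely many values, and dense, by cofinality for `cover` and amalgamation
for `extend`. -/
theorem isGenericIn_of_homogeneous [Countable X] (γ : G)
    (hG : ∀ e : Equiv.Perm X, (∀ s : Finset X, ∃ g ∈ G, ∀ x ∈ s, g x = e x) → e ∈ G)
    (hγ : ∀ p, ExtendsPartial (γ : Equiv.Perm X) p →
      ∃ q, p ⊆ q ∧ IsHomogeneousIn G (γ : Equiv.Perm X) q) :
    IsGenericIn (conjClosure γ) γ := by
  classical
  set F := homogeneousFamily G (γ : Equiv.Perm X) with hFdef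
  set P : Set (Finset (X × X)) :=
    {p | ∃ δ ∈ conjClosure γ, ExtendsPartial (δ : Equiv.Perm X) p} with hPdef
  have hP : ∀ p, p ∈ P ↔ ∃ g ∈ G, ExtendsPartial (γ : Equiv.Perm X) (permAct g p) :=
    fun p => exists_mem_conjClosure_iff
  have hcof := homogeneousFamily_cofinal hP hγ
  have hinv := homogeneousFamily_invariant (G := G) (γ : Equiv.Perm X)
  have hamal := homogeneousFamily_amalgamation hP hcof
  have hgraph : ∀ (δ : conjClosure γ) (s : Finset X) (p : Finset (X × X)),
      ExtendsPartial ((δ : G) : Equiv.Perm X) p → ∃ q ∈ F, p ⊆ q ∧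
        ∀ x ∈ s, (x, ((δ : G) : Equiv.Perm X) x) ∈ q := by
    intro δ s p hp
    obtain ⟨q, hq, h⟩ := hcof.2 (p ∪ s.image fun x => (x, ((δ : G) : Equiv.Perm X) x))
      ⟨δ, δ.2, fun e he => by
        rcases Finset.mem_union.1 he with he | he
        · exact hp e he
        · obtain ⟨x, -, rfl⟩ := Finset.mem_image.1 he
          rfl⟩
    exact ⟨q, hq, Finset.subset_union_left.trans h, fun x hx =>
      h (Finset.mem_union_right _ (Finset.mem_image_of_mem _ hx))⟩
  have hagree : ∀ (δ δ' : conjClosure γ) (p : Finset (X × X)),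
      (∀ x ∈ p.image Prod.fst, ((δ' : G) : Equiv.Perm X) x = ((δ : G) : Equiv.Perm X) x) →
      (ExtendsPartial ((δ : G) : Equiv.Perm X) p ↔ ExtendsPartial ((δ' : G) : Equiv.Perm X) p) :=
    fun δ δ' p h => forall₂_congr fun e he => by rw [h _ (Finset.mem_image_of_mem _ he)]
  have hE : ∀ r : Finset (X × X), {δ : conjClosure γ | ExtendsPartial ((δ : G) : Equiv.Perm X) r →
      ∃ q ∈ F, r ⊆ q ∧ ExtendsPartial ((δ : G) : Equiv.Perm X) q} ∈ residual (conjClosure γ) := by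
    intro r
    refine mem_residual_of_forall_extension (fun δ hδ => ?_) fun δ s => ?_
    · by_cases hr : ExtendsPartial ((δ : G) : Equiv.Perm X) r
      · obtain ⟨q, hq, hrq, hqδ⟩ := hδ hr
        exact ⟨q.image Prod.fst, fun δ' h _ => ⟨q, hq, hrq, (hagree δ δ' q h).1 hqδ⟩⟩
      · exact ⟨r.image Prod.fst, fun δ' h hr' => absurd ((hagree δ δ' r h).2 hr') hr⟩
    · by_cases hr : ExtendsPartial ((δ : G) : Equiv.Perm X) r
      · obtain ⟨q, hq, hrq, hs⟩ := hgraph δ s r hr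
        obtain ⟨δ', hδ', hq'⟩ := hcof.1 hq
        exact ⟨⟨δ', hδ'⟩, fun _ => ⟨q, hq, hrq, hq'⟩, fun x hx => hq' _ (hs x hx)⟩
      · exact ⟨δ, fun h => absurd h hr, fun _ _ => rfl⟩
  have hD : ∀ p q : Finset (X × X), {δ : conjClosure γ | p ∈ F → q ∈ F → p ⊆ q →
      ExtendsPartial ((δ : G) : Equiv.Perm X) p → ∃ α ∈ G, FixesSupport α p ∧
        ExtendsPartial ((δ : G) : Equiv.Perm X) (permAct α q)} ∈ residual (conjClosure γ) := by
    intro p q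
    by_cases hpq : p ∈ F ∧ q ∈ F ∧ p ⊆ q
    swap
    · refine Filter.mem_of_superset Filter.univ_mem fun δ _ h1 h2 h3 => absurd ⟨h1, h2, h3⟩ hpq
    obtain ⟨hp, hq, hpq⟩ := hpq
    refine mem_residual_of_forall_extension (fun δ hδ => ?_) fun δ s => ?_
    · by_cases hr : ExtendsPartial ((δ : G) : Equiv.Perm X) p
      · obtain ⟨α, hα, hfix, hqδ⟩ := hδ hp hq hpq hr
        exact ⟨(permAct α q).image Prod.fst, fun δ' h _ _ _ _ =>
          ⟨α, hα, hfix, (hagree δ δ' _ h).1 hqδ⟩⟩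
      · exact ⟨p.image Prod.fst, fun δ' h _ _ _ hr' => absurd ((hagree δ δ' p h).2 hr') hr⟩
    · by_cases hr : ExtendsPartial ((δ : G) : Equiv.Perm X) p
      · obtain ⟨p₁, hp₁, hpp₁, hs⟩ := hgraph δ s p hr
        obtain ⟨p₃, hp₃, α, hα, hfix, h1, h2⟩ := hamal p hp p₁ hp₁ q hq hpp₁ hpq
        obtain ⟨δ', hδ', hq'⟩ := hcof.1 hp₃
        exact ⟨⟨δ', hδ'⟩, fun _ _ _ _ => ⟨α, hα, hfix, hq'.mono h2⟩,
          fun x hx => hq' _ (h1 (hs x hx))⟩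
      · exact ⟨δ, fun _ _ _ h => absurd h hr, fun _ _ => rfl⟩
  refine Filter.mem_of_superset (Filter.inter_mem (countable_iInter_mem.2 hE)
    (countable_iInter_mem.2 fun p => countable_iInter_mem.2 (hD p))) ?_
  rintro δ ⟨h1, h2⟩
  simp only [Set.mem_iInter, Set.mem_ofPred_eq] at h1 h2
  have hext : IsExtensive G F ((δ : G) : Equiv.Perm X) :=
    ⟨h1, fun p hp q hq hpq => h2 p q hp hq hpq⟩
  obtain ⟨q, hq, -, hqδ⟩ := h1 ∅ (fun e he => absurd he (Finset.notMem_empty e))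
  obtain ⟨g, hg, hgq⟩ := id hq
  obtain ⟨e, he, hconj⟩ := (isExtensive_self hγ).exists_conj hG hinv hext (hinv g hg q hq)
    (G.inv_mem hg) hgq.1 (by rwa [permAct_inv_mul])
  exact isConj_iff.2 ⟨⟨e, he⟩, Subtype.ext hconj⟩

end

/-! ### Automorphisms of the betweenness relation -/

/-- Betweenness makes `g` monotone or antitone on each triple. Two pairs are compared through a
common upper point, so all pairs have the same orientation. -/
theorem strictMono_or_strictAnti {g : Equiv.Perm ℚ} (hg : g ∈ autRatBetween) :
    StrictMono g ∨ StrictAnti g := by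
  have h3 : ∀ x y z : ℚ, x < y → y < z → (g x < g y ∧ g y < g z) ∨ (g z < g y ∧ g y < g x) :=
    fun x y z h1 h2 => (hg y x z).2 (.inl ⟨h1, h2⟩)
  have key : ∀ x y z w : ℚ, x < y → z < w → g x < g y → g z < g w := by
    intro x y z w hxy hzw h
    obtain ⟨u, hu⟩ := exists_gt (max y w)
    have hyu := (le_max_left y w).trans_lt hu
    have hwu := (le_max_right y w).trans_lt hu
    have h1 : g x < g u := by
      rcases h3 x y u hxy hyu with h' | h'
      · exact h'.1.trans h'.2
      · exact absurd h h'.2.not_gt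
    have h2 : g z < g u := by
      rcases lt_trichotomy x z with hxz | rfl | hxz
      · rcases h3 x z u hxz (hzw.trans hwu) with h' | h'
        · exact h'.2
        · exact absurd h1 (h'.1.trans h'.2).not_gt
      · exact h1
      · rcases h3 z x u hxz (hxy.trans hyu) with h' | h'
        · exact h'.1.trans h'.2
        · exact absurd h1 h'.1.not_gt
    rcases h3 z w u hzw hwu with h' | h'
    · exact h'.1
    · exact absurd h2 (h'.1.trans h'.2).not_gt
  by_cases h : g 0 < g 1
  · exact .inl fun x y hxy => key 0 1 x y one_pos hxy h
  · refine .inr fun x y hxy => lt_of_le_of_ne (not_lt.1 fun h' => h (key x y 0 1 hxy one_pos h')) ?_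
    exact fun he => hxy.ne (g.injective he).symm

theorem mem_autRatBetween_of_strictMono {g : Equiv.Perm ℚ} (hg : StrictMono g) :
    g ∈ autRatBetween := fun x y z => by simp only [ratBetween, hg.lt_iff_lt]

theorem mem_autRatBetween_of_strictAnti {g : Equiv.Perm ℚ} (hg : StrictAnti g) :
    g ∈ autRatBetween := fun x y z => by simp only [ratBetween, hg.lt_iff_gt]; tauto

theorem mem_autRatBetween_of_forall_finset (e : Equiv.Perm ℚ)
    (h : ∀ s : Finset ℚ, ∃ g ∈ autRatBetween, ∀ x ∈ s, g x = e x) : e ∈ autRatBetween := by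
  intro x y z
  obtain ⟨g, hg, h⟩ := h {x, y, z}
  rw [← h x (by simp), ← h y (by simp), ← h z (by simp)]
  exact hg x y z

theorem isFinPartialIso_of_extends {g : Equiv.Perm ℚ} (hg : g ∈ autRatBetween)
    {p : Finset (ℚ × ℚ)} (hp : ExtendsPartial g p) : IsFinPartialIso p := by
  refine ⟨fun a ha b hb => ?_, fun a ha b hb c hc => ?_⟩
  · rw [← hp a ha, ← hp b hb, g.injective.eq_iff]
  · rw [← hp a ha, ← hp b hb, ← hp c hc]
    exact (hg a.1 b.1 c.1).symm

/-- `γ` reverses the order, `R` is the set of points to the right of its centre, and `τ` is the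
square of `γ` on `R`. -/
structure IsReversal (R : Set ℚ) (τ : R ≃o R) (γ : Equiv.Perm ℚ) : Prop where
  anti : StrictAnti γ
  mem : ∀ x, x ∈ R ↔ γ x < x
  sq : ∀ x : R, γ (γ x) = τ x

/-! ### Doubling maps of the right half -/

section

variable {R : Set ℚ} {τ τ' : R ≃o R} {γ γ' : Equiv.Perm ℚ}

theorem IsReversal.apply_mem (h : IsReversal R τ γ) {x : ℚ} (hx : x < γ x) : γ x ∈ R :=
  (h.mem _).2 (h.anti hx)

theorem IsReversal.lt_apply (h : IsReversal R τ γ) {x : ℚ} (hx : x ∈ R) : γ x < γ (γ x) :=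
  h.anti ((h.mem x).1 hx)

theorem IsReversal.inv_mem (h : IsReversal R τ γ) {x : ℚ} (hx : x < γ x) : γ⁻¹ x ∈ R := by
  rw [h.mem, ← h.anti.lt_iff_gt]
  simpa using hx

theorem IsReversal.delta_mono (h : IsReversal R τ γ) {x y : ℚ} (hxy : x < y) :
    x - γ x < y - γ y := by
  have := h.anti hxy
  linarith

open Classical in
/-- The symmetric extension of a map `f` of the right half to a map that carries `γ` to `γ'`. -/
noncomputable def doubleMap (R : Set ℚ) (γ γ' : Equiv.Perm ℚ) (f : ℚ → ℚ) (x : ℚ) : ℚ :=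
  if x ∈ R then f x else if x < γ x then γ' (f (γ⁻¹ x)) else x

theorem doubleMap_of_mem {f : ℚ → ℚ} {x : ℚ} (hx : x ∈ R) : doubleMap R γ γ' f x = f x :=
  if_pos hx

theorem IsReversal.doubleMap_of_lt (h : IsReversal R τ γ) {f : ℚ → ℚ} {x : ℚ} (hx : x < γ x) :
    doubleMap R γ γ' f x = γ' (f (γ⁻¹ x)) := by
  rw [doubleMap, if_neg (by rw [h.mem]; exact hx.not_gt), if_pos hx]

theorem IsReversal.doubleMap_of_eq (h : IsReversal R τ γ) {f : ℚ → ℚ} {x : ℚ} (hx : γ x = x) :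
    doubleMap R γ γ' f x = x := by
  rw [doubleMap, if_neg (by rw [h.mem]; exact hx.not_lt), if_neg hx.not_gt]

/-- The displacement `x - γ x` is strictly increasing, and its sign tells left half, centre and
right half apart. The doubled map respects these three parts, so only points of the same half need a
separate argument. -/
theorem IsReversal.strictMonoOn_doubleMap (h : IsReversal R τ γ) (h' : IsReversal R τ' γ')
    (hL : ∀ x, x < γ x ↔ x < γ' x) {f : ℚ → ℚ} {T : Set ℚ} (hf : StrictMonoOn f T)
    (hfR : ∀ x ∈ R, f x ∈ R) :
    StrictMonoOn (doubleMap R γ γ' f) {x | (x ∈ R → x ∈ T) ∧ (x < γ x → γ⁻¹ x ∈ T)} := by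
  have hsign : ∀ x, (0 < x - γ x → 0 < doubleMap R γ γ' f x - γ' (doubleMap R γ γ' f x)) ∧
      (x - γ x < 0 → doubleMap R γ γ' f x - γ' (doubleMap R γ γ' f x) < 0) ∧
      (x - γ x = 0 → doubleMap R γ γ' f x - γ' (doubleMap R γ γ' f x) = 0) := by
    intro x
    refine ⟨fun hx => ?_, fun hx => ?_, fun hx => ?_⟩
    · have hxR : x ∈ R := (h.mem x).2 (sub_pos.1 hx)
      rw [doubleMap_of_mem hxR]
      exact sub_pos.2 ((h'.mem _).1 (hfR x hxR))
    · have hxL := sub_neg.1 hx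
      rw [h.doubleMap_of_lt hxL]
      exact sub_neg.2 (h'.lt_apply (hfR _ (h.inv_mem hxL)))
    · have hxc : γ x = x := (sub_eq_zero.1 hx).symm
      rw [h.doubleMap_of_eq hxc]
      refine sub_eq_zero.2 (le_antisymm (not_lt.1 fun hlt => ?_) (not_lt.1 fun hlt => ?_))
      · exact hxc.not_lt ((h.mem x).1 ((h'.mem x).2 hlt))
      · exact hxc.not_gt ((hL x).2 hlt)
  intro x hx y hy hxy
  have hd := h.delta_mono hxy
  suffices hs : doubleMap R γ γ' f x - γ' (doubleMap R γ γ' f x) <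
      doubleMap R γ γ' f y - γ' (doubleMap R γ γ' f y) by
    by_contra hcon
    rcases (not_lt.1 hcon).eq_or_lt with he | he
    · rw [he] at hs
      exact lt_irrefl _ hs
    · exact (h'.delta_mono he).not_gt hs
  obtain ⟨x1, x2, x3⟩ := hsign x
  obtain ⟨y1, y2, y3⟩ := hsign y
  rcases lt_trichotomy (x - γ x) 0 with hx0 | hx0 | hx0
  · rcases lt_trichotomy (y - γ y) 0 with hy0 | hy0 | hy0
    · refine h'.delta_mono ?_
      have hxL := sub_neg.1 hx0
      have hyL := sub_neg.1 hy0
      rw [h.doubleMap_of_lt hxL, h.doubleMap_of_lt hyL]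
      refine h'.anti (hf (hy.2 hyL) (hx.2 hxL) ?_)
      rw [← h.anti.lt_iff_gt]
      simpa using hxy
    · exact (x2 hx0).trans_eq (y3 hy0).symm
    · exact (x2 hx0).trans (y1 hy0)
  · exact (x3 hx0).trans_lt (y1 (hx0 ▸ hd))
  · have hy0 := hx0.trans hd
    refine h'.delta_mono ?_
    have hxR : x ∈ R := (h.mem x).2 (sub_pos.1 hx0)
    have hyR : y ∈ R := (h.mem y).2 (sub_pos.1 hy0)
    rw [doubleMap_of_mem hxR, doubleMap_of_mem hyR]
    exact hf (hx.1 hxR) (hy.1 hyR) hxy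

/-- If the finite restrictions of the square on the right half embed, then so do the finite
restrictions of the reversal. -/
theorem IsReversal.exists_orderIso (h : IsReversal R τ γ) (h' : IsReversal R τ' γ')
    (hL : ∀ x, x < γ x ↔ x < γ' x) (hage : AgeLe τ τ') (s : Finset ℚ) :
    ∃ g : ℚ ≃o ℚ, ∀ x ∈ s, g (γ x) = γ' (g x) := by
  classical
  let t : Finset R := (s ∪ s.image γ ∪ s.image ⇑(γ⁻¹)).subtype (· ∈ R)
  have ht : ∀ x : R, (x : ℚ) ∈ s ∪ s.image γ ∪ s.image ⇑(γ⁻¹) → x ∈ t := fun x hx =>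
    Finset.mem_subtype.2 hx
  obtain ⟨f, hf⟩ := hage t
  let f' : ℚ → ℚ := fun x => if hx : x ∈ R then f ⟨x, hx⟩ else x
  have hf' : ∀ x : R, f' x = f x := fun x => dif_pos x.2
  have hf'R : ∀ x ∈ R, f' x ∈ R := fun x hx => by
    rw [show f' x = f ⟨x, hx⟩ from hf' ⟨x, hx⟩]
    exact (f ⟨x, hx⟩).2
  have hmono : StrictMonoOn f' ((↑) '' (t : Set R)) := by
    rintro _ ⟨x, hx, rfl⟩ _ ⟨y, hy, rfl⟩ hxy
    rw [hf', hf']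
    have := (hf x hx y hy).1
    rw [(cmp_eq_lt_iff x y).2 hxy] at this
    exact (cmp_eq_lt_iff _ _).1 this.symm
  have hD := h.strictMonoOn_doubleMap h' hL hmono hf'R
  obtain ⟨g, hg⟩ := exists_orderIso_rat (s ∪ s.image γ) (doubleMap R γ γ' f') (hD.mono (by
    intro x hx
    rw [Finset.mem_coe, Finset.mem_union, Finset.mem_image] at hx
    refine ⟨fun hxR => ⟨⟨x, hxR⟩, ht _ ?_, rfl⟩, fun hxL => ⟨⟨_, h.inv_mem hxL⟩, ht _ ?_, rfl⟩⟩
    · exact Finset.mem_union_left _ (Finset.mem_union.2 (hx.imp_right Finset.mem_image.2))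
    · rcases hx with hx | ⟨y, hy, rfl⟩
      · exact Finset.mem_union_right _ (Finset.mem_image_of_mem _ hx)
      · simp [hy]))
  refine ⟨g, fun x hx => ?_⟩
  rw [hg x (by simp [hx]), hg (γ x) (Finset.mem_union_right _ (Finset.mem_image_of_mem _ hx))]
  rcases lt_trichotomy x (γ x) with hxL | hxc | hxR
  · have hr := h.inv_mem hxL
    set r : R := ⟨γ⁻¹ x, hr⟩ with hrdef
    have hγr : γ r = x := by simp [hrdef]
    have hτr : ((τ r : R) : ℚ) = γ x := by rw [← h.sq, hγr]
    have hrt : r ∈ t := ht r (by simp [hrdef, hx])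
    have hτrt : τ r ∈ t := ht _ (by rw [hτr]; simp [hx])
    rw [doubleMap_of_mem (h.apply_mem hxL), h.doubleMap_of_lt hxL, ← hτr, hf']
    change _ = γ' (γ' (f' r))
    rw [hf', h'.sq]
    have := (hf _ hτrt _ hrt).2
    rw [cmp_self_eq_eq] at this
    rw [(cmp_eq_eq_iff _ _).1 this.symm]
  · rw [h.doubleMap_of_eq hxc.symm, ← hxc, h.doubleMap_of_eq hxc.symm]
    refine le_antisymm (not_lt.1 fun hlt => ?_) (not_lt.1 fun hlt => ?_)
    · exact hxc.symm.not_lt ((h.mem x).1 ((h'.mem x).2 hlt))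
    · exact hxc.symm.not_gt ((hL x).2 hlt)
  · have hxR' : x ∈ R := (h.mem x).2 hxR
    rw [doubleMap_of_mem hxR', h.doubleMap_of_lt (h.lt_apply hxR')]
    simp

/-- The support is carried to the right half and enlarged there to a determining set `t`. Putting
`γ` on `t`, and its second application where it stays in `t`, into `q` makes every increasing
embedding of `q` a partial embedding of `τ` on `t`; its extension is then doubled. -/
theorem IsReversal.exists_isHomogeneousIn (h : IsReversal R τ γ) (hτ : HasDeterminingSets τ)
    {p : Finset (ℚ × ℚ)} (hp : ExtendsPartial γ p) :
    ∃ q, p ⊆ q ∧ IsHomogeneousIn autRatBetween γ q := by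
  classical
  let s : Finset ℚ := p.image Prod.fst ∪ p.image Prod.snd
  obtain ⟨t, hst, ht⟩ := hτ ((s ∪ s.image ⇑(γ⁻¹)).subtype (· ∈ R))
  have hst : ∀ x : R, (x : ℚ) ∈ s ∨ (x : ℚ) ∈ s.image ⇑(γ⁻¹) → x ∈ t := fun x hx =>
    hst (Finset.mem_subtype.2 (Finset.mem_union.2 hx))
  let q : Finset (ℚ × ℚ) := p ∪ ((t.image fun r : R => ((r : ℚ), γ r)) ∪
    (t.filter fun r : R => τ r ∈ t).image fun r : R => (γ r, ((τ r : R) : ℚ)))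
  have hq : ∀ e, e ∈ q ↔ e ∈ p ∨ (∃ r ∈ t, ((r : ℚ), γ r) = e) ∨
      ∃ r : R, (r ∈ t ∧ τ r ∈ t) ∧ (γ r, ((τ r : R) : ℚ)) = e := fun e => by
    simp [q]
  have hqγ : ExtendsPartial γ q := fun e he => by
    rcases (hq e).1 he with he | ⟨r, -, rfl⟩ | ⟨r, -, rfl⟩
    · exact hp e he
    · rfl
    · exact h.sq r
  have hsupp : ∀ e ∈ q, ∀ x, x = e.1 ∨ x = e.2 →
      (∃ r ∈ t, x = (r : ℚ)) ∨ (∃ r ∈ t, x = γ r) ∨ (γ x = x ∧ (x, x) ∈ q) := by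
    intro e he x hx
    rcases (hq e).1 he with hep | ⟨r, hr, rfl⟩ | ⟨r, ⟨hr, hr'⟩, rfl⟩
    · have hxs : x ∈ s := by
        rcases hx with rfl | rfl
        · exact Finset.mem_union_left _ (Finset.mem_image_of_mem _ hep)
        · exact Finset.mem_union_right _ (Finset.mem_image_of_mem _ hep)
      rcases lt_trichotomy x (γ x) with hxL | hxc | hxR
      · exact .inr (.inl ⟨⟨_, h.inv_mem hxL⟩, hst _ (.inr (Finset.mem_image_of_mem _ hxs)),
          by simp⟩)
      · refine .inr (.inr ⟨hxc.symm, ?_⟩)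
        have h1 := hqγ e he
        have h2 : e = (x, x) := by
          rcases hx with rfl | rfl
          · exact Prod.ext rfl (h1.symm.trans hxc.symm)
          · exact Prod.ext (γ.injective (h1.trans hxc)) rfl
        exact h2 ▸ he
      · exact .inl ⟨⟨x, (h.mem x).2 hxR⟩, hst _ (.inl hxs), rfl⟩
    · rcases hx with rfl | rfl
      · exact .inl ⟨r, hr, rfl⟩
      · exact .inr (.inl ⟨r, hr, rfl⟩)
    · rcases hx with rfl | rfl
      · exact .inr (.inl ⟨r, hr, rfl⟩)
      · exact .inl ⟨τ r, hr', rfl⟩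
  have main : ∀ g : Equiv.Perm ℚ, StrictMono g → ExtendsPartial γ (permAct g q) →
      ∃ k ∈ autRatBetween, k * γ = γ * k ∧ ∀ e ∈ q, k e.1 = g e.1 ∧ k e.2 = g e.2 := by
    intro g hg hgq
    have hgq : ∀ a b : ℚ, (a, b) ∈ q → γ (g a) = g b := fun a b hab =>
      hgq _ (mem_permAct.2 ⟨_, hab, rfl⟩)
    have hg1 : ∀ r ∈ t, γ (g r) = g (γ r) := fun r hr =>
      hgq _ _ ((hq _).2 (.inr (.inl ⟨r, hr, rfl⟩)))
    have hg2 : ∀ r ∈ t, τ r ∈ t → γ (g (γ r)) = g ((τ r : R) : ℚ) := fun r hr hr' =>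
      hgq _ _ ((hq _).2 (.inr (.inr ⟨r, ⟨hr, hr'⟩, rfl⟩)))
    have hgR : ∀ r ∈ t, g (r : ℚ) ∈ R := fun r hr => by
      rw [h.mem, hg1 r hr]
      exact hg ((h.mem r).1 r.2)
    let f : R → R := fun r => if hr : g (r : ℚ) ∈ R then ⟨g r, hr⟩ else r
    have hf : ∀ r ∈ t, ((f r : R) : ℚ) = g r := fun r hr => by
      simp only [f, dif_pos (hgR r hr)]
    obtain ⟨k, hk, hkf⟩ := ht f (fun r hr r' hr' hrr' => by
        change ((f r : R) : ℚ) < f r'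
        rw [hf r hr, hf r' hr']
        exact hg hrr') (fun r hr hr' => by
        apply Subtype.ext
        rw [hf _ hr', ← hg2 r hr hr', ← hg1 r hr, ← hf r hr, h.sq])
    let k' : ℚ → ℚ := fun x => if hx : x ∈ R then k ⟨x, hx⟩ else x
    have hk' : ∀ x : R, k' x = k x := fun x => dif_pos x.2
    have hk'R : ∀ x ∈ R, k' x ∈ R := fun x hx => by
      rw [show k' x = k ⟨x, hx⟩ from hk' ⟨x, hx⟩]
      exact (k ⟨x, hx⟩).2
    have hmono : StrictMonoOn k' R := fun x hx y hy hxy => by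
      rw [show k' x = k ⟨x, hx⟩ from hk' ⟨x, hx⟩, show k' y = k ⟨y, hy⟩ from hk' ⟨y, hy⟩]
      exact k.strictMono (show (⟨x, hx⟩ : R) < ⟨y, hy⟩ from hxy)
    set K := doubleMap R γ γ k' with hKdef
    have hK : StrictMono K := by
      have := h.strictMonoOn_doubleMap h (fun _ => Iff.rfl) hmono hk'R
      exact fun x y hxy => this ⟨id, h.inv_mem⟩ ⟨id, h.inv_mem⟩ hxy
    have hKR : ∀ r : R, K r = k r := fun r => by rw [hKdef, doubleMap_of_mem r.2, hk']
    have hKL : ∀ r : R, K (γ r) = γ (k r) := fun r => by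
      rw [hKdef, h.doubleMap_of_lt (h.lt_apply r.2)]
      simp [hk']
    have hcases : ∀ x : ℚ, (∃ r : R, x = r) ∨ (∃ r : R, x = γ r) ∨ γ x = x := fun x => by
      rcases lt_trichotomy x (γ x) with hxL | hxc | hxR
      · exact .inr (.inl ⟨⟨_, h.inv_mem hxL⟩, by simp⟩)
      · exact .inr (.inr hxc.symm)
      · exact .inl ⟨⟨x, (h.mem x).2 hxR⟩, rfl⟩
    have hKs : Function.Surjective K := fun x => by
      rcases hcases x with ⟨r, rfl⟩ | ⟨r, rfl⟩ | hx
      · exact ⟨k.symm r, by rw [hKR, OrderIso.apply_symm_apply]⟩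
      · exact ⟨γ (k.symm r : R), by rw [hKL, OrderIso.apply_symm_apply]⟩
      · exact ⟨x, h.doubleMap_of_eq hx⟩
    refine ⟨Equiv.ofBijective K ⟨hK.injective, hKs⟩, mem_autRatBetween_of_strictMono hK, ?_,
      fun e he => ?_⟩
    · ext x
      change K (γ x) = γ (K x)
      rcases hcases x with ⟨r, rfl⟩ | ⟨r, rfl⟩ | hx
      · rw [hKL, hKR]
      · rw [hKL, h.sq, hKR, hk, h.sq]
      · rw [hx, hKdef, h.doubleMap_of_eq hx, hx]
    · have hval : ∀ x, x = e.1 ∨ x = e.2 → K x = g x := by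
        intro x hx
        rcases hsupp e he x hx with ⟨r, hr, rfl⟩ | ⟨r, hr, rfl⟩ | ⟨hxc, hxq⟩
        · rw [hKR, hkf r hr, hf r hr]
        · rw [hKL, hkf r hr, hf r hr, hg1 r hr]
        · rw [hKdef, h.doubleMap_of_eq hxc]
          have hgx := hgq x x hxq
          -- An order-reversing map has at most one fixed point, so the centre must go to itself.
          rcases lt_trichotomy x (g x) with hlt | heq | hlt
          · have := h.anti hlt
            rw [hgx, hxc] at this
            exact absurd hlt this.not_gt
          · exact heq
          · have := h.anti hlt
            rw [hgx, hxc] at this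
            exact absurd hlt this.not_gt
      exact ⟨hval _ (.inl rfl), hval _ (.inr rfl)⟩
  refine ⟨q, Finset.subset_union_left, hqγ, fun g hg hgq => ?_⟩
  rcases strictMono_or_strictAnti hg with hm | ha
  · exact main g hm hgq
  -- Since `γ` commutes with itself, composing a reversing embedding with `γ` gives an increasing
  -- one; `γ⁻¹` undoes this afterwards.
  · obtain ⟨k, hk, hc, he⟩ := main (γ * g) (fun x y hxy => h.anti (ha hxy)) (by
      rw [permAct_mul]
      exact hgq.permAct_of_commute rfl)
    refine ⟨γ⁻¹ * k, autRatBetween.mul_mem (autRatBetween.inv_mem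
      (mem_autRatBetween_of_strictAnti h.anti)) hk, ?_, fun e heq => ?_⟩
    · rw [mul_assoc, hc, inv_mul_cancel_left, mul_inv_cancel_left]
    · obtain ⟨h1, h2⟩ := he e heq
      exact ⟨by rw [Equiv.Perm.mul_apply, h1]; simp, by rw [Equiv.Perm.mul_apply, h2]; simp⟩

end

/-! ### The right half and the replacement of the square -/

section

variable {R : Set ℚ}

/-- The square of an order reversing permutation on the right of its centre. -/
theorem exists_isReversal (ρ : Equiv.Perm ℚ) (hρ : StrictAnti ρ) :
    ∃ σ : {x | ρ x < x} ≃o {x | ρ x < x}, IsReversal {x | ρ x < x} σ ρ := by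
  have hmem : ∀ x, ρ (ρ x) ∈ {x | ρ x < x} ↔ x ∈ {x | ρ x < x} := fun x => by
    simp only [Set.mem_ofPred_eq, hρ.lt_iff_gt]
  refine ⟨StrictMono.orderIsoOfSurjective (fun x => ⟨ρ (ρ x), (hmem x).2 x.2⟩)
    (fun x y hxy => hρ (hρ hxy)) fun y => ⟨⟨ρ⁻¹ (ρ⁻¹ y), ?_⟩, Subtype.ext (by simp)⟩,
    hρ, fun _ => Iff.rfl, fun _ => rfl⟩
  rw [← hmem]
  simp

variable {σ : R ≃o R} {ρ : Equiv.Perm ℚ}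

theorem IsReversal.mem_of_le (h : IsReversal R σ ρ) {x y : ℚ} (hx : x ∈ R) (hxy : x ≤ y) :
    y ∈ R := by
  rw [h.mem] at *
  exact (h.anti.antitone hxy).trans_lt (hx.trans_le hxy)

theorem IsReversal.nonempty (h : IsReversal R σ ρ) : Nonempty R := by
  refine ⟨⟨max 0 (ρ 0) + 1, (h.mem _).2 ?_⟩⟩
  have h1 := le_max_left 0 (ρ 0)
  have h2 := le_max_right 0 (ρ 0)
  have := h.anti (by linarith : (0 : ℚ) < max 0 (ρ 0) + 1)
  linarith

theorem IsReversal.denselyOrdered (h : IsReversal R σ ρ) : DenselyOrdered R :=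
  ⟨fun x y hxy => by
    obtain ⟨z, h1, h2⟩ := exists_between (show (x : ℚ) < y from hxy)
    exact ⟨⟨z, h.mem_of_le x.2 h1.le⟩, h1, h2⟩⟩

theorem IsReversal.noMaxOrder (h : IsReversal R σ ρ) : NoMaxOrder R :=
  ⟨fun x => ⟨⟨x + 1, h.mem_of_le x.2 (by linarith)⟩, by
    change (x : ℚ) < x + 1
    linarith⟩⟩

theorem IsReversal.noMinOrder (h : IsReversal R σ ρ) : NoMinOrder R :=
  ⟨fun x => by
    obtain ⟨b, hb1, hb2⟩ := exists_between ((h.mem x).1 x.2)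
    obtain ⟨a, ha1, ha2⟩ := exists_between hb1
    by_cases hb : b ∈ R
    · exact ⟨⟨b, hb⟩, hb2⟩
    -- If `b` is not in the right half, then `a < b` lies in the left half, and its preimage is a
    -- point of `R` below `x` because `ρ x < a`.
    · have hab := h.delta_mono ha2
      rw [h.mem, not_lt] at hb
      refine ⟨⟨ρ⁻¹ a, h.inv_mem (by linarith)⟩, ?_⟩
      change ρ⁻¹ a < x
      rw [← h.anti.lt_iff_gt]
      simpa using ha1⟩

/-- The square on the right half of a reversal can be replaced by any order automorphism. -/
theorem IsReversal.exists_replace (h : IsReversal R σ ρ) (τ : R ≃o R) :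
    ∃ γ : Equiv.Perm ℚ, IsReversal R τ γ ∧ ∀ x, x < ρ x ↔ x < γ x := by
  classical
  -- The new reversal is `κ * ρ`. It equals `ρ` on `R`, and its second application there is `τ ∘ σ⁻¹
  -- ∘ σ = τ`.
  let κ : Equiv.Perm ℚ := Equiv.Perm.ofSubtype (p := (· ∈ R)) (σ.symm.trans τ).toEquiv
  have hκ : ∀ x : R, κ x = (τ (σ.symm x) : R) := fun x =>
    Equiv.Perm.ofSubtype_apply_of_mem _ x.2
  have hκ' : ∀ x, x ∉ R → κ x = x := fun x hx => Equiv.Perm.ofSubtype_apply_of_not_mem _ hx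
  have hκR : ∀ x ∈ R, κ x ∈ R := fun x hx => by
    rw [hκ ⟨x, hx⟩]
    exact Subtype.prop _
  have hlt : ∀ x ∉ R, ∀ y ∈ R, x < y := fun x hx y hy =>
    lt_of_not_ge fun hyx => hx (h.mem_of_le hy hyx)
  have hmono : StrictMono κ := by
    intro x y hxy
    by_cases hx : x ∈ R
    · have hy := h.mem_of_le hx hxy.le
      rw [hκ ⟨x, hx⟩, hκ ⟨y, hy⟩]
      exact τ.strictMono (σ.symm.strictMono (show (⟨x, hx⟩ : R) < ⟨y, hy⟩ from hxy))
    · rw [hκ' x hx]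
      by_cases hy : y ∈ R
      · exact hlt x hx _ (hκR y hy)
      · rwa [hκ' y hy]
  have hR : ∀ x ∈ R, κ (ρ x) = ρ x := fun x hx => hκ' _ fun hmem =>
    ((h.mem _).1 hmem).not_gt (h.lt_apply hx)
  have hLft : ∀ x, x < ρ x → x < κ (ρ x) := fun x hx =>
    hlt x (fun hmem => ((h.mem x).1 hmem).not_gt hx) _ (hκR _ (h.apply_mem hx))
  have hC : ∀ x, ρ x = x → κ (ρ x) = x := fun x hx => by
    rw [hx]
    exact hκ' x fun hmem => ((h.mem x).1 hmem).ne hx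
  refine ⟨κ * ρ, ⟨fun x y hxy => hmono (h.anti hxy), fun x => ?_, fun x => ?_⟩, fun x => ?_⟩
  · rw [h.mem, Equiv.Perm.mul_apply]
    rcases lt_trichotomy x (ρ x) with hx | hx | hx
    · exact iff_of_false hx.not_gt (hLft x hx).not_gt
    · exact iff_of_false hx.symm.not_lt (hC x hx.symm).not_lt
    · rw [hR x ((h.mem x).2 hx)]
  · rw [Equiv.Perm.mul_apply, Equiv.Perm.mul_apply, hR x x.2, h.sq, hκ, OrderIso.symm_apply_apply]
  · rw [Equiv.Perm.mul_apply]
    rcases lt_trichotomy x (ρ x) with hx | hx | hx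
    · exact iff_of_true hx (hLft x hx)
    · exact iff_of_false hx.not_lt (hC x hx.symm).not_gt
    · rw [hR x ((h.mem x).2 hx)]

/-- Embedding each finite restriction of `γ` into `ρ` by an order automorphism exhibits conjugates
of `ρ` that agree with `γ` on any given finite set. -/
theorem IsReversal.mem_conjClosure {τ : R ≃o R} {ρ γ : autRatBetween}
    (hρ : IsReversal R σ (ρ : Equiv.Perm ℚ)) (hγ : IsReversal R τ (γ : Equiv.Perm ℚ))
    (hL : ∀ x, x < (γ : Equiv.Perm ℚ) x ↔ x < (ρ : Equiv.Perm ℚ) x) (hage : AgeLe τ σ) :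
    γ ∈ conjClosure ρ := by
  refine mem_conjClosure_iff.2 fun s => ?_
  obtain ⟨g, hg⟩ := hγ.exists_orderIso hρ hL hage s
  let g' : autRatBetween := ⟨g.toEquiv, mem_autRatBetween_of_strictMono g.strictMono⟩
  refine ⟨g'⁻¹, fun x hx => ?_⟩
  rw [inv_inv, Subgroup.coe_mul, Subgroup.coe_mul, Subgroup.coe_inv, Equiv.Perm.mul_apply,
    Equiv.Perm.mul_apply, Equiv.Perm.inv_eq_iff_eq]
  exact (hg x hx).symm

end

/-- An order reversing automorphism has the same conjugacy closure as some automorphism all of whose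
finite restrictions extend to homogeneous ones. -/
theorem exists_homogeneous_companion (ρ : autRatBetween)
    (hρ : StrictAnti (ρ : Equiv.Perm ℚ)) :
    ∃ γ : autRatBetween, conjClosure γ = conjClosure ρ ∧
      ∀ p, ExtendsPartial (γ : Equiv.Perm ℚ) p →
        ∃ q, p ⊆ q ∧ IsHomogeneousIn autRatBetween (γ : Equiv.Perm ℚ) q := by
  obtain ⟨σ, hσ⟩ := exists_isReversal ρ hρ
  have := hσ.nonempty
  have := hσ.denselyOrdered
  have := hσ.noMaxOrder
  have := hσ.noMinOrder
  obtain ⟨τ, h1, h2, hdet⟩ := exists_hasDeterminingSets σ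
  obtain ⟨γ, hγ, hL⟩ := hσ.exists_replace τ
  let γ' : autRatBetween := ⟨γ, mem_autRatBetween_of_strictAnti hγ.anti⟩
  have hγ' : IsReversal _ τ (γ' : Equiv.Perm ℚ) := hγ
  exact ⟨γ', (conjClosure_subset (hσ.mem_conjClosure hγ' (fun x => (hL x).symm) h2)).antisymm
    (conjClosure_subset (hγ'.mem_conjClosure hσ hL h1)),
    fun p hp => hγ.exists_isHomogeneousIn hdet hp⟩

theorem corollary5p3 (ρ : autRatBetween) (hρ : (ρ : Equiv.Perm ℚ) ∉ autRatLt) :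
    (∃ F : Set (Finset (ℚ × ℚ)),
      CofinalSubfamily F (partialIsos ρ) ∧
      InvariantFamily autRatBetween F ∧
      HasAmalgamation autRatBetween F) ∧
    ∃ γ ∈ conjClosure ρ, IsGenericIn (conjClosure ρ) γ := by
  have hanti : StrictAnti (ρ : Equiv.Perm ℚ) :=
    (strictMono_or_strictAnti ρ.2).resolve_left fun h => hρ fun _ _ => h.lt_iff_lt
  obtain ⟨γ, hC, hγ⟩ := exists_homogeneous_companion ρ hanti
  have hP : ∀ p, p ∈ partialIsos ρ ↔
      ∃ g ∈ autRatBetween, ExtendsPartial (γ : Equiv.Perm ℚ) (permAct g p) := fun p => by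
    rw [← exists_mem_conjClosure_iff, hC]
    -- Being a partial isomorphism is automatic for a restriction of an automorphism.
    exact ⟨fun h => h.2, fun ⟨δ, hδ, hp⟩ => ⟨isFinPartialIso_of_extends δ.2 hp, δ, hδ, hp⟩⟩
  have hcof := homogeneousFamily_cofinal hP hγ
  refine ⟨⟨_, hcof, homogeneousFamily_invariant _, homogeneousFamily_amalgamation hP hcof⟩,
    γ, ?_, ?_⟩
  · rw [← hC]
    exact subset_closure (IsConj.refl γ)
  · rw [← hC]
    exact isGenericIn_of_homogeneous γ mem_autRatBetween_of_forall_finset hγ
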